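/- Let $k$ be an algebraically closed field, let $A$ be a finite-dimensional $k$-algebra, and let $G$ be a finite group acting on $A$ by $k$-algebra automorphisms such that $|G|$ is invertible in $k$. Let $A*G$ be the skew group algebra: $A\otimes_k kG$ as a vector space, with $(a\otimes g)(a'\otimes g')=a\,g(a')\otimes gg'$. Write $\mathrm{Sim}(R)$ for the set of isomorphism classes of simple left $R$-modules and $P_L$ for a projective cover of $L$. For a partial order $\le$ on $\mathrm{Sim}(R)$, the standard module $\Delta_L$ is the quotient of $P_L$ by the sum of the images of all homomorphisms $P_{L'}\to P_L$ with $L'\not\le L$. The order is *adapted* if every finite-dimensional module with simple top $L$ and simple socle $L'$, where $L,L'$ are incomparable, has a composition factor $L''$ with $L''>L$ and $L''>L'$. The pair $(R,\le)$ is *quasi-hereditary* if $\le$ is adapted, ${}_RR$ has a finite filtration with standard subquotients, and $\mathrm{Ext}^1_R(\Delta_L,\Delta_L)=0$ and $\mathrm{End}_R(\Delta_L)\cong k$ for all $L$. It is *directed* if $\le$ is adapted and $\Delta_L\cong L$ for all $L$. Let $(R,\le_R)$ be quasi-hereditary, $C\subseteq R$ a (unital) subalgebra, and $\le_C$ a partial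 order on $\mathrm{Sim}(C)$. Then $(C,\le_C)$ is an *exact Borel subalgebra* of $(R,\le_R)$ if $R$ is projective as a right $C$-module, $(C,\le_C)$ is directed, and there is an isomorphism of partially ordered sets $i:\mathrm{Sim}(C)\to\mathrm{Sim}(R)$ with $R\otimes_C L\cong\Delta_{i(L)}$ for all $L\in\mathrm{Sim}(C)$. It is called * *strong* if $C$ contains a maximal semisimple subalgebra of $R$; * *normal* if the inclusion $C\to R$ has a splitting as right $C$-modules whose kernel is a right ideal of $R$; * *homological* if the maps $\mathrm{Ext}^n_C(L,L')\to\mathrm{Ext}^n_R(R\otimes_CL,R\otimes_CL')$ induced by the exact functor $R\otimes_C-$ are surjective for $n=1$ and bijective for $n\ge2$, for all $L,L'\in\mathrm{Sim}(C)$; * *regular* if it is normal and these maps are bijective for all $n\ge1$. Let $\le_A$ be a partial order on $\mathrm{Sim}(A)$ that is $G$-equivariant, i.e. $L<_AL'$ if and only if $gL<_AhL'$ for all $g,h\in G$, where $gL$ is $L$ with $a$ acting as $g^{-1}(a)$. Assume that $(A,\le_A)$ is quasi-hereditary. Let $\le_{A*G}$ be the partial order on $\mathrm{Sim}(A*G)$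 for which $S<_{A*G}S'$ if and only if $L<_AL'$ for all simple summands $L$ of $S|_A$ and $L'$ of $S'|_A$. Let $B\subseteq A$ be a subalgebra with $g(B)=B$ for all $g\in G$, and regard $B*G$ as a subalgebra of $A*G$. Then there is a partial order $\le_B$ on $\mathrm{Sim}(B)$ such that $(B,\le_B)$ is a strong exact Borel subalgebra of $(A,\le_A)$ if and only if there is a partial order $\le_{B*G}$ on $\mathrm{Sim}(B*G)$ such that $(B*G,\le_{B*G})$ is a strong exact Borel subalgebra of $(A*G,\le_{A*G})$. The same equivalence holds with "strong" replaced by "normal", by "homological", and by "regular". -/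

import Mathlib

open CategoryTheory
open scoped TensorProduct Pointwise

universe u

namespace QHSkew

section Tensor

variable {S R : Type u} [Ring S] [Ring R] (f : S →+* R)

/-- The relations `a f(s) ⊗ m = a ⊗ s m`, as a left `R`-submodule of `R ⊗_ℤ M`. -/
def tensorRelations (M : Type u) [AddCommGroup M] [Module S M] : Submodule R (R ⊗[ℤ] M) :=
  Submodule.span R
    {x | ∃ (a : R) (s : S) (m : M), x = (a * f s) ⊗ₜ[ℤ] m - a ⊗ₜ[ℤ] (s • m)}

/-- The left `R`-module `R ⊗_S M`, for a (not necessarily commutative) ring homomorphism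
`f : S → R` and a left `S`-module `M`. -/
abbrev TensorOver (M : Type u) [AddCommGroup M] [Module S M] : Type u :=
  (R ⊗[ℤ] M) ⧸ tensorRelations f M

/-- The class of `a ⊗ m` in `R ⊗_S M`. -/
def tensorMk {M : Type u} [AddCommGroup M] [Module S M] (a : R) (m : M) : TensorOver f M :=
  (tensorRelations f M).mkQ (a ⊗ₜ[ℤ] m)

section
variable {f} {M : Type u} [AddCommGroup M] [Module S M]

theorem tensorMk_add (a : R) (m n : M) :
    tensorMk f a (m + n) = tensorMk f a m + tensorMk f a n := by
  simp only [tensorMk, TensorProduct.tmul_add, map_add]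

theorem smul_tensorMk (b a : R) (m : M) : b • tensorMk f a m = tensorMk f (b * a) m := by
  simp only [tensorMk, ← map_smul]; rfl

theorem tensorMk_smul (a : R) (s : S) (m : M) :
    tensorMk f a (s • m) = tensorMk f (a * f s) m := by
  symm
  rw [← sub_eq_zero, tensorMk, tensorMk, ← map_sub, Submodule.mkQ_apply,
    Submodule.Quotient.mk_eq_zero]
  exact Submodule.subset_span ⟨a, s, m, rfl⟩

theorem tensorOver_hom_ext {N : Type u} [AddCommGroup N] {g h : TensorOver f M →+ N}
    (H : ∀ a m, g (tensorMk f a m) = h (tensorMk f a m)) : g = h := by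
  ext x
  obtain ⟨y, rfl⟩ := Submodule.mkQ_surjective _ x
  induction y with
  | zero => simp
  | tmul a m => exact H a m
  | add y z hy hz => simp only [map_add, hy, hz]

/-- The universal property of `R ⊗_S M`. -/
noncomputable def tensorLift {N : Type u} [AddCommGroup N] [Module R N] (g : M →+ N)
    (hg : ∀ (s : S) (m : M), g (s • m) = f s • g m) : TensorOver f M →ₗ[R] N :=
  (tensorRelations f M).liftQ
    (TensorProduct.AlgebraTensorModule.lift
      ((LinearMap.toSpanSingleton R (M →ₗ[ℤ] N) g.toIntLinearMap))) (by
    rw [tensorRelations, Submodule.span_le]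
    rintro _ ⟨a, s, m, rfl⟩
    simp [hg, mul_smul])

@[simp]
theorem tensorLift_mk {N : Type u} [AddCommGroup N] [Module R N] (g : M →+ N)
    (hg : ∀ (s : S) (m : M), g (s • m) = f s • g m) (a : R) (m : M) :
    tensorLift g hg (tensorMk f a m) = a • g m := by
  simp [tensorLift, tensorMk]

/-- The map `R ⊗_S M → R ⊗_S N` induced by an `S`-linear map `M → N`. -/
noncomputable def tensorMap {N : Type u} [AddCommGroup N] [Module S N] (g : M →ₗ[S] N) :
    TensorOver f M →ₗ[R] TensorOver f N :=
  tensorLift (AddMonoidHom.mk' (fun m => tensorMk f 1 (g m))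
      (fun m n => by rw [map_add, tensorMk_add]))
    (fun s m => by simp [tensorMk_smul, smul_tensorMk])

@[simp]
theorem tensorMap_mk {N : Type u} [AddCommGroup N] [Module S N] (g : M →ₗ[S] N) (a : R) (m : M) :
    tensorMap (f := f) g (tensorMk f a m) = tensorMk f a (g m) := by
  simp [tensorMap, smul_tensorMk]

theorem tensorOver_linearMap_ext {N : Type u} [AddCommGroup N] [Module R N]
    {g h : TensorOver f M →ₗ[R] N} (H : ∀ m, g (tensorMk f 1 m) = h (tensorMk f 1 m)) :
    g = h := by
  have : g.toAddMonoidHom = h.toAddMonoidHom := tensorOver_hom_ext fun a m => by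
    have := congrArg (a • ·) (H m)
    simpa [← map_smul, smul_tensorMk] using this
  ext1
  ext x
  exact DFunLike.congr_fun this _

end

/-- The functor `R ⊗_S -` from left `S`-modules to left `R`-modules. -/
noncomputable def induction : ModuleCat.{u} S ⥤ ModuleCat.{u} R where
  obj M := ModuleCat.of R (TensorOver f M)
  map g := ModuleCat.ofHom (tensorMap g.hom)
  map_id M := by
    ext1
    exact tensorOver_linearMap_ext fun m => by simp
  map_comp g h := by
    ext1
    exact tensorOver_linearMap_ext fun m => by simp

instance : (induction f).Additive where
  map_add := by
    intro M N g h
    ext1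
    exact tensorOver_linearMap_ext fun m => by
      change tensorMap (g.hom + h.hom) (tensorMk f 1 m) =
        tensorMap g.hom (tensorMk f 1 m) + tensorMap h.hom (tensorMk f 1 m)
      rw [tensorMap_mk, tensorMap_mk, tensorMap_mk, LinearMap.add_apply, tensorMk_add]

/-- The restriction of an `R`-linear map `R ⊗_S M → N` to `M`. -/
def tensorUnlift {M : ModuleCat.{u} S} {N : ModuleCat.{u} R} (g : TensorOver f M →ₗ[R] N) :
    M →ₗ[S] (ModuleCat.restrictScalars f).obj N where
  toFun m := g (tensorMk f 1 m)
  map_add' m n := by rw [tensorMk_add, map_add]; rfl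
  map_smul' s m := by
    rw [tensorMk_smul, one_mul, ← mul_one (f s), ← smul_tensorMk, map_smul]
    rfl

/-- The extension of an `S`-linear map `M → N`, with `N` an `R`-module, to `R ⊗_S M`. -/
noncomputable def tensorExtend {M : ModuleCat.{u} S} {N : ModuleCat.{u} R}
    (g : M →ₗ[S] (ModuleCat.restrictScalars f).obj N) : TensorOver f M →ₗ[R] N :=
  tensorLift (N := N) (AddMonoidHom.mk' (fun m => g m) (fun m n => g.map_add m n))
    (fun s m => g.map_smul s m)

theorem tensorExtend_mk {M : ModuleCat.{u} S} {N : ModuleCat.{u} R}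
    (g : M →ₗ[S] (ModuleCat.restrictScalars f).obj N) (m : M) :
    tensorExtend f g (tensorMk f 1 m) = g m :=
  (tensorLift_mk (N := N) (AddMonoidHom.mk' (fun m => g m) (fun m n => g.map_add m n))
    (fun s m => g.map_smul s m) 1 m).trans (one_smul R (show N from g m))

/-- `R ⊗_S -` is left adjoint to restriction of scalars. -/
noncomputable def inductionAdjunction : induction f ⊣ ModuleCat.restrictScalars.{u} f :=
  Adjunction.mkOfHomEquiv
    { homEquiv := fun M N =>
        { toFun := fun g => ModuleCat.ofHom (X := M) (Y := (ModuleCat.restrictScalars f).obj N)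
            (tensorUnlift f (M := M) (N := N) g.hom)
          invFun := fun g => ModuleCat.ofHom (X := TensorOver f M) (Y := N) (tensorExtend f g.hom)
          left_inv := fun g => by
            ext1
            exact tensorOver_linearMap_ext fun m => tensorExtend_mk f _ m
          right_inv := fun g => by
            ext m
            exact tensorExtend_mk f g.hom m }
      homEquiv_naturality_left_symm := fun {M' M N} g h => by
        ext1
        refine tensorOver_linearMap_ext fun m => ?_
        refine (tensorExtend_mk f (g ≫ h).hom m).trans (Eq.symm ?_)
        refine (congrArg (tensorExtend f h.hom) (tensorMap_mk g.hom 1 m)).trans ?_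
        exact tensorExtend_mk f h.hom (g.hom m)
      homEquiv_naturality_right := fun g h => by
        ext m
        rfl }

/-- `R` is projective as a right `S`-module. -/
def IsRightProjective : Prop :=
  letI : Module Sᵐᵒᵖ R := Module.compHom R (RingHom.op f)
  Module.Projective Sᵐᵒᵖ R

variable {f}

theorem tensorMap_injective (hf : IsRightProjective f) {M N : Type u} [AddCommGroup M] [Module S M]
    [AddCommGroup N] [Module S N] (g : M →ₗ[S] N) (hg : Function.Injective g) :
    Function.Injective (tensorMap (f := f) g) := by
  let _ : Module Sᵐᵒᵖ R := Module.compHom R (RingHom.op f)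
  obtain ⟨σ, hσ⟩ : Module.Projective Sᵐᵒᵖ R := hf
  have hact : ∀ (a : R) (s : S), a * f s = MulOpposite.op s • a := fun a s => rfl
  let φ₀ (L : Type u) [AddCommGroup L] [Module S L] : R ⊗[ℤ] L →+ (R →₀ L) :=
    TensorProduct.liftAddHom
        { toFun := fun a =>
            { toFun := fun m => (σ a).mapRange (fun s => s.unop • m) (by simp)
              map_zero' := by ext; simp
              map_add' := fun m n => by ext; simp }
          map_zero' := by ext; simp
          map_add' := fun a b => by ext; simp [add_smul] }
        (fun n a m => by rw [map_zsmul, map_zsmul]; rfl)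
  have hφ₀ (L : Type u) [AddCommGroup L] [Module S L] (a : R) (m : L) :
      φ₀ L (a ⊗ₜ m) = (σ a).mapRange (fun s => s.unop • m) (by simp) := rfl
  have hker (L : Type u) [AddCommGroup L] [Module S L] (x : R ⊗[ℤ] L)
      (hx : x ∈ tensorRelations f L) : ∀ r : R, φ₀ L (r • x) = 0 := by
    induction hx using Submodule.span_induction with
    | mem x h =>
      obtain ⟨a, s, m, rfl⟩ := h
      intro r
      rw [smul_sub, TensorProduct.smul_tmul', TensorProduct.smul_tmul', map_sub, hφ₀, hφ₀,
        smul_eq_mul, smul_eq_mul, ← mul_assoc, hact, map_smul, sub_eq_zero]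
      ext i
      simp [mul_smul]
    | zero => intro r; simp
    | add x y _ _ hx hy => intro r; rw [smul_add, map_add, hx, hy, add_zero]
    | smul a x _ hx => intro r; rw [smul_smul]; exact hx _
  have hψ (x : R ⊗[ℤ] M) : ((φ₀ M x).sum fun i m => tensorMk f i m) =
      (tensorRelations f M).mkQ x := by
    induction x with
    | zero => simp
    | tmul a m =>
      rw [hφ₀, Finsupp.sum_mapRange_index (by intro i; simp [tensorMk])]
      change _ = tensorMk f a m
      conv_rhs => rw [← hσ a]
      rw [Finsupp.linearCombination_apply, Finsupp.sum, Finsupp.sum, tensorMk,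
        TensorProduct.sum_tmul, map_sum]
      refine Finset.sum_congr rfl fun i _ => ?_
      rw [tensorMk_smul]
      rfl
    | add x y hx hy =>
      rw [map_add, map_add, Finsupp.sum_add_index' (by intro i; simp [tensorMk])
        (by intro i m n; exact tensorMk_add i m n), hx, hy]
  have hnat (x : R ⊗[ℤ] M) : φ₀ N (LinearMap.lTensor R (g.toAddMonoidHom.toIntLinearMap) x) =
      Finsupp.mapRange.addMonoidHom g.toAddMonoidHom (φ₀ M x) := by
    induction x with
    | zero => simp
    | tmul a m => rw [LinearMap.lTensor_tmul, hφ₀, hφ₀]; ext i; simp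
    | add x y hx hy => simp only [map_add, hx, hy]
  have hmap (x : R ⊗[ℤ] M) : tensorMap (f := f) g ((tensorRelations f M).mkQ x) =
      (tensorRelations f N).mkQ (LinearMap.lTensor R (g.toAddMonoidHom.toIntLinearMap) x) := by
    induction x with
    | zero => simp
    | tmul a m => exact tensorMap_mk g a m
    | add x y hx hy => simp only [map_add, hx, hy]
  rw [injective_iff_map_eq_zero]
  intro t ht
  obtain ⟨x, rfl⟩ := Submodule.mkQ_surjective _ t
  rw [hmap, Submodule.mkQ_apply, Submodule.Quotient.mk_eq_zero] at ht
  have h1 := hker N _ ht 1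
  rw [one_smul, hnat] at h1
  have h2 : φ₀ M x = 0 :=
    Finsupp.mapRange_injective _ (map_zero g) hg (h1.trans (by ext; simp))
  rw [← hψ, h2, Finsupp.sum_zero_index]

/-- If `R` is projective as a right `S`-module, then `R ⊗_S -` is exact. -/
theorem induction_exact (hf : IsRightProjective f) :
    Limits.PreservesFiniteLimits (induction f) ∧ Limits.PreservesFiniteColimits (induction f) := by
  have hadj : Limits.PreservesColimitsOfSize.{0, 0} (induction f) :=
    (inductionAdjunction f).leftAdjoint_preservesColimits
  have hc : Limits.PreservesFiniteColimits (induction f) := inferInstance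
  refine ⟨?_, hc⟩
  rw [Functor.preservesFiniteLimits_iff_forall_exact_map_and_mono]
  intro T hT
  refine ⟨(((induction f).preservesFiniteColimits_iff_forall_exact_map_and_epi).1 hc T hT).1, ?_⟩
  rw [ModuleCat.mono_iff_injective]
  exact tensorMap_injective hf _ ((ModuleCat.mono_iff_injective _).1 hT.mono_f)

/-- The map `Ext_S^n(M, N) → Ext_R^n(R ⊗_S M, R ⊗_S N)` induced by the exact functor `R ⊗_S -`,
where `R` is projective as a right `S`-module. -/
noncomputable def inductionExtMap (hf : IsRightProjective f) (M N : ModuleCat.{u} S) (n : ℕ) :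
    Abelian.Ext.{u} M N n →+ Abelian.Ext.{u} ((induction f).obj M) ((induction f).obj N) n :=
  haveI := (induction_exact hf).1
  haveI := (induction_exact hf).2
  (induction f).mapExtAddHom M N n

end Tensor

/-! ### Simple modules -/

section Simple

variable (R : Type u) [Ring R]

/-- Isomorphism of simple left `R`-modules. -/
def simpleSetoid : Setoid {M : ModuleCat.{u} R // IsSimpleModule R M} where
  r M N := Nonempty (M.1 ≃ₗ[R] N.1)
  iseqv :=
    { refl := fun _ => ⟨LinearEquiv.refl R _⟩
      symm := fun ⟨e⟩ => ⟨e.symm⟩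
      trans := fun ⟨e⟩ ⟨e'⟩ => ⟨e.trans e'⟩ }

/-- The set of isomorphism classes of simple left `R`-modules. -/
def Sim : Type (u + 1) := Quotient (simpleSetoid R)

variable {R}

/-- A chosen representative of an isomorphism class of simple modules. -/
noncomputable def Sim.rep (L : Sim R) : ModuleCat.{u} R :=
  (@Quotient.out _ (simpleSetoid R) L).1

instance (L : Sim R) : IsSimpleModule R L.rep :=
  (@Quotient.out _ (simpleSetoid R) L).2

/-- The isomorphism class of a simple module. -/
def Sim.of (M : ModuleCat.{u} R) (hM : IsSimpleModule R M) : Sim R :=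
  @Quotient.mk _ (simpleSetoid R) ⟨M, hM⟩

theorem Sim.rep_of (M : ModuleCat.{u} R) (hM : IsSimpleModule R M) :
    Nonempty ((Sim.of M hM).rep ≃ₗ[R] M) :=
  @Quotient.mk_out _ (simpleSetoid R) ⟨M, hM⟩

variable (M N : Type u) [AddCommGroup M] [Module R M] [AddCommGroup N] [Module R N]

/-- `N` is isomorphic to a direct summand of `M`. -/
def IsSummand : Prop :=
  ∃ (i : N →ₗ[R] M) (p : M →ₗ[R] N), p ∘ₗ i = LinearMap.id

/-- The simple module `L` is a composition factor of `M`. -/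
def IsCompositionFactor (L : Sim R) : Prop :=
  ∃ N₁ N₂ : Submodule R M, N₁ ≤ N₂ ∧ Nonempty ((N₂ ⧸ N₁.submoduleOf N₂) ≃ₗ[R] L.rep)

/-- The top `M / rad M` of a module, where `rad M` is the intersection of the maximal
submodules of `M`. -/
abbrev ModuleTop : Type u := M ⧸ Module.jacobson R M

/-- The socle of a module: the sum of its simple submodules. -/
def socle : Submodule R M := sSup {N : Submodule R M | IsSimpleModule R N}

end Simple

/-! ### Quasi-hereditary algebras -/

section QuasiHereditary

variable {R : Type u} [Ring R]

/-- The partial order `le` on the simple modules is adapted: every finitely generated module with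
simple top `L` and simple socle `L'`, where `L` and `L'` are incomparable, has a composition
factor `L''` with `L < L''` and `L' < L''`. -/
def IsAdapted (le : PartialOrder (Sim R)) : Prop :=
  ∀ M : ModuleCat.{u} R, Module.Finite R M → ∀ L L' : Sim R,
    Nonempty (ModuleTop (R := R) M ≃ₗ[R] L.rep) → Nonempty (socle (R := R) M ≃ₗ[R] L'.rep) →
    ¬ le.le L L' → ¬ le.le L' L →
    ∃ L'' : Sim R, IsCompositionFactor M L'' ∧ le.lt L L'' ∧ le.lt L' L''

/-- `π : P → M` is a projective cover: `P` is projective and `π` is surjective with superfluous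
kernel. -/
structure IsProjectiveCover {P M : Type u} [AddCommGroup P] [Module R P] [AddCommGroup M]
    [Module R M] (π : P →ₗ[R] M) : Prop where
  projective : Module.Projective R P
  surjective : Function.Surjective π
  superfluous : ∀ N : Submodule R P, N ⊔ LinearMap.ker π = ⊤ → N = ⊤

/-- The sum of the images of all homomorphisms `P_{L'} → P` with `L' ≰ L`, where `P_{L'}` is a
projective cover of `L'`. -/
def standardKernel (le : PartialOrder (Sim R)) (L : Sim R) (P : Type u) [AddCommGroup P]
    [Module R P] : Submodule R P :=
  sSup {N | ∃ (L' : Sim R) (Q : ModuleCat.{u} R) (ρ : Q →ₗ[R] L'.rep) (φ : Q →ₗ[R] P),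
    ¬ le.le L' L ∧ IsProjectiveCover ρ ∧ N = LinearMap.range φ}

/-- `D` is isomorphic to the standard module `Δ_L`, the quotient of the projective cover `P_L` of
`L` by the sum of the images of all homomorphisms `P_{L'} → P_L` with `L' ≰ L`. -/
def IsStandard (le : PartialOrder (Sim R)) (L : Sim R) (D : Type u) [AddCommGroup D]
    [Module R D] : Prop :=
  ∃ (P : ModuleCat.{u} R) (π : P →ₗ[R] L.rep), IsProjectiveCover π ∧
    Nonempty (D ≃ₗ[R] (P ⧸ standardKernel le L P))

/-- `M` belongs to `F(Δ)`: it has a finite filtration whose subquotients are standard modules. -/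
def HasStandardFiltration (le : PartialOrder (Sim R)) (M : Type u) [AddCommGroup M]
    [Module R M] : Prop :=
  ∃ (m : ℕ) (F : ℕ → Submodule R M), Monotone F ∧ F 0 = ⊥ ∧ F m = ⊤ ∧
    ∀ j < m, ∃ L : Sim R, IsStandard le L (F (j + 1) ⧸ (F j).submoduleOf (F (j + 1)))

/-- `M` is exceptional: `Ext¹(M, M) = 0` and `End(M) = k`, i.e. every endomorphism is
multiplication by a unique scalar. -/
def IsExceptional (k : Type u) [Field k] [Algebra k R] (M : ModuleCat.{u} R) : Prop :=
  Subsingleton (Abelian.Ext.{u} M M 1) ∧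
    ∀ φ : M →ₗ[R] M, ∃! c : k, ∀ m : M, φ m = algebraMap k R c • m

/-- `(R, le)` is a quasi-hereditary `k`-algebra. -/
structure IsQuasiHereditary (k : Type u) [Field k] [Algebra k R] (le : PartialOrder (Sim R)) :
    Prop where
  adapted : IsAdapted le
  filtration : HasStandardFiltration le R
  exceptional : ∀ (L : Sim R) (D : ModuleCat.{u} R), IsStandard le L D → IsExceptional k D

/-- `(R, le)` is directed: `le` is adapted and every standard module is simple. -/
structure IsDirected (le : PartialOrder (Sim R)) : Prop where
  adapted : IsAdapted le
  standard_simple : ∀ L : Sim R, IsStandard le L L.rep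

end QuasiHereditary

/-! ### Exact Borel subalgebras -/

section Borel

variable {k A : Type u} [Field k] [Ring A] [Algebra k A]

/-- The inclusion of a subalgebra, as a ring homomorphism. -/
abbrev incl (B : Subalgebra k A) : B →+* A := B.val.toRingHom

/-- `(B, leB)` is an exact Borel subalgebra of the quasi-hereditary algebra `(A, leA)`. The
bijection `i` between the simple modules is an isomorphism of partially ordered sets. -/
structure IsExactBorel (leA : PartialOrder (Sim A))
    (B : Subalgebra k A) (leB : PartialOrder (Sim B)) : Prop where
  quasiHereditary : IsQuasiHereditary k leA
  projective : IsRightProjective (incl B)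
  directed : IsDirected leB
  standard : ∃ i : Sim B ≃ Sim A, (∀ L L' : Sim B, leB.le L L' ↔ leA.le (i L) (i L')) ∧
    ∀ L : Sim B, IsStandard leA (i L) ((induction (incl B)).obj L.rep)

/-- A strong exact Borel subalgebra: `B` contains a maximal semisimple subalgebra of `A`. -/
structure IsStrongExactBorel (leA : PartialOrder (Sim A))
    (B : Subalgebra k A) (leB : PartialOrder (Sim B)) : Prop extends
    IsExactBorel leA B leB where
  strong : ∃ C : Subalgebra k A, Maximal (fun C : Subalgebra k A => IsSemisimpleRing C) C ∧ C ≤ B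

/-- A normal exact Borel subalgebra: the inclusion `B → A` has a splitting `π` as a map of right
`B`-modules whose kernel is a right ideal of `A`. -/
structure IsNormalExactBorel (leA : PartialOrder (Sim A))
    (B : Subalgebra k A) (leB : PartialOrder (Sim B)) : Prop extends
    IsExactBorel leA B leB where
  normal : ∃ π : A →+ B, (∀ b : B, π b = b) ∧ (∀ (a : A) (b : B), π (a * b) = π a * b) ∧
    ∀ a x : A, π a = 0 → π (a * x) = 0

/-- A homological exact Borel subalgebra: the maps `Ext_B^n(L, L') → Ext_A^n(A ⊗_B L, A ⊗_B L')`
for simple `B`-modules `L`, `L'` are surjective for `n = 1` and bijective for `n ≥ 2`. -/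
structure IsHomologicalExactBorel
    (leA : PartialOrder (Sim A)) (B : Subalgebra k A) (leB : PartialOrder (Sim B)) : Prop extends
    IsExactBorel leA B leB where
  ext_one : ∀ L L' : Sim B,
    Function.Surjective (inductionExtMap (f := incl B) projective L.rep L'.rep 1)
  ext_ge_two : ∀ (L L' : Sim B) (n : ℕ), 2 ≤ n →
    Function.Bijective (inductionExtMap (f := incl B) projective L.rep L'.rep n)

/-- A regular exact Borel subalgebra: it is normal, and the maps
`Ext_B^n(L, L') → Ext_A^n(A ⊗_B L, A ⊗_B L')` for simple `B`-modules `L`, `L'` are bijective for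
`n ≥ 1`. -/
structure IsRegularExactBorel (leA : PartialOrder (Sim A))
    (B : Subalgebra k A) (leB : PartialOrder (Sim B)) : Prop extends
    IsNormalExactBorel leA B leB where
  ext_ge_one : ∀ (L L' : Sim B) (n : ℕ), 1 ≤ n →
    Function.Bijective (inductionExtMap (f := incl B) projective L.rep L'.rep n)

end Borel

/-! ### Group actions and skew group algebras -/

section Skew

variable {k A G : Type u} [Field k] [Ring A] [Algebra k A] [Group G] [MulSemiringAction G A]

/-- The twist `gM` of an `A`-module: the same additive group, on which `a` acts as `g⁻¹(a)`. -/
noncomputable abbrev twist (g : G) (M : ModuleCat.{u} A) : ModuleCat.{u} A :=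
  (ModuleCat.restrictScalars.{u} (MulSemiringAction.toRingHom G A g⁻¹)).obj M

theorem isSimpleModule_twist (g : G) (M : ModuleCat.{u} A) (hM : IsSimpleModule A M) :
    IsSimpleModule A (twist g M) := by
  have : RingHomSurjective (MulSemiringAction.toRingHom G A g⁻¹) :=
    ⟨fun a => ⟨g • a, by simp⟩⟩
  let l : twist g M →ₛₗ[MulSemiringAction.toRingHom G A g⁻¹] M :=
    { toFun := fun m => m
      map_add' := fun _ _ => rfl
      map_smul' := fun _ _ => rfl }
  exact (LinearMap.isSimpleModule_iff_of_bijective l Function.bijective_id).2 hM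

/-- The action `L ↦ gL` on isomorphism classes of simple modules. -/
noncomputable def Sim.twist (g : G) (L : Sim A) : Sim A :=
  Sim.of (QHSkew.twist g L.rep) (isSimpleModule_twist g L.rep inferInstance)

variable (G) in
/-- A partial order on the simple `A`-modules is `G`-equivariant if `L < L'` holds if and only if
`gL < hL'` for all `g, h ∈ G`. -/
def IsEquivariantOrder (le : PartialOrder (Sim A)) : Prop :=
  ∀ L L' : Sim A, le.lt L L' ↔ ∀ g h : G, le.lt (L.twist g) (L'.twist h)

/-- Restriction of `A * G`-modules to `A`, along `a ↦ a ⊗ e`. The skew group algebra `A * G` is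
`SkewMonoidAlgebra A G`, with `(a ⊗ g)(a' ⊗ g') = a g(a') ⊗ g g'`. -/
noncomputable abbrev restrict (M : ModuleCat.{u} (SkewMonoidAlgebra A G)) : ModuleCat.{u} A :=
  (ModuleCat.restrictScalars.{u}
    (SkewMonoidAlgebra.singleOneRingHom : A →+* SkewMonoidAlgebra A G)).obj M

/-- `S < S'` for simple `A * G`-modules, if `L < L'` for all simple summands `L` of the restriction
of `S` and `L'` of the restriction of `S'` to `A`. -/
def inducedLT (le : PartialOrder (Sim A)) (S S' : Sim (SkewMonoidAlgebra A G)) : Prop :=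
  ∀ L L' : Sim A, IsSummand (R := A) (restrict S.rep) L.rep →
    IsSummand (R := A) (restrict S'.rep) L'.rep → le.lt L L'

/-- The restriction to `A` of a simple `A * G`-module has a simple submodule and is semisimple. -/
theorem restrict_semisimple [IsArtinianRing A] [Finite G] (M : Type u) [AddCommGroup M]
    [Module (SkewMonoidAlgebra A G) M] [Module A M]
    (hA : ∀ (a : A) (m : M), a • m = (SkewMonoidAlgebra.single (1 : G) a) • m)
    [IsSimpleModule (SkewMonoidAlgebra A G) M] :
    (∃ N : Submodule A M, IsSimpleModule A N) ∧ IsSemisimpleModule A M := by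
  have hspan : ∀ m : M, m ≠ 0 → Submodule.span A
      (Set.range fun g : G => (SkewMonoidAlgebra.single g (1 : A)) • m) = ⊤ := by
    intro m hm
    rw [eq_top_iff]
    rintro x -
    obtain ⟨y, rfl⟩ := IsSimpleModule.toSpanSingleton_surjective (SkewMonoidAlgebra A G) hm x
    rw [LinearMap.toSpanSingleton_apply]
    induction y using SkewMonoidAlgebra.induction_on with
    | zero => simp
    | single g a =>
      have : SkewMonoidAlgebra.single g a =
          SkewMonoidAlgebra.single (1 : G) a * SkewMonoidAlgebra.single g (1 : A) := by simp
      rw [this, mul_smul, ← hA]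
      exact Submodule.smul_mem _ _ (Submodule.subset_span ⟨g, rfl⟩)
    | add x y hx hy => rw [add_smul]; exact Submodule.add_mem _ hx hy
  have : Nontrivial M := IsSimpleModule.nontrivial (SkewMonoidAlgebra A G) M
  obtain ⟨m, hm⟩ := exists_ne (0 : M)
  have hfin : Module.Finite A M := ⟨Submodule.fg_def.2 ⟨_, Set.finite_range _, hspan m hm⟩⟩
  obtain ⟨N, hN, -⟩ := (eq_bot_or_exists_atom_le (⊤ : Submodule A M)).resolve_left top_ne_bot
  have hNs : IsSimpleModule A N := isSimpleModule_iff_isAtom.2 hN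
  refine ⟨⟨N, hNs⟩, IsSemisimpleModule.of_sSup_simples_eq_top ?_⟩
  obtain ⟨n, hn, hn0⟩ := N.exists_mem_ne_zero_of_ne_bot hN.1
  rw [eq_top_iff, ← hspan n hn0, Submodule.span_le]
  rintro _ ⟨g, rfl⟩
  have : RingHomSurjective (MulSemiringAction.toRingHom G A g) := ⟨fun a => ⟨g⁻¹ • a, by simp⟩⟩
  let l : M →ₛₗ[MulSemiringAction.toRingHom G A g] M :=
    { toFun := fun m => (SkewMonoidAlgebra.single g (1 : A)) • m
      map_add' := fun _ _ => smul_add _ _ _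
      map_smul' := fun a m => by simp [hA, smul_smul] }
  have hl : Function.Injective l := by
    intro x y hxy
    have := congrArg (fun z => (SkewMonoidAlgebra.single g⁻¹ (1 : A)) • z) hxy
    simpa [l, smul_smul, ← SkewMonoidAlgebra.one_def] using this
  let l' : N →ₛₗ[MulSemiringAction.toRingHom G A g] (N.map l) :=
    (l.comp N.subtype).codRestrict (N.map l) (fun x => ⟨x, x.2, rfl⟩)
  have hl' : Function.Bijective l' := by
    constructor
    · intro x y hxy
      exact Subtype.ext (hl (congrArg Subtype.val hxy))
    · rintro ⟨_, x, hx, rfl⟩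
      exact ⟨⟨x, hx⟩, rfl⟩
  have hs : IsSimpleModule A (N.map l) := (LinearMap.isSimpleModule_iff_of_bijective l' hl').1 hNs
  exact (le_sSup (a := N.map l) hs) ⟨n, hn, rfl⟩

theorem exists_summand_restrict [IsArtinianRing A] [Finite G]
    (M : ModuleCat.{u} (SkewMonoidAlgebra A G)) (hM : IsSimpleModule (SkewMonoidAlgebra A G) M) :
    ∃ L : Sim A, IsSummand (R := A) (restrict M) L.rep := by
  obtain ⟨⟨N, hN⟩, hss⟩ : (∃ N : Submodule A (restrict M), IsSimpleModule A N) ∧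
      IsSemisimpleModule A (restrict M) :=
    @restrict_semisimple A G _ _ _ _ _ M M.isAddCommGroup M.isModule
      (restrict M).isModule (fun _ _ => rfl) hM
  obtain ⟨N', hN'⟩ := exists_isCompl N
  obtain ⟨e⟩ := Sim.rep_of (ModuleCat.of A N) hN
  refine ⟨Sim.of (ModuleCat.of A N) hN, N.subtype ∘ₗ e.toLinearMap,
    e.symm.toLinearMap ∘ₗ N.projectionOnto N' hN', LinearMap.ext fun x => ?_⟩
  change e.symm (N.projectionOnto N' hN' (e x : N)) = x
  rw [Submodule.projectionOnto_apply_left]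
  exact e.symm_apply_apply x

variable (k) in
/-- The partial order on the simple `A * G`-modules induced by a partial order on the simple
`A`-modules. -/
@[reducible]
noncomputable def inducedOrder [FiniteDimensional k A] [Finite G] (le : PartialOrder (Sim A)) :
    PartialOrder (Sim (SkewMonoidAlgebra A G)) :=
  have : IsArtinianRing A := IsArtinianRing.of_finite k A
  have hasymm : ∀ S S' : Sim (SkewMonoidAlgebra A G),
      inducedLT le S S' → ¬ inducedLT le S' S := fun S S' h h' => by
    obtain ⟨L, hL⟩ := exists_summand_restrict S.rep inferInstance
    obtain ⟨L', hL'⟩ := exists_summand_restrict S'.rep inferInstance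
    exact lt_asymm (h L L' hL hL') (h' L' L hL' hL)
  { le := fun S S' => S = S' ∨ inducedLT le S S'
    lt := inducedLT le
    le_refl := fun S => Or.inl rfl
    le_trans := fun S S' S'' => by
      rintro (rfl | h) (rfl | h')
      · exact Or.inl rfl
      · exact Or.inr h'
      · exact Or.inr h
      · obtain ⟨L', hL'⟩ := exists_summand_restrict S'.rep inferInstance
        exact Or.inr fun L L'' hL hL'' => lt_trans (h L L' hL hL') (h' L' L'' hL' hL'')
    le_antisymm := fun S S' => by
      rintro (rfl | h) (h' | h')
      · rfl
      · rfl
      · exact h'.symm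
      · exact absurd h' (hasymm S S' h)
    lt_iff_le_not_ge := fun S S' => by
      constructor
      · intro h
        refine ⟨Or.inr h, ?_⟩
        rintro (rfl | h')
        · exact hasymm _ _ h h
        · exact hasymm _ _ h h'
      · rintro ⟨rfl | h, h'⟩
        · exact absurd (Or.inl rfl) h'
        · exact h }

variable [SMulCommClass G k A]

/-- The subalgebra `B * G` of `A * G`, for a subalgebra `B` of `A` with `g(B) = B` for all `g`. -/
def skewSubalgebra (B : Subalgebra k A) (hB : ∀ g : G, B.map (MulSemiringAction.toAlgHom k A g) = B) :
    Subalgebra k (SkewMonoidAlgebra A G) where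
  carrier := {x | ∀ g : G, x.coeff g ∈ B}
  mul_mem' {x y} hx hy g := by
    rw [SkewMonoidAlgebra.coeff_mul_left]
    refine B.sum_mem fun h _ => B.mul_mem (hx h) ?_
    have : h • y.coeff (h⁻¹ * g) ∈ B.map (MulSemiringAction.toAlgHom k A h) := ⟨_, hy _, rfl⟩
    rwa [hB h] at this
  add_mem' hx hy g := by
    rw [SkewMonoidAlgebra.coeff_add]
    exact B.add_mem (hx g) (hy g)
  algebraMap_mem' c g := by
    classical
    rw [SkewMonoidAlgebra.coe_algebraMap, Function.comp_apply, SkewMonoidAlgebra.coeff_single_apply]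
    split_ifs
    · exact B.algebraMap_mem c
    · exact B.zero_mem

end Skew

end QHSkew

namespace QHSkew

/-! ### Composition factors and projective covers over Artinian rings -/

section SimBasic

variable {R : Type u} [Ring R]

/-! Write T for A * G. Because |G| is invertible, A → T is a split and separable Frobenius
extension. Restriction U and induction V are therefore adjoint to each other on both sides, hence
exact. Each identity functor is a natural retract of a composite of U and V, and both functors
preserve finite generation and semisimplicity. The same holds for B → B * G, and the inductions A
⊗_B - and T ⊗_{B*G} - commute with U and V compatibly with the retractions. `FrobPair` and
`FrobSquare` record just this. They are symmetric under exchange of the two rings (`swap`), so each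
transfer is proved in one direction only: apply U or V, solve the problem there, come back and pass
to a retract.

Simple modules are linked by the relation "L occurs in U S", which is not a bijection. The simple
constituents of U S lie in one G-orbit, so equivariance gives S < S' iff L < L' for linked pairs
(`orderCompat_inducedOrder`). Only strict inequalities transfer, because different S may lie over
the same L. Standard modules are therefore described by strict inequalities alone: for an adapted
order, Δ_L is the module with simple top L and no composition factor above L which is projective
relative to modules without factors above L (`IsAdapted.isStandard_iff`). These conditions pass
through U and V, and A * G turns out to be quasi-hereditary (`OrderCompat.isQuasiHereditary`). The
condition End(Δ_L) = k on A enters as the statement that L occurs only at the top of a module with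
top L and no factor above L (`IsQuasiHereditary.eq_top_of_ne_zero`).

The order on Sim(B) is eliminated before transferring. Directedness means that Ext¹(L, L') ≠ 0
implies L < L' (`isDirected_iff`). Hence, granted right projectivity, some order makes B an exact
Borel subalgebra iff the functor A ⊗_B - satisfies conditions that mention only the order on Sim(A)
(`IsBorelFunctor`, `exists_isExactBorel_iff`). `FrobSquare.isBorelFunctor` moves these conditions
across the square, and dual bases move right projectivity.

The four adjectives are then treated separately. Strong: by Wedderburn and Malcev, B contains a
maximal semisimple subalgebra iff B + rad A = A (`exists_maximal_semisimple_iff`), and this density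
passes between A and T. Normal: this is automatic (`IsExactBorel.exists_splitting`). The costandard
A-module with socle i(L) restricts to an injective hull of L over B, so the dual of the regular
B-module is the restriction of an A-module; dualising the action of A on it gives the splitting A →
B. Homological and regular: the conditions on Ext extend from simple to finitely generated
semisimple modules, and the map on Ext over B * G is a retract of the map on Ext over B between
restricted modules (`FrobSquare.surjective_mapExt`, `FrobSquare.injective_mapExt`). -/

theorem Sim.eq_of_equiv {L L' : Sim R} (e : L.rep ≃ₗ[R] L'.rep) : L = L' := by
  have h : @Quotient.mk _ (simpleSetoid R) (@Quotient.out _ (simpleSetoid R) L) =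
      @Quotient.mk _ (simpleSetoid R) (@Quotient.out _ (simpleSetoid R) L') :=
    @Quotient.sound _ (simpleSetoid R) _ _ ⟨e⟩
  exact ((@Quotient.out_eq _ (simpleSetoid R) L).symm.trans h).trans
    (@Quotient.out_eq _ (simpleSetoid R) L')

theorem Sim.eq_of_ne_zero {L L' : Sim R} (f : L.rep →ₗ[R] L'.rep) (hf : f ≠ 0) : L = L' :=
  Sim.eq_of_equiv (LinearEquiv.ofBijective f (LinearMap.bijective_of_ne_zero hf))

variable {M N K : Type u} [AddCommGroup M] [Module R M] [AddCommGroup N] [Module R N]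
  [AddCommGroup K] [Module R K]

theorem exists_rep_equiv (M : Type u) [AddCommGroup M] [Module R M] [hM : IsSimpleModule R M] :
    ∃ L : Sim R, Nonempty (M ≃ₗ[R] L.rep) :=
  ⟨Sim.of (ModuleCat.of R M) hM, (Sim.rep_of (ModuleCat.of R M) hM).map LinearEquiv.symm⟩

/-- The simple module `L` is a quotient of `D`. -/
def IsQuot (D : Type u) [AddCommGroup D] [Module R D] (L : Sim R) : Prop :=
  ∃ q : D →ₗ[R] L.rep, q ≠ 0

theorem exists_isQuot [Module.Finite R M] [Nontrivial M] : ∃ L : Sim R, IsQuot M L := by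
  obtain ⟨m, hm, -⟩ := (eq_top_or_exists_le_coatom (⊥ : Submodule R M)).resolve_left bot_ne_top
  have : IsSimpleModule R (M ⧸ m) := isSimpleModule_iff_isCoatom.2 hm
  obtain ⟨L, ⟨e⟩⟩ := exists_rep_equiv (R := R) (M ⧸ m)
  refine ⟨L, e.toLinearMap ∘ₗ m.mkQ, fun h => hm.1 ?_⟩
  rw [eq_top_iff]
  intro x _
  have := LinearMap.congr_fun h x
  simpa using this

theorem exists_isQuot_notMem [Module.Finite R M] {N : Submodule R M} (hN : N ≠ ⊤) :
    ∃ (L : Sim R) (q : M →ₗ[R] L.rep), q ≠ 0 ∧ N ≤ LinearMap.ker q := by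
  have : Nontrivial (M ⧸ N) := Submodule.Quotient.nontrivial_iff.2 hN
  obtain ⟨L, q, hq⟩ := exists_isQuot (R := R) (M := M ⧸ N)
  refine ⟨L, q ∘ₗ N.mkQ, fun h => hq ?_, ?_⟩
  · exact LinearMap.ext fun x => by
      obtain ⟨y, rfl⟩ := N.mkQ_surjective x
      exact LinearMap.congr_fun h y
  · intro x hx
    simp [(Submodule.Quotient.mk_eq_zero N).2 hx]

/-- A nonzero map to a simple module is onto, so its kernel serves as the lower term of the
subquotient. This is the working form of the definition. -/
theorem cf_iff_exists_sub {L : Sim R} :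
    IsCompositionFactor M L ↔ ∃ (N : Submodule R M) (q : N →ₗ[R] L.rep), q ≠ 0 := by
  constructor
  · rintro ⟨N₁, N₂, h, ⟨e⟩⟩
    refine ⟨N₂, e.toLinearMap ∘ₗ (N₁.submoduleOf N₂).mkQ, fun h0 => ?_⟩
    have : Nontrivial L.rep := IsSimpleModule.nontrivial R _
    obtain ⟨x, hx⟩ := exists_ne (0 : L.rep)
    obtain ⟨y, hy⟩ := (N₁.submoduleOf N₂).mkQ_surjective (e.symm x)
    apply hx
    have := LinearMap.congr_fun h0 y
    rw [LinearMap.comp_apply, hy] at this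
    simpa using this
  · rintro ⟨N, q, hq⟩
    refine ⟨(LinearMap.ker q).map N.subtype, N, Submodule.map_subtype_le _ _, ?_⟩
    have : ((LinearMap.ker q).map N.subtype).submoduleOf N = LinearMap.ker q :=
      Submodule.comap_map_eq_of_injective N.injective_subtype _
    rw [this]
    exact ⟨q.quotKerEquivOfSurjective (LinearMap.surjective_of_ne_zero hq)⟩

theorem cf_of_injective {L : Sim R} {f : M →ₗ[R] N} (hf : Function.Injective f)
    (h : IsCompositionFactor M L) : IsCompositionFactor N L := by
  obtain ⟨X, q, hq⟩ := cf_iff_exists_sub.1 h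
  let e : X ≃ₗ[R] X.map f := X.equivMapOfInjective f hf
  refine cf_iff_exists_sub.2 ⟨X.map f, q ∘ₗ e.symm.toLinearMap, fun h0 => hq ?_⟩
  ext1 x
  simpa using LinearMap.congr_fun h0 (e x)

theorem cf_of_surjective {L : Sim R} {f : M →ₗ[R] N} (hf : Function.Surjective f)
    (h : IsCompositionFactor N L) : IsCompositionFactor M L := by
  obtain ⟨X, q, hq⟩ := cf_iff_exists_sub.1 h
  refine cf_iff_exists_sub.2 ⟨X.comap f, q ∘ₗ f.restrict (fun x hx => hx), fun h0 => hq ?_⟩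
  ext1 ⟨x, hx⟩
  obtain ⟨y, rfl⟩ := hf x
  exact LinearMap.congr_fun h0 ⟨y, hx⟩

theorem cf_of_isQuot {L : Sim R} (h : IsQuot M L) : IsCompositionFactor M L := by
  obtain ⟨q, hq⟩ := h
  refine cf_of_surjective (LinearMap.surjective_of_ne_zero hq)
    (cf_iff_exists_sub.2 ⟨⊤, Submodule.subtype _, fun h0 => ?_⟩)
  have : Nontrivial L.rep := IsSimpleModule.nontrivial R _
  obtain ⟨x, hx⟩ := exists_ne (0 : L.rep)
  exact hx (LinearMap.congr_fun h0 ⟨x, trivial⟩)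

theorem eq_of_cf_rep {L L' : Sim R} (h : IsCompositionFactor L.rep L') : L' = L := by
  obtain ⟨N, q, hq⟩ := cf_iff_exists_sub.1 h
  rcases eq_bot_or_eq_top N with rfl | rfl
  · exact absurd (LinearMap.ext fun x => by rw [Subsingleton.elim x 0, map_zero, map_zero]) hq
  · refine (Sim.eq_of_ne_zero (q ∘ₗ Submodule.topEquiv.symm.toLinearMap) fun h0 => hq ?_).symm
    ext1 x
    exact LinearMap.congr_fun h0 x.1

/-! ### Superfluous epimorphisms -/

/-- The linear map `τ` is surjective with superfluous kernel. -/
structure IsEssEpi (τ : M →ₗ[R] N) : Prop where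
  surjective : Function.Surjective τ
  superfluous : ∀ X : Submodule R M, X ⊔ LinearMap.ker τ = ⊤ → X = ⊤

theorem IsProjectiveCover.isEssEpi {τ : M →ₗ[R] N} (h : IsProjectiveCover τ) : IsEssEpi τ :=
  ⟨h.surjective, h.superfluous⟩

theorem IsEssEpi.eq_top {τ : M →ₗ[R] N} (h : IsEssEpi τ) {X : Submodule R M}
    (hX : X.map τ = ⊤) : X = ⊤ := by
  refine h.superfluous X ?_
  rw [← Submodule.comap_map_eq, hX, Submodule.comap_top]

theorem IsEssEpi.surjective_of_comp {τ : M →ₗ[R] N} (h : IsEssEpi τ) {f : K →ₗ[R] M}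
    (hf : Function.Surjective (τ ∘ₗ f)) : Function.Surjective f := by
  rw [← LinearMap.range_eq_top] at hf ⊢
  exact h.eq_top (by rwa [← LinearMap.range_comp])

/-- The image of X in a simple module is zero or everything, and the second case is excluded by
superfluity. So the kernel is the largest proper submodule. -/
theorem IsEssEpi.le_ker [IsSimpleModule R N] {τ : M →ₗ[R] N} (h : IsEssEpi τ) {X : Submodule R M}
    (hX : X ≠ ⊤) : X ≤ LinearMap.ker τ := by
  rcases eq_bot_or_eq_top (X.map τ) with h' | h'
  · exact fun x hx => (Submodule.mem_bot R).1 (h' ▸ Submodule.mem_map_of_mem hx)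
  · exact absurd (h.eq_top h') hX

theorem IsEssEpi.finite [IsSimpleModule R N] {τ : M →ₗ[R] N} (h : IsEssEpi τ) :
    Module.Finite R M := by
  have : Nontrivial N := IsSimpleModule.nontrivial R N
  obtain ⟨n, hn⟩ := exists_ne (0 : N)
  obtain ⟨m, rfl⟩ := h.surjective n
  have : Submodule.span R {m} = ⊤ := by
    by_contra hne
    exact hn (h.le_ker hne (Submodule.mem_span_singleton_self m))
  exact ⟨this ▸ Submodule.fg_span (Set.finite_singleton m)⟩

theorem IsEssEpi.of_comp {τ : M →ₗ[R] N} {f : K →ₗ[R] M} (h : IsEssEpi (τ ∘ₗ f))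
    (hf : Function.Surjective f) : IsEssEpi τ where
  surjective := Function.Surjective.of_comp (g := f) h.surjective
  superfluous X hX := by
    have : X.comap f = ⊤ := by
      refine h.eq_top ?_
      rw [Submodule.map_comp, Submodule.map_comap_eq_of_surjective hf, eq_top_iff]
      rintro n -
      obtain ⟨m, rfl⟩ := Function.Surjective.of_comp (g := f) h.surjective n
      obtain ⟨x, hx, y, hy, rfl⟩ := Submodule.mem_sup.1 (hX.ge (Submodule.mem_top (x := m)))
      exact ⟨x, hx, ((map_add τ x y).trans (by rw [LinearMap.mem_ker.1 hy, add_zero])).symm⟩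
    rw [← Submodule.map_comap_eq_of_surjective hf X, this, Submodule.map_top,
      LinearMap.range_eq_top.2 hf]

theorem IsEssEpi.comp_equiv {τ : M →ₗ[R] N} (h : IsEssEpi τ) (e : K ≃ₗ[R] M) :
    IsEssEpi (τ ∘ₗ e.toLinearMap) :=
  IsEssEpi.of_comp (f := e.symm.toLinearMap)
    (by rwa [LinearMap.comp_assoc, LinearEquiv.comp_symm, LinearMap.comp_id]) e.symm.surjective

variable [IsArtinianRing R]

/-- The cover is a left ideal minimal among the projective left ideals that map onto L. Superfluity
of the kernel follows from Fitting's lemma, applied to an endomorphism over L with image in a given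
supplement N. -/
theorem exists_isProjectiveCover (L : Type u) [AddCommGroup L] [Module R L] [IsSimpleModule R L] :
    ∃ (P : ModuleCat.{u} R) (π : P →ₗ[R] L), IsProjectiveCover π := by
  have hne : {I : Submodule R R | Module.Projective R I ∧
      ∃ π : I →ₗ[R] L, Function.Surjective π}.Nonempty := by
    have : Nontrivial L := IsSimpleModule.nontrivial R L
    obtain ⟨m, hm⟩ := exists_ne (0 : L)
    refine ⟨⊤, Module.Projective.of_equiv (Submodule.topEquiv (R := R) (M := R)).symm,
      LinearMap.toSpanSingleton R L m ∘ₗ Submodule.topEquiv.toLinearMap, ?_⟩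
    exact (IsSimpleModule.toSpanSingleton_surjective R hm).comp Submodule.topEquiv.surjective
  obtain ⟨I, ⟨hI, π, hπ⟩, hmin⟩ := wellFounded_lt.has_min _ hne
  refine ⟨ModuleCat.of R I, π, hI, hπ, fun N hN => ?_⟩
  have hs : Function.Surjective (π ∘ₗ N.subtype) := by
    intro l
    obtain ⟨m, rfl⟩ := hπ l
    obtain ⟨x, hx, y, hy, rfl⟩ := Submodule.mem_sup.1 (hN.ge (Submodule.mem_top (x := m)))
    exact ⟨⟨x, hx⟩, by simp [LinearMap.mem_ker.1 hy]⟩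
  obtain ⟨θ, hθ⟩ := Module.projective_lifting_property (π ∘ₗ N.subtype) π hs
  let e : I →ₗ[R] I := N.subtype ∘ₗ θ
  have he : π ∘ₗ e = π := hθ
  have hen : ∀ n : ℕ, π ∘ₗ (e ^ n) = π := by
    intro n
    induction n with
    | zero => rfl
    | succ n ih => rw [pow_succ', Module.End.mul_eq_comp, ← LinearMap.comp_assoc, he, ih]
  -- Fitting: for large n the range of e ^ n is a direct summand, so again a projective left ideal
  -- over L. The bound n ≥ 1 is what puts this range inside the range of e, hence inside N.
  obtain ⟨n, hn, hn1⟩ := ((LinearMap.eventually_isCompl_ker_pow_range_pow e).and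
    (Filter.eventually_ge_atTop 1)).exists
  have hr : LinearMap.range (e ^ n) = ⊤ := by
    let J := (LinearMap.range (e ^ n)).map I.subtype
    have hJ : J ∈ {I : Submodule R R | Module.Projective R I ∧
        ∃ π : I →ₗ[R] L, Function.Surjective π} := by
      let eJ : LinearMap.range (e ^ n) ≃ₗ[R] J :=
        Submodule.equivMapOfInjective I.subtype I.injective_subtype _
      constructor
      · have : Module.Projective R (LinearMap.range (e ^ n)) :=
          Module.Projective.of_split (Submodule.subtype _)
            ((LinearMap.range (e ^ n)).projectionOnto _ hn.symm)
            (LinearMap.ext fun x => Submodule.projectionOnto_apply_left hn.symm x)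
        exact Module.Projective.of_equiv eJ
      · refine ⟨π ∘ₗ Submodule.subtype _ ∘ₗ eJ.symm.toLinearMap, fun l => ?_⟩
        obtain ⟨m, hm⟩ := hπ l
        refine ⟨eJ ⟨(e ^ n) m, m, rfl⟩, ?_⟩
        rw [← LinearMap.comp_assoc, LinearMap.comp_apply, LinearEquiv.coe_coe,
          LinearEquiv.symm_apply_apply]
        exact (LinearMap.congr_fun (hen n) m).trans hm
    have hJI : J = I := by
      by_contra h
      exact hmin J hJ (lt_of_le_of_ne (Submodule.map_subtype_le _ _) h)
    rw [eq_top_iff]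
    rintro x -
    obtain ⟨y, hy, hyx⟩ := hJI.ge x.2
    rwa [← Subtype.ext hyx]
  rw [eq_top_iff, ← hr]
  obtain ⟨m, rfl⟩ := Nat.exists_eq_add_of_le hn1
  rw [pow_add, pow_one, Module.End.mul_eq_comp]
  refine (LinearMap.range_comp_le_range _ _).trans ?_
  rintro _ ⟨x, rfl⟩
  exact (θ x).2

/-- A chosen projective cover of a simple module. -/
noncomputable def Sim.cover (L : Sim R) : ModuleCat.{u} R :=
  (exists_isProjectiveCover (R := R) L.rep).choose

/-- The projection of the chosen projective cover of a simple module. -/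
noncomputable def Sim.coverMap (L : Sim R) : L.cover →ₗ[R] L.rep :=
  (exists_isProjectiveCover (R := R) L.rep).choose_spec.choose

theorem Sim.isProjectiveCover (L : Sim R) : IsProjectiveCover L.coverMap :=
  (exists_isProjectiveCover (R := R) L.rep).choose_spec.choose_spec

instance (L : Sim R) : Module.Projective R L.cover := L.isProjectiveCover.projective

instance (L : Sim R) : Module.Finite R L.cover := L.isProjectiveCover.isEssEpi.finite

-- A map from a subquotient's numerator onto L lets the cover lift. Conversely the kernel of a
-- nonzero φ is proper, so it lies in the kernel of the cover, and L becomes a quotient of the range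
-- of φ.
omit [IsArtinianRing R] in
theorem IsProjectiveCover.cf_iff {Q : Type u} [AddCommGroup Q] [Module R Q] {L : Sim R}
    {ρ : Q →ₗ[R] L.rep} (hρ : IsProjectiveCover ρ) :
    IsCompositionFactor M L ↔ ∃ φ : Q →ₗ[R] M, φ ≠ 0 := by
  have := hρ.projective
  have : Nontrivial L.rep := IsSimpleModule.nontrivial R _
  rw [cf_iff_exists_sub]
  constructor
  · rintro ⟨N, q, hq⟩
    obtain ⟨φ, hφ⟩ := Module.projective_lifting_property q ρ (LinearMap.surjective_of_ne_zero hq)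
    refine ⟨N.subtype ∘ₗ φ, fun h => ?_⟩
    obtain ⟨x, hx⟩ := exists_ne (0 : L.rep)
    obtain ⟨y, rfl⟩ := hρ.surjective x
    apply hx
    have hy : φ y = 0 := Subtype.ext (LinearMap.congr_fun h y)
    rw [← hφ, LinearMap.comp_apply, hy, map_zero]
  · rintro ⟨φ, hφ⟩
    have hk : LinearMap.ker φ ≤ LinearMap.ker ρ :=
      hρ.isEssEpi.le_ker fun h => hφ (LinearMap.ker_eq_top.1 h)
    refine ⟨LinearMap.range φ, (LinearMap.ker φ).liftQ ρ hk ∘ₗ φ.quotKerEquivRange.symm.toLinearMap,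
      fun h => ?_⟩
    obtain ⟨x, hx⟩ := exists_ne (0 : L.rep)
    obtain ⟨y, rfl⟩ := hρ.surjective x
    apply hx
    have := LinearMap.congr_fun h (φ.quotKerEquivRange (Submodule.Quotient.mk y))
    simpa using this

theorem cf_iff_cover {L : Sim R} : IsCompositionFactor M L ↔ ∃ φ : L.cover →ₗ[R] M, φ ≠ 0 :=
  L.isProjectiveCover.cf_iff

/-- A nonzero map from the cover of L to M either stays nonzero in K or lands in the image of N.
Only half of exactness is needed. -/
theorem cf_of_exact {L : Sim R} {i : N →ₗ[R] M} {p : M →ₗ[R] K}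
    (hip : LinearMap.ker p ≤ LinearMap.range i) (h : IsCompositionFactor M L) :
    IsCompositionFactor N L ∨ IsCompositionFactor K L := by
  obtain ⟨φ, hφ⟩ := cf_iff_cover.1 h
  by_cases hp : p ∘ₗ φ = 0
  · left
    have : IsCompositionFactor (LinearMap.range i) L := by
      refine cf_iff_cover.2 ⟨φ.codRestrict _ fun x => hip (LinearMap.congr_fun hp x), fun h => hφ ?_⟩
      ext1 x
      exact congrArg Subtype.val (LinearMap.congr_fun h x)
    exact cf_of_surjective i.surjective_rangeRestrict this
  · exact Or.inr (cf_iff_cover.2 ⟨_, hp⟩)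

omit [IsArtinianRing R] in
theorem exists_isSub [IsArtinianRing R] [Nontrivial M] :
    ∃ (L : Sim R) (i : L.rep →ₗ[R] M), Function.Injective i := by
  obtain ⟨m, hm⟩ := exists_ne (0 : M)
  let N := Submodule.span R {m}
  have : Module.Finite R N := ⟨(Submodule.fg_top _).2 (Submodule.fg_span (Set.finite_singleton m))⟩
  have hN : N ≠ ⊥ := by simpa [N] using hm
  have : Nontrivial N := Submodule.nontrivial_iff_ne_bot.2 hN
  obtain ⟨S, hS, -⟩ := (eq_bot_or_exists_atom_le (⊤ : Submodule R N)).resolve_left top_ne_bot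
  have : IsSimpleModule R S := isSimpleModule_iff_isAtom.2 hS
  obtain ⟨L, ⟨e⟩⟩ := exists_rep_equiv (R := R) S
  exact ⟨L, N.subtype ∘ₗ S.subtype ∘ₗ e.symm.toLinearMap,
    N.injective_subtype.comp (S.injective_subtype.comp e.symm.injective)⟩

end SimBasic

/-! ### Standard modules as relatively projective modules -/

section Standard

variable {R : Type u} [Ring R]

/-- No composition factor of `M` lies in `X`. -/
def NoFactor (X : Set (Sim R)) (M : Type u) [AddCommGroup M] [Module R M] : Prop :=
  ∀ L ∈ X, ¬ IsCompositionFactor M L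

/-- `D` is projective relative to the modules without composition factors in `X`. -/
def IsRelProjective (X : Set (Sim R)) (D : Type u) [AddCommGroup D] [Module R D] : Prop :=
  ∀ (M N : ModuleCat.{u} R) (p : M →ₗ[R] N), Function.Surjective p → NoFactor X M →
    ∀ f : D →ₗ[R] N, ∃ g : D →ₗ[R] M, p ∘ₗ g = f

/-- The module `D` has simple top `L`. -/
def HasTop (D : Type u) [AddCommGroup D] [Module R D] (L : Sim R) : Prop :=
  ∃ τ : D →ₗ[R] L.rep, IsEssEpi τ

variable {M N K : Type u} [AddCommGroup M] [Module R M] [AddCommGroup N] [Module R N]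
  [AddCommGroup K] [Module R K] {X Y : Set (Sim R)}

theorem NoFactor.mono (h : NoFactor X M) (hY : Y ⊆ X) : NoFactor Y M := fun L hL => h L (hY hL)

theorem NoFactor.of_injective (h : NoFactor X N) {f : M →ₗ[R] N} (hf : Function.Injective f) :
    NoFactor X M := fun L hL hM => h L hL (cf_of_injective hf hM)

theorem NoFactor.of_surjective (h : NoFactor X M) {f : M →ₗ[R] N} (hf : Function.Surjective f) :
    NoFactor X N := fun L hL hM => h L hL (cf_of_surjective hf hM)

theorem NoFactor.of_exact [IsArtinianRing R] {i : N →ₗ[R] M} {p : M →ₗ[R] K}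
    (hip : LinearMap.ker p ≤ LinearMap.range i) (hN : NoFactor X N) (hK : NoFactor X K) :
    NoFactor X M := fun L hL hM => (cf_of_exact hip hM).elim (hN L hL) (hK L hL)

theorem IsRelProjective.mono (h : IsRelProjective X M) (hX : X ⊆ Y) : IsRelProjective Y M :=
  fun M N p hp hM => h M N p hp (hM.mono hX)

theorem IsRelProjective.lift (h : IsRelProjective X K) {p : M →ₗ[R] N} (hp : Function.Surjective p)
    (hM : NoFactor X M) (f : K →ₗ[R] N) : ∃ g : K →ₗ[R] M, p ∘ₗ g = f :=
  h (ModuleCat.of R M) (ModuleCat.of R N) p hp hM f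

theorem IsRelProjective.of_retract (h : IsRelProjective X M) {i : N →ₗ[R] M} {r : M →ₗ[R] N}
    (hri : r ∘ₗ i = LinearMap.id) : IsRelProjective X N := by
  intro A B p hp hA f
  obtain ⟨g, hg⟩ := h A B p hp hA (f ∘ₗ r)
  refine ⟨g ∘ₗ i, ?_⟩
  rw [← LinearMap.comp_assoc, hg, LinearMap.comp_assoc, hri, LinearMap.comp_id]

theorem HasTop.finite {L : Sim R} (h : HasTop M L) : Module.Finite R M := by
  obtain ⟨τ, hτ⟩ := h
  exact hτ.finite

theorem HasTop.isQuot {L : Sim R} (h : HasTop M L) : IsQuot M L := by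
  obtain ⟨τ, hτ⟩ := h
  refine ⟨τ, ?_⟩
  rintro rfl
  have : Nontrivial L.rep := IsSimpleModule.nontrivial R _
  obtain ⟨x, hx⟩ := exists_ne (0 : L.rep)
  obtain ⟨y, hy⟩ := hτ.surjective x
  exact hx hy.symm

theorem HasTop.eq_of_isQuot {L L' : Sim R} (h : HasTop M L) (h' : IsQuot M L') : L' = L := by
  obtain ⟨τ, hτ⟩ := h
  obtain ⟨q, hq⟩ := h'
  have hk : LinearMap.ker q ≤ LinearMap.ker τ :=
    hτ.le_ker fun h => hq (LinearMap.ker_eq_top.1 h)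
  have hqs := LinearMap.surjective_of_ne_zero hq
  refine Sim.eq_of_ne_zero ((LinearMap.ker q).liftQ τ hk ∘ₗ
    (q.quotKerEquivOfSurjective hqs).symm.toLinearMap) fun h0 => ?_
  have : Nontrivial L.rep := IsSimpleModule.nontrivial R _
  obtain ⟨x, hx⟩ := exists_ne (0 : L.rep)
  obtain ⟨y, rfl⟩ := hτ.surjective x
  apply hx
  have := LinearMap.congr_fun h0 (q.quotKerEquivOfSurjective hqs (Submodule.Quotient.mk y))
  rw [LinearMap.comp_apply, LinearEquiv.coe_coe, LinearEquiv.symm_apply_apply] at this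
  exact this

theorem HasTop.of_surjective {L : Sim R} (h : HasTop M L) {f : M →ₗ[R] N}
    (hf : Function.Surjective f) [Nontrivial N] : HasTop N L := by
  obtain ⟨τ, hτ⟩ := h
  have hk : LinearMap.ker f ≤ LinearMap.ker τ := hτ.le_ker fun h => by
    rw [LinearMap.ker_eq_top] at h
    obtain ⟨x, hx⟩ := exists_ne (0 : N)
    obtain ⟨y, rfl⟩ := hf x
    exact hx (by rw [h]; rfl)
  let σ : N →ₗ[R] L.rep := (LinearMap.ker f).liftQ τ hk ∘ₗ
    (f.quotKerEquivOfSurjective hf).symm.toLinearMap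
  have hσ : σ ∘ₗ f = τ := LinearMap.ext fun x => by
    have : (f.quotKerEquivOfSurjective hf).symm (f x) = Submodule.Quotient.mk x := by
      rw [LinearEquiv.symm_apply_eq]
      rfl
    simp [σ, this]
  exact ⟨σ, IsEssEpi.of_comp (hσ ▸ hτ) hf⟩

theorem HasTop.of_equiv {L : Sim R} (h : HasTop M L) (e : N ≃ₗ[R] M) : HasTop N L := by
  obtain ⟨τ, hτ⟩ := h
  exact ⟨_, hτ.comp_equiv e⟩

theorem Sim.hasTop_cover [IsArtinianRing R] (L : Sim R) : HasTop L.cover L :=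
  ⟨_, L.isProjectiveCover.isEssEpi⟩

theorem HasTop.nontrivial {L : Sim R} (h : HasTop M L) : Nontrivial M := by
  obtain ⟨τ, hτ⟩ := h
  have : Nontrivial L.rep := IsSimpleModule.nontrivial R _
  exact hτ.surjective.nontrivial

theorem isQuot_of_surjective {L : Sim R} (h : IsQuot N L) {f : M →ₗ[R] N}
    (hf : Function.Surjective f) : IsQuot M L := by
  obtain ⟨q, hq⟩ := h
  refine ⟨q ∘ₗ f, fun h => hq (LinearMap.ext fun x => ?_)⟩
  obtain ⟨y, rfl⟩ := hf x
  exact LinearMap.congr_fun h y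

theorem surjective_of_retract {i : N →ₗ[R] M} {r : M →ₗ[R] N}
    (hri : r ∘ₗ i = LinearMap.id) : Function.Surjective r :=
  fun x => ⟨i x, LinearMap.congr_fun hri x⟩

theorem injective_of_retract {i : N →ₗ[R] M} {r : M →ₗ[R] N}
    (hri : r ∘ₗ i = LinearMap.id) : Function.Injective i :=
  Function.LeftInverse.injective (g := r) fun x => LinearMap.congr_fun hri x

/-- Two relatively projective modules with the same simple top are isomorphic. -/
theorem IsRelProjective.nonempty_equiv [IsArtinianRing R] {L : Sim R} (hM : IsRelProjective X M)
    (hN : IsRelProjective X N) (hXM : NoFactor X M) (hXN : NoFactor X N) (hLM : HasTop M L)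
    (hLN : HasTop N L) : Nonempty (M ≃ₗ[R] N) := by
  have := hLM.finite
  have := isNoetherian_of_isNoetherianRing_of_finite R M
  obtain ⟨τ, hτ⟩ := hLM
  obtain ⟨σ, hσ⟩ := hLN
  -- Lifting the two tops against each other gives surjections both ways; the composite is a
  -- surjective endomorphism of a Noetherian module, hence injective.
  obtain ⟨f, hf⟩ := hM.lift hσ.surjective hXN τ
  obtain ⟨g, hg⟩ := hN.lift hτ.surjective hXM σ
  have hfs : Function.Surjective f := hσ.surjective_of_comp (by rw [hf]; exact hτ.surjective)
  have hgs : Function.Surjective g := hτ.surjective_of_comp (by rw [hg]; exact hσ.surjective)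
  have hgf : Function.Surjective (g ∘ₗ f) := hgs.comp hfs
  have := IsNoetherian.injective_of_surjective_endomorphism _ hgf
  exact ⟨LinearEquiv.ofBijective f ⟨Function.Injective.of_comp (f := g) this, hfs⟩⟩

/-- The sum of the images in `P` of the projective covers of simple modules in `X`. -/
def traceSub (X : Set (Sim R)) (P : Type u) [AddCommGroup P] [Module R P] : Submodule R P :=
  sSup {N | ∃ (L' : Sim R) (Q : ModuleCat.{u} R) (ρ : Q →ₗ[R] L'.rep) (φ : Q →ₗ[R] P),
    L' ∈ X ∧ IsProjectiveCover ρ ∧ N = LinearMap.range φ}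

theorem traceSub_eq_standardKernel (le : PartialOrder (Sim R)) (L : Sim R) :
    traceSub {L' | ¬ le.le L' L} M = standardKernel le L M := rfl

theorem range_le_traceSub {L' : Sim R} (hL' : L' ∈ X) {Q : Type u} [AddCommGroup Q] [Module R Q]
    {ρ : Q →ₗ[R] L'.rep} (hρ : IsProjectiveCover ρ) (φ : Q →ₗ[R] M) :
    LinearMap.range φ ≤ traceSub X M :=
  le_sSup ⟨L', ModuleCat.of R Q, ρ, φ, hL', hρ, rfl⟩

theorem traceSub_le_ker (hN : NoFactor X N) (f : M →ₗ[R] N) : traceSub X M ≤ LinearMap.ker f := by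
  refine sSup_le ?_
  rintro _ ⟨L', Q, ρ, φ, hL', hρ, rfl⟩
  rw [LinearMap.range_le_ker_iff]
  by_contra h
  exact hN L' hL' (hρ.cf_iff.2 ⟨_, h⟩)

/-- The trace is generated by images of covers of simple modules in X, and such covers have no
nonzero maps to N. This is what kills self-extensions of standard modules. -/
theorem eq_zero_of_noFactor (hN : NoFactor X N) (f : traceSub X M →ₗ[R] N) : f = 0 := by
  have : ∀ Z ∈ {N | ∃ (L' : Sim R) (Q : ModuleCat.{u} R) (ρ : Q →ₗ[R] L'.rep) (φ : Q →ₗ[R] M),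
      L' ∈ X ∧ IsProjectiveCover ρ ∧ N = LinearMap.range φ},
      Z ≤ (LinearMap.ker f).map (traceSub X M).subtype := by
    rintro _ ⟨L', Q, ρ, φ, hL', hρ, rfl⟩ _ ⟨x, rfl⟩
    have hφ : ∀ y, φ y ∈ traceSub X M := fun y => range_le_traceSub hL' hρ φ ⟨y, rfl⟩
    refine ⟨⟨φ x, hφ x⟩, ?_, rfl⟩
    by_contra h
    refine hN L' hL' (hρ.cf_iff.2 ⟨f ∘ₗ φ.codRestrict _ hφ, fun h0 => h ?_⟩)
    exact LinearMap.congr_fun h0 x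
  ext1 ⟨x, hx⟩
  obtain ⟨y, hy, hyx⟩ := sSup_le this hx
  have : y = ⟨x, hx⟩ := Subtype.ext hyx
  exact this ▸ hy

/-- A map from a projective cover to the quotient lifts to M, where its image is swallowed by the
trace. -/
theorem noFactor_quotient_traceSub [IsArtinianRing R] : NoFactor X (M ⧸ traceSub X M) := by
  intro L hL h
  obtain ⟨φ, hφ⟩ := cf_iff_cover.1 h
  obtain ⟨ψ, hψ⟩ := Module.projective_lifting_property (traceSub X M).mkQ φ
    (Submodule.mkQ_surjective _)
  refine hφ (LinearMap.ext fun x => ?_)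
  rw [← hψ]
  exact (Submodule.Quotient.mk_eq_zero _).2
    (range_le_traceSub hL L.isProjectiveCover ψ ⟨x, rfl⟩)

theorem isRelProjective_quotient_traceSub [Module.Projective R M] :
    IsRelProjective X (M ⧸ traceSub X M) := by
  intro A B p hp hA f
  obtain ⟨g, hg⟩ := Module.projective_lifting_property p (f ∘ₗ (traceSub X M).mkQ) hp
  refine ⟨(traceSub X M).liftQ g (traceSub_le_ker hA g), ?_⟩
  refine LinearMap.ext fun x => ?_
  obtain ⟨y, rfl⟩ := (traceSub X M).mkQ_surjective x
  exact LinearMap.congr_fun hg y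

theorem noFactor_rep {L : Sim R} (hL : L ∉ X) : NoFactor X L.rep := by
  intro L' hL' h
  rw [eq_of_cf_rep h] at hL'
  exact hL hL'

theorem hasTop_quotient_traceSub {P : Type u} [AddCommGroup P] [Module R P] {L : Sim R}
    (hL : L ∉ X) (hP : HasTop P L) : HasTop (P ⧸ traceSub X P) L := by
  have : Nontrivial (P ⧸ traceSub X P) := by
    rw [Submodule.Quotient.nontrivial_iff]
    intro h
    obtain ⟨τ, hτ⟩ := hP.isQuot
    have := traceSub_le_ker (noFactor_rep hL) τ
    rw [h, top_le_iff, LinearMap.ker_eq_top] at this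
    exact hτ this
  exact hP.of_surjective (Submodule.mkQ_surjective _)

theorem IsStandard.of_equiv {le : PartialOrder (Sim R)} {L : Sim R} (h : IsStandard le L M)
    (e : N ≃ₗ[R] M) : IsStandard le L N := by
  obtain ⟨P, π, hπ, ⟨f⟩⟩ := h
  exact ⟨P, π, hπ, ⟨e.trans f⟩⟩

theorem NoFactor.of_equiv (h : NoFactor X M) (e : N ≃ₗ[R] M) : NoFactor X N :=
  h.of_injective (f := e.toLinearMap) e.injective

theorem IsRelProjective.of_equiv (h : IsRelProjective X M) (e : N ≃ₗ[R] M) : IsRelProjective X N :=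
  h.of_retract (i := e.toLinearMap) (r := e.symm.toLinearMap)
    (LinearMap.ext fun x => e.symm_apply_apply x)

section Artinian

variable [IsArtinianRing R] {le : PartialOrder (Sim R)} {L : Sim R}

/-- The standard module at L is the projective cover of L inside the category of modules whose
factors are all ≤ L. Uniqueness of such a relative cover gives the converse. -/
theorem isStandard_iff :
    IsStandard le L M ↔
      HasTop M L ∧ NoFactor {L' | ¬ le.le L' L} M ∧ IsRelProjective {L' | ¬ le.le L' L} M := by
  have hL : L ∉ {L' | ¬ le.le L' L} := fun h => h (le.le_refl L)
  constructor
  · rintro ⟨P, π, hπ, ⟨e⟩⟩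
    have := hπ.projective
    exact ⟨(hasTop_quotient_traceSub hL ⟨π, hπ.isEssEpi⟩).of_equiv e,
      noFactor_quotient_traceSub.of_equiv e, isRelProjective_quotient_traceSub.of_equiv e⟩
  · rintro ⟨h₁, h₂, h₃⟩
    refine ⟨L.cover, L.coverMap, L.isProjectiveCover, ?_⟩
    exact h₃.nonempty_equiv isRelProjective_quotient_traceSub h₂ noFactor_quotient_traceSub h₁
      (hasTop_quotient_traceSub hL L.hasTop_cover)

theorem exists_isStandard (le : PartialOrder (Sim R)) (L : Sim R) :
    ∃ D : ModuleCat.{u} R, IsStandard le L D :=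
  ⟨ModuleCat.of R (L.cover ⧸ standardKernel le L L.cover), L.cover, L.coverMap,
    L.isProjectiveCover, ⟨LinearEquiv.refl R _⟩⟩

omit [IsArtinianRing R] in
theorem HasTop.nonempty_moduleTop (h : HasTop M L) : Nonempty (ModuleTop (R := R) M ≃ₗ[R] L.rep) := by
  obtain ⟨τ, hτ⟩ := h
  have : Module.jacobson R M = LinearMap.ker τ := by
    apply le_antisymm
    · exact sInf_le (isSimpleModule_iff_isCoatom.1
        (IsSimpleModule.congr (τ.quotKerEquivOfSurjective hτ.surjective)))
    · refine le_sInf fun m hm => ?_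
      by_contra h
      have h' : m < LinearMap.ker τ ⊔ m := lt_of_le_of_ne le_sup_right fun he =>
        h (he ▸ le_sup_left)
      have := hm.2 _ h'
      exact hm.1 (hτ.superfluous m (by rw [sup_comm]; exact this))
  change Nonempty ((M ⧸ Module.jacobson R M) ≃ₗ[R] _)
  rw [this]
  exact ⟨τ.quotKerEquivOfSurjective hτ.surjective⟩

omit [IsArtinianRing R] in
/-- A subquotient of `M` isomorphic to `L` becomes the socle of a suitable quotient of `M`. -/
theorem exists_quotient_simple_socle [IsNoetherian R M] {A : Submodule R M} {q : A →ₗ[R] L.rep}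
    (hq : q ≠ 0) : ∃ U : Submodule R M, U ≠ ⊤ ∧ U ⊓ A = (LinearMap.ker q).map A.subtype ∧
      Nonempty (socle (R := R) (M ⧸ U) ≃ₗ[R] L.rep) := by
  have hqs := LinearMap.surjective_of_ne_zero hq
  set B := (LinearMap.ker q).map A.subtype with hB
  have hBA : B ≤ A := Submodule.map_subtype_le _ _
  -- With U maximal subject to U ∩ A = B, the image of A in M / U is isomorphic to L. Any simple
  -- submodule of M / U not contained in this image could be used to enlarge U.
  obtain ⟨U, hU, hmax⟩ := wellFounded_gt.has_min {U : Submodule R M | U ⊓ A = B}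
    ⟨B, inf_eq_left.2 hBA⟩
  have hUA : U ⊓ A = B := hU
  have hAU : ¬ A ≤ U := fun h => hq <| LinearMap.ext fun x => by
    have : (x : M) ∈ B := by rw [← hUA, inf_eq_right.2 h]; exact x.2
    obtain ⟨y, hy, hyx⟩ := this
    rw [← Subtype.ext hyx]
    exact hy
  have hker : LinearMap.ker (U.mkQ ∘ₗ A.subtype) = LinearMap.ker q := by
    ext x
    rw [LinearMap.mem_ker, LinearMap.comp_apply, Submodule.mkQ_apply,
      Submodule.Quotient.mk_eq_zero]
    constructor
    · intro hx
      have : (x : M) ∈ B := hUA ▸ ⟨hx, x.2⟩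
      obtain ⟨y, hy, hyx⟩ := this
      rwa [← Subtype.ext hyx]
    · intro hx
      have : (x : M) ∈ U ⊓ A := hUA ▸ ⟨x, hx, rfl⟩
      exact this.1
  let e : A.map U.mkQ ≃ₗ[R] L.rep :=
    (LinearEquiv.ofEq _ _ (by rw [LinearMap.range_comp, Submodule.range_subtype])).trans
      ((U.mkQ ∘ₗ A.subtype).quotKerEquivRange.symm.trans
        ((Submodule.quotEquivOfEq _ _ hker).trans (q.quotKerEquivOfSurjective hqs)))
  have hsimple : IsSimpleModule R (A.map U.mkQ) := IsSimpleModule.congr e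
  have hsoc : socle (R := R) (M ⧸ U) = A.map U.mkQ := by
    apply le_antisymm
    · refine sSup_le fun Y hY => ?_
      have hY : IsAtom Y := isSimpleModule_iff_isAtom.1 hY
      by_contra hYA
      have hat : IsAtom (A.map U.mkQ) := isSimpleModule_iff_isAtom.1 hsimple
      have hdis : Y ⊓ A.map U.mkQ = ⊥ := by
        rcases (hY.le_iff.1 (inf_le_left : Y ⊓ A.map U.mkQ ≤ Y)) with h | h
        · exact h
        · exact absurd (inf_eq_left.1 h) hYA
      refine hmax (Y.comap U.mkQ) ?_ ?_
      · change Y.comap U.mkQ ⊓ A = B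
        rw [← hUA]
        apply le_antisymm
        · rintro x ⟨hx, hxA⟩
          refine ⟨?_, hxA⟩
          have : U.mkQ x ∈ Y ⊓ A.map U.mkQ := ⟨hx, x, hxA, rfl⟩
          rw [hdis, Submodule.mem_bot] at this
          exact (Submodule.Quotient.mk_eq_zero U).1 this
        · refine inf_le_inf_right _ fun x hx => ?_
          rw [Submodule.mem_comap, Submodule.mkQ_apply, (Submodule.Quotient.mk_eq_zero U).2 hx]
          exact Y.zero_mem
      · refine lt_of_le_of_ne ?_ ?_
        · intro x hx
          rw [Submodule.mem_comap, Submodule.mkQ_apply, (Submodule.Quotient.mk_eq_zero U).2 hx]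
          exact Y.zero_mem
        · intro h
          apply hY.1
          rw [← Submodule.map_comap_eq_of_surjective U.mkQ_surjective Y, ← h, Submodule.mkQ_map_self]
    · exact le_sSup (a := A.map U.mkQ) hsimple
  exact ⟨U, fun h => hAU (h ▸ le_top), hUA, ⟨(LinearEquiv.ofEq _ _ hsoc).trans e⟩⟩

theorem HasTop.isNoetherian (h : HasTop M L) : IsNoetherian R M :=
  have := h.finite
  isNoetherian_of_isNoetherianRing_of_finite R M

/-- A suitable quotient of M has the given factor as its socle, so the definition of adaptedness,
which asks for a simple socle, covers every composition factor. -/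
theorem IsAdapted.exists_cf (hle : IsAdapted le) {L' : Sim R} (hM : HasTop M L)
    (h' : IsCompositionFactor M L') (h₁ : ¬ le.le L L') (h₂ : ¬ le.le L' L) :
    ∃ L'' : Sim R, IsCompositionFactor M L'' ∧ le.lt L L'' ∧ le.lt L' L'' := by
  have := hM.isNoetherian
  obtain ⟨A, q, hq⟩ := cf_iff_exists_sub.1 h'
  obtain ⟨U, hU, -, hs⟩ := exists_quotient_simple_socle hq
  have : Nontrivial (M ⧸ U) := Submodule.Quotient.nontrivial_iff.2 hU
  have ht := hM.of_surjective U.mkQ_surjective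
  obtain ⟨L'', h, h'⟩ := hle (ModuleCat.of R (M ⧸ U)) ht.finite L L' ht.nonempty_moduleTop hs h₁ h₂
  exact ⟨L'', cf_of_surjective U.mkQ_surjective h, h'⟩

/-- An incomparable factor would force a further factor strictly above L, by adaptedness. -/
theorem IsAdapted.le_of_cf (hle : IsAdapted le) {L' : Sim R} (hM : HasTop M L)
    (hX : NoFactor {L' | le.lt L L'} M) (h' : IsCompositionFactor M L') : le.le L' L := by
  by_contra h
  by_cases h₁ : le.le L L'
  · exact hX L' (lt_of_le_of_ne h₁ fun he => h (he ▸ le.le_refl L)) h'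
  · obtain ⟨L'', hc, hl, -⟩ := hle.exists_cf hM h' h₁ h
    exact hX L'' hl hc

omit [IsArtinianRing R] in
theorem setOf_lt_subset : {L' | le.lt L L'} ⊆ {L' | ¬ le.le L' L} :=
  fun _ h h' => absurd h (not_lt_of_ge h')

/-- Killing only the factors above L already leaves factors ≤ L, so both versions of the relative
projective cover coincide. The gain is that only strict inequalities remain, and those are the ones
that transfer along `FrobPair.OrderCompat`. -/
theorem IsAdapted.isStandard_iff (hle : IsAdapted le) :
    IsStandard le L M ↔
      HasTop M L ∧ NoFactor {L' | le.lt L L'} M ∧ IsRelProjective {L' | le.lt L L'} M := by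
  rw [QHSkew.isStandard_iff]
  constructor
  · rintro ⟨h₁, h₂, h₃⟩
    have hL : L ∉ {L' | le.lt L L'} := fun h => lt_irrefl L h
    refine ⟨h₁, h₂.mono setOf_lt_subset, ?_⟩
    have ht := hasTop_quotient_traceSub hL L.hasTop_cover
    have hn : NoFactor {L' | ¬ le.le L' L} (L.cover ⧸ traceSub {L' | le.lt L L'} L.cover) :=
      fun L' hL' hc => hL' (hle.le_of_cf ht noFactor_quotient_traceSub hc)
    obtain ⟨e⟩ := h₃.nonempty_equiv (isRelProjective_quotient_traceSub.mono setOf_lt_subset)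
      h₂ hn h₁ ht
    exact isRelProjective_quotient_traceSub.of_equiv e
  · rintro ⟨h₁, h₂, h₃⟩
    exact ⟨h₁, fun L' hL' hc => hL' (hle.le_of_cf h₁ h₂ hc), h₃.mono setOf_lt_subset⟩

variable {k : Type u} [Field k] [Algebra k R]

/-- Let D be standard at L. It maps onto M by p, and its top also lifts to a map g into A. Lifting g
through p gives an endomorphism of D, which is a scalar c; thus g = c p. As g covers the top, c ≠ 0,
so A contains the image of p. In other words, L occurs only at the top of M. -/
theorem IsQuasiHereditary.eq_top_of_ne_zero (h : IsQuasiHereditary k le) (hM : HasTop M L)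
    (hX : NoFactor {L' | le.lt L L'} M) {A : Submodule R M} {q : A →ₗ[R] L.rep} (hq : q ≠ 0) :
    A = ⊤ := by
  obtain ⟨D, hD⟩ := exists_isStandard le L
  obtain ⟨hDt, hDX, hDp⟩ := h.adapted.isStandard_iff.1 hD
  obtain ⟨σ, hσ⟩ := hDt
  obtain ⟨τ, hτ⟩ := hM
  obtain ⟨p, hp⟩ := hDp.lift hτ.surjective hX σ
  have hps : Function.Surjective p := hτ.surjective_of_comp (by rw [hp]; exact hσ.surjective)
  obtain ⟨g, hg⟩ := hDp.lift (LinearMap.surjective_of_ne_zero hq)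
    (hX.of_injective A.injective_subtype) σ
  obtain ⟨φ, hφ⟩ := hDp.lift hps hDX (A.subtype ∘ₗ g)
  obtain ⟨c, hc, -⟩ := (h.exceptional L D hD).2 φ
  have hgc : ∀ x, (g x : M) = algebraMap k R c • p x := fun x => by
    rw [← map_smul, ← hc, ← LinearMap.comp_apply, hφ]
    rfl
  have hc0 : c ≠ 0 := by
    rintro rfl
    have : Nontrivial L.rep := IsSimpleModule.nontrivial R _
    obtain ⟨x, hx⟩ := exists_ne (0 : L.rep)
    obtain ⟨y, rfl⟩ := hσ.surjective x
    apply hx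
    have : g y = 0 := Subtype.ext (by rw [hgc, map_zero, zero_smul]; rfl)
    rw [← hg, LinearMap.comp_apply, this, map_zero]
  rw [eq_top_iff]
  rintro x -
  obtain ⟨y, rfl⟩ := hps x
  have : p y = algebraMap k R c⁻¹ • (g y : M) := by
    rw [hgc, smul_smul, ← map_mul, inv_mul_cancel₀ hc0, map_one, one_smul]
  rw [this]
  exact A.smul_mem _ (g y).2

/-- In a quasi-hereditary algebra, a composition factor of a module with simple top `L` which is
not the top itself is comparable to `L` or accompanied by one that is larger than both. -/
theorem IsQuasiHereditary.trichotomy (h : IsQuasiHereditary k le) {L' : Sim R} (hM : HasTop M L)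
    {A : Submodule R M} (hA : A ≠ ⊤) {q : A →ₗ[R] L'.rep} (hq : q ≠ 0) :
    le.lt L L' ∨ le.lt L' L ∨
      ∃ L'' : Sim R, IsCompositionFactor M L'' ∧ le.lt L L'' ∧ le.lt L' L'' := by
  by_cases h₁ : le.le L L'
  · by_cases he : L = L'
    · subst he
      by_cases hX : NoFactor {L' | le.lt L L'} M
      · exact absurd (h.eq_top_of_ne_zero hM hX hq) hA
      · simp only [NoFactor, not_forall, not_not] at hX
        obtain ⟨L'', hL, hc⟩ := hX
        exact Or.inr (Or.inr ⟨L'', hc, hL, hL⟩)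
    · exact Or.inl (lt_of_le_of_ne h₁ he)
  · by_cases h₂ : le.le L' L
    · exact Or.inr (Or.inl (lt_of_le_of_ne h₂ fun he => h₁ (he ▸ le.le_refl _)))
    · exact Or.inr (Or.inr (h.adapted.exists_cf hM (cf_iff_exists_sub.2 ⟨A, q, hq⟩) h₁ h₂))

end Artinian

end Standard

/-! ### Standard filtrations and direct sums of standard modules -/

section Filtration

variable {R : Type u} [Ring R]

/-- Induction on length: over an Artinian ring, a proper submodule of a finitely generated module is
strictly shorter. -/
theorem finite_induction [IsArtinianRing R] {P : ModuleCat.{u} R → Prop}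
    (h : ∀ M : ModuleCat.{u} R, Module.Finite R M →
      (∀ N : Submodule R M, N ≠ ⊤ → P (ModuleCat.of R N)) → P M)
    (M : ModuleCat.{u} R) (hM : Module.Finite R M) : P M := by
  induction hn : Module.length R M using WellFoundedLT.induction generalizing M with
  | ind n ih =>
    refine h M hM fun N hN => ?_
    have := isNoetherian_of_isNoetherianRing_of_finite R M
    have : IsArtinian R M := isArtinian_of_fg_of_artinian'
    exact ih _ (hn ▸ Submodule.length_lt hN) (ModuleCat.of R N) inferInstance rfl

variable {M N K : Type u} [AddCommGroup M] [Module R M] [AddCommGroup N] [Module R N]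
  [AddCommGroup K] [Module R K]

theorem nonempty_subquotient_equiv {A₁ A₂ : Submodule R M} {B₁ B₂ : Submodule R N}
    (f : A₂ →ₗ[R] B₂) (hf : Function.Surjective f)
    (h : (B₁.submoduleOf B₂).comap f = A₁.submoduleOf A₂) :
    Nonempty ((A₂ ⧸ A₁.submoduleOf A₂) ≃ₗ[R] (B₂ ⧸ B₁.submoduleOf B₂)) := by
  let g : A₂ →ₗ[R] (B₂ ⧸ B₁.submoduleOf B₂) := (B₁.submoduleOf B₂).mkQ ∘ₗ f
  have hg : Function.Surjective g := (Submodule.mkQ_surjective _).comp hf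
  have hk : LinearMap.ker g = A₁.submoduleOf A₂ := by
    rw [LinearMap.ker_comp, Submodule.ker_mkQ, h]
  exact ⟨(Submodule.quotEquivOfEq _ _ hk.symm).trans (g.quotKerEquivOfSurjective hg)⟩

theorem hasStandardFiltration_of_subsingleton (le : PartialOrder (Sim R)) [Subsingleton M] :
    HasStandardFiltration le M :=
  ⟨0, fun _ => ⊥, monotone_const, rfl, Subsingleton.elim _ _, fun j hj => absurd hj j.not_lt_zero⟩

theorem IsStandard.hasStandardFiltration {le : PartialOrder (Sim R)} {L : Sim R}
    (h : IsStandard le L M) : HasStandardFiltration le M := by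
  refine ⟨1, fun n => if n = 0 then ⊥ else ⊤, ?_, rfl, rfl, fun j hj => ⟨L, ?_⟩⟩
  · intro a b hab
    dsimp only
    split_ifs with h1 h2
    · exact le_rfl
    · exact bot_le
    · omega
    · exact le_rfl
  · obtain rfl : j = 0 := by omega
    have : (⊥ : Submodule R M).submoduleOf ⊤ = ⊥ := by
      rw [Submodule.submoduleOf, Submodule.comap_bot, Submodule.ker_subtype]
    refine h.of_equiv ?_
    exact (Submodule.quotEquivOfEq _ _ this).trans
      ((Submodule.quotEquivOfEqBot _ rfl).trans Submodule.topEquiv)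

theorem HasStandardFiltration.of_exact {le : PartialOrder (Sim R)} {i : N →ₗ[R] M}
    {p : M →ₗ[R] K} (hi : Function.Injective i) (hp : Function.Surjective p)
    (hip : LinearMap.range i = LinearMap.ker p) (hN : HasStandardFiltration le N)
    (hK : HasStandardFiltration le K) : HasStandardFiltration le M := by
  obtain ⟨m, F, hF, hF0, hFm, hFs⟩ := hN
  obtain ⟨n, E, hE, hE0, hEn, hEs⟩ := hK
  have hle : ∀ a b, (F a).map i ≤ (E b).comap p := by
    rintro a b _ ⟨x, -, rfl⟩
    have : i x ∈ LinearMap.ker p := hip ▸ ⟨x, rfl⟩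
    rw [Submodule.mem_comap, LinearMap.mem_ker.1 this]
    exact (E b).zero_mem
  -- Push the first filtration forward, then pull the second one back. The two descriptions agree at
  -- index m, where both give the range of i, the kernel of p.
  let H : ℕ → Submodule R M := fun j => if j < m then (F j).map i else (E (j - m)).comap p
  have H₁ : ∀ j ≤ m, H j = (F j).map i := by
    intro j hj
    rcases hj.lt_or_eq with h | rfl
    · exact if_pos h
    · simp only [H, lt_irrefl, if_false, Nat.sub_self, hE0, hFm, Submodule.map_top, hip,
        Submodule.comap_bot]
  have H₂ : ∀ j, H (m + j) = (E j).comap p := by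
    intro j
    simp only [H, Nat.not_lt.2 (Nat.le_add_right m j), if_false, Nat.add_sub_cancel_left]
  refine ⟨m + n, H, ?_, ?_, ?_, ?_⟩
  · intro a b hab
    dsimp only [H]
    split_ifs with h1 h2
    · exact Submodule.map_mono (hF hab)
    · exact hle _ _
    · omega
    · exact Submodule.comap_mono (hE (by omega))
  · rw [H₁ 0 (Nat.zero_le m), hF0, Submodule.map_bot]
  · rw [H₂, hEn, Submodule.comap_top]
  · intro j hj
    by_cases hjm : j < m
    · obtain ⟨L, hL⟩ := hFs j hjm
      refine ⟨L, ?_⟩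
      rw [H₁ j hjm.le, H₁ (j + 1) hjm]
      let e := Submodule.equivMapOfInjective i hi (F (j + 1))
      obtain ⟨g⟩ := nonempty_subquotient_equiv (A₁ := F j) (B₁ := (F j).map i)
        e.toLinearMap e.surjective (by
          ext x
          constructor
          · rintro ⟨y, hy, hyx⟩
            have : y = x := hi (hyx.trans (Submodule.coe_equivMapOfInjective_apply i hi _ x))
            change (x : N) ∈ F j
            rwa [← this]
          · intro hx
            exact ⟨x, hx, (Submodule.coe_equivMapOfInjective_apply i hi _ x).symm⟩)
      exact hL.of_equiv g.symm
    · obtain ⟨j, rfl⟩ := Nat.exists_eq_add_of_le (not_lt.1 hjm)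
      obtain ⟨L, hL⟩ := hEs j (by omega)
      refine ⟨L, ?_⟩
      rw [H₂, add_assoc, H₂]
      obtain ⟨g⟩ := nonempty_subquotient_equiv (A₁ := (E j).comap p)
        (A₂ := (E (j + 1)).comap p) (B₁ := E j) (B₂ := E (j + 1))
        (p.restrict fun x hx => hx) (by
          rintro ⟨y, hy⟩
          obtain ⟨x, rfl⟩ := hp y
          exact ⟨⟨x, hy⟩, rfl⟩) rfl
      exact hL.of_equiv g

theorem HasStandardFiltration.of_equiv {le : PartialOrder (Sim R)}
    (h : HasStandardFiltration le M) (e : M ≃ₗ[R] N) : HasStandardFiltration le N :=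
  HasStandardFiltration.of_exact (i := e.toLinearMap) (p := (0 : N →ₗ[R] PUnit.{u+1})) e.injective
    (fun x => ⟨0, Subsingleton.elim _ _⟩) (by rw [LinearMap.ker_zero, LinearEquiv.range]) h
    (hasStandardFiltration_of_subsingleton le)

/-- A finitely generated module which is suitably relatively projective is a direct sum of
standard modules. -/
theorem standard_decomposition [IsArtinianRing R] {le : PartialOrder (Sim R)} (hle : IsAdapted le)
    (M : ModuleCat.{u} R) (hM : Module.Finite R M) :
    (∀ S, IsQuot M S → NoFactor {L | le.lt S L} M ∧ IsRelProjective {L | le.lt S L} M) →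
    HasStandardFiltration le M ∧ ∀ x : M, x ≠ 0 → ∃ (S : Sim R) (D : ModuleCat.{u} R)
      (q : M →ₗ[R] D), IsQuot M S ∧ IsStandard le S D ∧ q x ≠ 0 := by
  refine finite_induction (P := fun M : ModuleCat.{u} R =>
    (∀ S, IsQuot M S → NoFactor {L | le.lt S L} M ∧ IsRelProjective {L | le.lt S L} M) →
    HasStandardFiltration le M ∧ ∀ x : M, x ≠ 0 → ∃ (S : Sim R) (D : ModuleCat.{u} R)
      (q : M →ₗ[R] D), IsQuot M S ∧ IsStandard le S D ∧ q x ≠ 0) (fun M hM ih H => ?_) M hM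
  rcases subsingleton_or_nontrivial M with h | h
  · exact ⟨hasStandardFiltration_of_subsingleton le, fun x hx => absurd (Subsingleton.elim x 0) hx⟩
  obtain ⟨S, t, ht⟩ := exists_isQuot (R := R) (M := M)
  obtain ⟨D, hD⟩ := exists_isStandard le S
  obtain ⟨⟨τ, hτ⟩, hDX, hDp⟩ := hle.isStandard_iff.1 hD
  obtain ⟨hX, hp⟩ := H S ⟨t, ht⟩
  -- M is relatively projective and D has no factors above S, so t lifts to D. The roles are then
  -- exchanged to split p, and the complement `ker p` inherits the hypotheses as a retract of M.
  obtain ⟨p, hpt⟩ := hp.lift hτ.surjective hDX t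
  have hps : Function.Surjective p :=
    hτ.surjective_of_comp (by rw [hpt]; exact LinearMap.surjective_of_ne_zero ht)
  obtain ⟨s, hs⟩ := hDp.lift hps hX LinearMap.id
  have hps' : ∀ x, p (s x) = x := fun x => LinearMap.congr_fun hs x
  let r : M →ₗ[R] LinearMap.ker p :=
    (LinearMap.id - s ∘ₗ p).codRestrict _ fun x => by simp [hps']
  have hr : r ∘ₗ (LinearMap.ker p).subtype = LinearMap.id := by
    ext x
    simp [r]
  have hne : LinearMap.ker p ≠ ⊤ := fun h => by
    have : Nontrivial D := hD |> (hle.isStandard_iff.1 · |>.1.nontrivial)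
    obtain ⟨x, hx⟩ := exists_ne (0 : D)
    obtain ⟨y, rfl⟩ := hps x
    exact hx (by rw [LinearMap.ker_eq_top.1 h]; rfl)
  have hq : ∀ S, IsQuot (LinearMap.ker p) S → IsQuot M S := fun S hS =>
    isQuot_of_surjective hS (surjective_of_retract hr)
  obtain ⟨h₁, h₂⟩ := ih (LinearMap.ker p) hne fun S hS =>
    ⟨(H S (hq S hS)).1.of_injective (Submodule.injective_subtype _),
      (H S (hq S hS)).2.of_retract hr⟩
  refine ⟨HasStandardFiltration.of_exact (Submodule.injective_subtype _) hps
    (Submodule.range_subtype _) h₁ hD.hasStandardFiltration, fun x hx => ?_⟩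
  by_cases hpx : p x = 0
  · obtain ⟨S, D, q, hS, hD, hqx⟩ := h₂ ⟨x, hpx⟩ fun h => hx (congrArg Subtype.val h)
    refine ⟨S, D, q ∘ₗ r, hq S hS, hD, ?_⟩
    rw [LinearMap.comp_apply, show r x = ⟨x, hpx⟩ from LinearMap.congr_fun hr ⟨x, hpx⟩]
    exact hqx
  · exact ⟨S, D, p, ⟨t, ht⟩, hD, hpx⟩

end Filtration

/-! ### First extension groups and directed algebras -/

section Directed

variable {R : Type u} [Ring R]

/-- Exactness of Hom(M, Z) → Hom(ker p, Z) → Ext¹(Y, Z). The next lemma is the converse when the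
middle term is projective; together they trade Ext¹ for extension problems. -/
theorem exists_extend_of_subsingleton_ext {M : Type u} [AddCommGroup M] [Module R M]
    {Y Z : ModuleCat.{u} R} {p : M →ₗ[R] Y} (hp : Function.Surjective p)
    (h : Subsingleton (Abelian.Ext.{u} Y Z 1)) (f : LinearMap.ker p →ₗ[R] Z) :
    ∃ g : M →ₗ[R] Z, g ∘ₗ (LinearMap.ker p).subtype = f := by
  have hS := LinearMap.shortExact_shortComplexKer hp
  obtain ⟨x, hx⟩ := Abelian.Ext.contravariant_sequence_exact₁ hS Z (Abelian.Ext.mk₀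
    (ModuleCat.ofHom f)) (add_zero 1) (Subsingleton.elim (α := Abelian.Ext.{u} Y Z 1) _ _)
  obtain ⟨g, rfl⟩ := (Abelian.Ext.mk₀_bijective _ _).2 x
  rw [Abelian.Ext.mk₀_comp_mk₀] at hx
  have := (Abelian.Ext.mk₀_bijective _ _).1 hx
  exact ⟨g.hom, congrArg ModuleCat.Hom.hom this⟩

theorem subsingleton_ext_of_exists_extend {P : Type u} [AddCommGroup P] [Module R P]
    [Module.Projective R P] {Y Z : ModuleCat.{u} R} {p : P →ₗ[R] Y} (hp : Function.Surjective p)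
    (h : ∀ f : LinearMap.ker p →ₗ[R] Z, ∃ g : P →ₗ[R] Z, g ∘ₗ (LinearMap.ker p).subtype = f) :
    Subsingleton (Abelian.Ext.{u} Y Z 1) := by
  have hS := LinearMap.shortExact_shortComplexKer hp
  have : Projective (ModuleCat.of R P) := (IsProjective.iff_projective P).1 inferInstance
  refine subsingleton_of_forall_eq 0 fun e => ?_
  obtain ⟨x, hx⟩ := Abelian.Ext.contravariant_sequence_exact₃ hS Z e
    (Abelian.Ext.eq_zero_of_projective _) (add_zero 1)
  obtain ⟨f, rfl⟩ := (Abelian.Ext.mk₀_bijective _ _).2 x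
  obtain ⟨g, hg⟩ := h f.hom
  have : f = p.shortComplexKer.f ≫ ModuleCat.ofHom g := by
    ext1
    exact hg.symm
  rw [← hx, this, ← Abelian.Ext.mk₀_comp_mk₀]
  exact hS.extClass_comp_assoc _

/-- Standard modules have no self-extensions. -/
theorem IsStandard.subsingleton_ext [IsArtinianRing R] {le : PartialOrder (Sim R)} {L : Sim R}
    {D : ModuleCat.{u} R} (h : IsStandard le L D) : Subsingleton (Abelian.Ext.{u} D D 1) := by
  have hX := (isStandard_iff.1 h).2.1
  obtain ⟨P, π, hπ, ⟨e⟩⟩ := h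
  have := hπ.projective
  let p : P →ₗ[R] D := e.symm.toLinearMap ∘ₗ (standardKernel le L P).mkQ
  have hp : Function.Surjective p := e.symm.surjective.comp (Submodule.mkQ_surjective _)
  have hk : LinearMap.ker p = traceSub {L' | ¬ le.le L' L} P := by
    rw [LinearEquiv.ker_comp, Submodule.ker_mkQ, traceSub_eq_standardKernel]
  -- The kernel of P → D is a trace submodule, and it has no nonzero maps to D at all.
  refine subsingleton_ext_of_exists_extend hp fun f => ⟨0, ?_⟩
  have := eq_zero_of_noFactor hX (f ∘ₗ (LinearEquiv.ofEq _ _ hk.symm).toLinearMap)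
  refine LinearMap.ext fun x => ?_
  have := LinearMap.congr_fun this ((LinearEquiv.ofEq _ _ hk) x)
  exact this.symm

variable [IsArtinianRing R] {le : PartialOrder (Sim R)}

/-- Since the standard module is L, the radical K of the cover is the trace of the covers of those Z
with Z ≰ L. A nonzero class gives a nonzero K → L', which rules out L' ≤ L. If L < L' also failed,
the quotient of P by the kernel of K → L' would have top L and factors L and L' only, contradicting
adaptedness. -/
theorem IsDirected.lt_of_ext (h : IsDirected le) {L L' : Sim R}
    (hL : ¬ Subsingleton (Abelian.Ext.{u} L.rep L'.rep 1)) : le.lt L L' := by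
  obtain ⟨P, π, hπ, ⟨e⟩⟩ := h.standard_simple L
  have := hπ.projective
  set K := standardKernel le L P with hK
  let p : P →ₗ[R] L.rep := e.symm.toLinearMap ∘ₗ K.mkQ
  have hp : Function.Surjective p := e.symm.surjective.comp (Submodule.mkQ_surjective _)
  have hk : LinearMap.ker p = K := by rw [LinearEquiv.ker_comp, Submodule.ker_mkQ]
  obtain ⟨f, hf⟩ : ∃ f : K →ₗ[R] L'.rep, f ≠ 0 := by
    by_contra! hf
    refine hL (subsingleton_ext_of_exists_extend hp fun f => ⟨0, LinearMap.ext fun x => ?_⟩)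
    have := LinearMap.congr_fun (hf (f ∘ₗ (LinearEquiv.ofEq _ _ hk.symm).toLinearMap))
      ((LinearEquiv.ofEq _ _ hk) x)
    exact this.symm
  by_contra hlt
  have h₁ : ¬ le.le L' L := fun hle => hf <| eq_zero_of_noFactor (X := {L' | ¬ le.le L' L})
    (noFactor_rep fun h => h hle) f
  have h₂ : ¬ le.le L L' := fun hle => hlt (lt_of_le_of_ne hle fun he => h₁ (he ▸ le.le_refl _))
  let W := (LinearMap.ker f).map K.subtype
  have hWK : W ≤ K := Submodule.map_subtype_le _ _
  have hWp : W ≤ LinearMap.ker p := hWK.trans_eq hk.symm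
  let p' : (P ⧸ W) →ₗ[R] L.rep := W.liftQ p hWp
  have hp' : Function.Surjective p' := fun x => by
    obtain ⟨y, rfl⟩ := hp x
    exact ⟨W.mkQ y, rfl⟩
  have hW : W ≤ K.comap (LinearMap.id) := hWK
  let i₀ : (K ⧸ LinearMap.ker f) →ₗ[R] (P ⧸ W) :=
    (LinearMap.ker f).mapQ W K.subtype (Submodule.le_comap_map _ _)
  let ef := f.quotKerEquivOfSurjective (LinearMap.surjective_of_ne_zero hf)
  let i : L'.rep →ₗ[R] (P ⧸ W) := i₀ ∘ₗ ef.symm.toLinearMap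
  have hif : ∀ y : K, i (f y) = W.mkQ y := fun y => by
    have : ef.symm (f y) = Submodule.Quotient.mk y := by
      rw [LinearEquiv.symm_apply_eq]
      rfl
    simp [i, this, i₀]
  have hi0 : i ≠ 0 := fun h0 => hf <| LinearMap.ext fun y => by
    have : (y : P) ∈ W := by
      rw [← Submodule.Quotient.mk_eq_zero, ← Submodule.mkQ_apply, ← hif, h0]
      rfl
    obtain ⟨z, hz, hzy⟩ := this
    rw [← Subtype.ext hzy]
    exact hz
  have hcf : ∀ Z, IsCompositionFactor (P ⧸ W) Z → Z = L' ∨ Z = L := by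
    intro Z hZ
    refine (cf_of_exact (i := i) (p := p') ?_ hZ).imp eq_of_cf_rep eq_of_cf_rep
    intro x hx
    obtain ⟨y, rfl⟩ := W.mkQ_surjective x
    have : y ∈ K := hk ▸ hx
    exact ⟨f ⟨y, this⟩, hif ⟨y, this⟩⟩
  have : Nontrivial L.rep := IsSimpleModule.nontrivial R _
  have : Nontrivial (P ⧸ W) := hp'.nontrivial
  have ht : HasTop (P ⧸ W) L := HasTop.of_surjective ⟨π, hπ.isEssEpi⟩ W.mkQ_surjective
  refine h₁ (h.adapted.le_of_cf ht ?_ ?_)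
  · intro Z hZ hc
    rcases hcf Z hc with rfl | rfl
    · exact hlt hZ
    · exact lt_irrefl _ hZ
  · have hinj : Function.Injective i :=
      (LinearMap.injective_or_eq_zero i).resolve_right hi0
    refine cf_of_injective hinj (cf_of_isQuot ⟨LinearMap.id, fun h0 => ?_⟩)
    exact hi0 (by rw [← LinearMap.comp_id i, h0, LinearMap.comp_zero])

/-- Remove a simple quotient S of M. A simple quotient W of the kernel either extends to a quotient
of M or has Ext¹(S, W) ≠ 0 and so S < W. Hence the bound on the quotients of M passes to the kernel,
and induction applies. -/
theorem le_of_cf_of_ext (H : ∀ L L' : Sim R,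
    ¬ Subsingleton (Abelian.Ext.{u} L.rep L'.rep 1) → le.lt L L') {L : Sim R}
    (M : ModuleCat.{u} R) (hM : Module.Finite R M) :
    (∀ Z, IsQuot M Z → le.le L Z) → ∀ Z, IsCompositionFactor M Z → le.le L Z := by
  refine finite_induction (P := fun M : ModuleCat.{u} R => (∀ Z, IsQuot M Z → le.le L Z) →
    ∀ Z, IsCompositionFactor M Z → le.le L Z) (fun M hM ih hQ Z hZ => ?_) M hM
  have : Nontrivial M := by
    obtain ⟨φ, hφ⟩ := cf_iff_cover.1 hZ
    by_contra h
    rw [not_nontrivial_iff_subsingleton] at h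
    exact hφ (LinearMap.ext fun x => Subsingleton.elim _ _)
  obtain ⟨S, q, hq⟩ := exists_isQuot (R := R) (M := M)
  have hqs := LinearMap.surjective_of_ne_zero hq
  rcases cf_of_exact (i := (LinearMap.ker q).subtype) (p := q)
    (Submodule.range_subtype _).ge hZ with h | h
  · refine ih (LinearMap.ker q) (fun h => hq (LinearMap.ker_eq_top.1 h)) ?_ Z h
    rintro W ⟨w, hw⟩
    by_cases hs : Subsingleton (Abelian.Ext.{u} S.rep W.rep 1)
    · obtain ⟨g, hg⟩ := exists_extend_of_subsingleton_ext hqs hs w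
      refine hQ W ⟨g, fun h0 => hw ?_⟩
      rw [← hg, h0, LinearMap.zero_comp]
    · exact le.le_trans _ _ _ (hQ S ⟨q, hq⟩) (H S W hs).le
  · rw [eq_of_cf_rep h]
    exact hQ S ⟨q, hq⟩

/-- If extensions only go upwards, then all factors of a module with top L lie above L. This makes
the adaptedness condition vacuous and forces the whole radical of the cover into the trace. The
criterion mentions neither covers nor socles, so it can be transferred. -/
theorem isDirected_iff :
    IsDirected le ↔
      ∀ L L' : Sim R, ¬ Subsingleton (Abelian.Ext.{u} L.rep L'.rep 1) → le.lt L L' := by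
  refine ⟨fun h L L' hL => h.lt_of_ext hL, fun H => ⟨?_, ?_⟩⟩
  · intro M hM L L' ⟨e⟩ ⟨e'⟩ h₁ _
    refine absurd (le_of_cf_of_ext H M hM (fun Z hZ => ?_) L' (cf_of_injective
      (f := (socle (R := R) M).subtype ∘ₗ e'.symm.toLinearMap)
      ((Submodule.injective_subtype _).comp e'.symm.injective)
      (cf_of_isQuot ⟨LinearMap.id, fun h0 => ?_⟩))) h₁
    · obtain ⟨q, hq⟩ := hZ
      have hk : Module.jacobson R M ≤ LinearMap.ker q := IsSemisimpleModule.jacobson_le_ker R R _ _ q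
      have : IsQuot L.rep Z := ⟨(Module.jacobson R M).liftQ q hk ∘ₗ e.symm.toLinearMap,
        fun h0 => hq (LinearMap.ext fun x => by
          have := LinearMap.congr_fun h0 (e (Submodule.Quotient.mk x))
          rw [LinearMap.comp_apply, LinearEquiv.coe_coe, LinearEquiv.symm_apply_apply] at this
          exact this)⟩
      rw [eq_of_cf_rep (cf_of_isQuot this)]
    · have : Nontrivial L'.rep := IsSimpleModule.nontrivial R _
      obtain ⟨x, hx⟩ := exists_ne (0 : L'.rep)
      exact hx (LinearMap.congr_fun h0 x)
  · intro L
    have ht := L.hasTop_cover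
    refine isStandard_iff.2 ⟨⟨LinearMap.id, ⟨Function.surjective_id, fun X hX => ?_⟩⟩,
      noFactor_rep fun h => h (le.le_refl L), ?_⟩
    · rwa [LinearMap.ker_id, sup_bot_eq] at hX
    let X := {L' | ¬ le.le L' L}
    let K := LinearMap.ker L.coverMap
    have hle : traceSub X L.cover ≤ K :=
      traceSub_le_ker (noFactor_rep fun h : ¬ le.le L L => h (le.le_refl L)) L.coverMap
    have heq : traceSub X L.cover = K := by
      by_contra hne
      have hne' : (traceSub X L.cover).submoduleOf K ≠ ⊤ := fun h =>
        hne (le_antisymm hle (Submodule.submoduleOf_eq_top.1 h))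
      have := isNoetherian_of_isNoetherianRing_of_finite R L.cover
      -- Take a simple quotient L' of the radical K that kills the trace. If Ext¹(L, L') = 0, it
      -- extends to the cover, where the kernel of the extension must be the unique maximal
      -- submodule K, so w = 0. Otherwise L < L', the cover of L' maps to K inside the trace, and
      -- again w would vanish.
      obtain ⟨L', w, hw, hwt⟩ := exists_isQuot_notMem (R := R) (M := K) hne'
      have hws := LinearMap.surjective_of_ne_zero hw
      by_cases hs : Subsingleton (Abelian.Ext.{u} L.rep L'.rep 1)
      · obtain ⟨g, hg⟩ := exists_extend_of_subsingleton_ext L.isProjectiveCover.surjective hs w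
        have hg0 : g ≠ 0 := fun h0 => hw (by rw [← hg, h0, LinearMap.zero_comp])
        have hgk : LinearMap.ker g = K := by
          have hlek := L.isProjectiveCover.isEssEpi.le_ker
            fun h => hg0 (LinearMap.ker_eq_top.1 h)
          have hco : IsCoatom (LinearMap.ker g) := isSimpleModule_iff_isCoatom.1
            (IsSimpleModule.congr (g.quotKerEquivOfSurjective (LinearMap.surjective_of_ne_zero hg0)))
          refine (hco.le_iff_eq fun h => ?_).1 hlek |>.symm
          have h0 : L.coverMap = 0 := LinearMap.ker_eq_top.1 h
          have : Nontrivial L.rep := IsSimpleModule.nontrivial R _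
          obtain ⟨x, hx⟩ := exists_ne (0 : L.rep)
          obtain ⟨y, rfl⟩ := L.isProjectiveCover.surjective x
          exact hx (by rw [h0]; rfl)
        refine hw (LinearMap.ext fun x => ?_)
        rw [← hg]
        exact hgk.ge x.2
      · have hlt := H L L' hs
        obtain ⟨φ, hφ⟩ := Module.projective_lifting_property w L'.coverMap hws
        have hr : LinearMap.range (K.subtype ∘ₗ φ) ≤ traceSub X L.cover :=
          range_le_traceSub (X := X) (fun h => absurd hlt (not_lt_of_ge h)) L'.isProjectiveCover _
        obtain ⟨τ, hτ⟩ := L'.hasTop_cover.isQuot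
        have : Nontrivial L'.rep := IsSimpleModule.nontrivial R _
        obtain ⟨x, hx⟩ := exists_ne (0 : L'.rep)
        obtain ⟨y, rfl⟩ := L'.isProjectiveCover.surjective x
        apply hx
        rw [← hφ]
        exact hwt (show φ y ∈ (traceSub X L.cover).submoduleOf K from hr ⟨y, rfl⟩)
    have := isRelProjective_quotient_traceSub (X := X) (M := L.cover)
    rw [heq] at this
    exact this.of_equiv (L.coverMap.quotKerEquivOfSurjective L.isProjectiveCover.surjective).symm

end Directed

/-! ### Maps to and from semisimple modules, and Schur's lemma -/

section Semisimple

variable {R : Type u} [Ring R] {M N K : Type u} [AddCommGroup M] [Module R M] [AddCommGroup N]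
  [Module R N] [AddCommGroup K] [Module R K]

/-- Maps to a semisimple module kill the radical, hence factor through the top. -/
theorem HasTop.exists_of_isSemisimple {L : Sim R} (hM : HasTop M L) [IsSemisimpleModule R N]
    {f : M →ₗ[R] N} (hf : f ≠ 0) : ∃ g : L.rep →ₗ[R] N, g ≠ 0 := by
  obtain ⟨τ, hτ⟩ := hM
  have hj : LinearMap.ker τ ≤ Module.jacobson R M := le_sInf fun m hm => by
    by_contra h
    have h' : m < LinearMap.ker τ ⊔ m := lt_of_le_of_ne le_sup_right fun he => h (he ▸ le_sup_left)
    have := hm.2 _ h'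
    exact hm.1 (hτ.superfluous m (by rw [sup_comm]; exact this))
  have hk : LinearMap.ker τ ≤ LinearMap.ker f :=
    hj.trans (IsSemisimpleModule.jacobson_le_ker R R M N f)
  let e := τ.quotKerEquivOfSurjective hτ.surjective
  refine ⟨(LinearMap.ker τ).liftQ f hk ∘ₗ e.symm.toLinearMap, fun h0 => hf ?_⟩
  ext1 x
  have := LinearMap.congr_fun h0 (e (Submodule.Quotient.mk x))
  rw [LinearMap.comp_apply, LinearEquiv.coe_coe, LinearEquiv.symm_apply_apply] at this
  exact this

theorem isQuot_of_isSemisimple [IsSemisimpleModule R M] {L : Sim R} {f : L.rep →ₗ[R] M}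
    (hf : f ≠ 0) : IsQuot M L := by
  have hi : Function.Injective f := (LinearMap.injective_or_eq_zero f).resolve_right hf
  obtain ⟨C, hC⟩ := exists_isCompl (LinearMap.range f)
  refine ⟨(LinearEquiv.ofInjective f hi).symm.toLinearMap ∘ₗ
    (LinearMap.range f).projectionOnto C hC, fun h0 => hf ?_⟩
  ext1 x
  have := LinearMap.congr_fun h0 (f x)
  have h2 : (LinearMap.range f).projectionOnto C hC (f x) = ⟨f x, x, rfl⟩ :=
    Submodule.projectionOnto_apply_left hC ⟨f x, x, rfl⟩
  rw [LinearMap.comp_apply, h2, LinearMap.zero_apply, LinearEquiv.coe_coe,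
    LinearEquiv.map_eq_zero_iff] at this
  exact congrArg Subtype.val this

theorem exists_of_isQuot_of_isSemisimple [IsSemisimpleModule R M] {L : Sim R} (h : IsQuot M L) :
    ∃ f : L.rep →ₗ[R] M, f ≠ 0 := by
  obtain ⟨q, hq⟩ := h
  obtain ⟨C, hC⟩ := exists_isCompl (LinearMap.ker q)
  have hqs := LinearMap.surjective_of_ne_zero hq
  let e := (Submodule.quotientEquivOfIsCompl _ C hC).symm.trans (q.quotKerEquivOfSurjective hqs)
  refine ⟨C.subtype ∘ₗ e.symm.toLinearMap, fun h0 => ?_⟩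
  have : Nontrivial L.rep := IsSimpleModule.nontrivial R _
  obtain ⟨x, hx⟩ := exists_ne (0 : L.rep)
  have := LinearMap.congr_fun h0 x
  simp only [LinearMap.comp_apply, Submodule.subtype_apply, LinearEquiv.coe_coe,
    LinearMap.zero_apply, ZeroMemClass.coe_eq_zero, LinearEquiv.map_eq_zero_iff] at this
  exact hx this

theorem le_socle_of_isSemisimple {A : Submodule R M} [IsSemisimpleModule R A] :
    A ≤ socle (R := R) M := by
  have h : (⊤ : Submodule R A) ≤ (socle (R := R) M).comap A.subtype := by
    rw [← IsSemisimpleModule.sSup_simples_eq_top R A]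
    refine sSup_le fun S hS => ?_
    have hS : IsSimpleModule R S := hS
    have : IsSimpleModule R (S.map A.subtype) :=
      IsSimpleModule.congr (Submodule.equivMapOfInjective A.subtype A.injective_subtype S).symm
    rw [← Submodule.map_le_iff_le_comap]
    exact le_sSup (a := S.map A.subtype) this
  intro x hx
  exact h (Submodule.mem_top (x := (⟨x, hx⟩ : A)))

theorem exists_algebraMap_smul {k : Type u} [Field k] [IsAlgClosed k] [Algebra k R]
    [FiniteDimensional k R] [IsSimpleModule R M] (f : M →ₗ[R] M) :
    ∃ c : k, ∀ m : M, f m = algebraMap k R c • m := by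
  let _ : Module k M := Module.compHom M (algebraMap k R)
  have : IsScalarTower k R M := ⟨fun c r m => by
    rw [Algebra.smul_def, mul_smul]
    rfl⟩
  have : Module.Finite R M := inferInstance
  have : Module.Finite k M := Module.Finite.trans R M
  obtain ⟨c, hc⟩ := (IsSimpleModule.algebraMap_end_bijective_of_isAlgClosed (A := R) (V := M) k).2 f
  exact ⟨c, fun m => by rw [← hc]; rfl⟩

end Semisimple

/-! ### Frobenius pairs -/

/-- A pair of functors between two module categories which are adjoint to each other on both
sides, such that both identity functors are natural retracts of the composites. -/
structure FrobPair (R T : Type u) [Ring R] [Ring T] where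
  /-- The functor from `T`-modules to `R`-modules. -/
  U : ModuleCat.{u} T ⥤ ModuleCat.{u} R
  /-- The functor from `R`-modules to `T`-modules. -/
  V : ModuleCat.{u} R ⥤ ModuleCat.{u} T
  additiveU : U.Additive
  additiveV : V.Additive
  /-- `V` is left adjoint to `U`. -/
  adj : V ⊣ U
  /-- `V` is right adjoint to `U`. -/
  adj' : U ⊣ V
  /-- The inclusion of the identity functor of `T`-modules as a retract. -/
  ηT : 𝟭 (ModuleCat.{u} T) ⟶ U ⋙ V
  /-- The retraction onto the identity functor of `T`-modules. -/
  pT : U ⋙ V ⟶ 𝟭 (ModuleCat.{u} T)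
  retT : ∀ M, ηT.app M ≫ pT.app M = 𝟙 M
  /-- The inclusion of the identity functor of `R`-modules as a retract. -/
  ηR : 𝟭 (ModuleCat.{u} R) ⟶ V ⋙ U
  /-- The retraction onto the identity functor of `R`-modules. -/
  pR : V ⋙ U ⟶ 𝟭 (ModuleCat.{u} R)
  retR : ∀ M, ηR.app M ≫ pR.app M = 𝟙 M
  finU : ∀ M : ModuleCat.{u} T, Module.Finite T M → Module.Finite R (U.obj M)
  finV : ∀ M : ModuleCat.{u} R, Module.Finite R M → Module.Finite T (V.obj M)
  ssU : ∀ M : ModuleCat.{u} T, IsSemisimpleModule T M → IsSemisimpleModule R (U.obj M)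
  ssV : ∀ M : ModuleCat.{u} R, IsSemisimpleModule R M → IsSemisimpleModule T (V.obj M)

namespace FrobPair

variable {R T : Type u} [Ring R] [Ring T]

/-- The pair of functors in the opposite order. -/
def swap (P : FrobPair R T) : FrobPair T R where
  U := P.V
  V := P.U
  additiveU := P.additiveV
  additiveV := P.additiveU
  adj := P.adj'
  adj' := P.adj
  ηT := P.ηR
  pT := P.pR
  retT := P.retR
  ηR := P.ηT
  pR := P.pT
  retR := P.retT
  finU := P.finV
  finV := P.finU
  ssU := P.ssV
  ssV := P.ssU

variable (P : FrobPair R T)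

instance : P.U.Additive := P.additiveU
instance : P.V.Additive := P.additiveV

instance : Limits.PreservesFiniteLimits P.U :=
  have : Limits.PreservesLimitsOfSize.{0, 0} P.U := P.adj.rightAdjoint_preservesLimits
  inferInstance

instance : Limits.PreservesFiniteLimits P.V :=
  have : Limits.PreservesLimitsOfSize.{0, 0} P.V := P.adj'.rightAdjoint_preservesLimits
  inferInstance

instance : Limits.PreservesFiniteColimits P.U :=
  have : Limits.PreservesColimitsOfSize.{0, 0} P.U := P.adj'.leftAdjoint_preservesColimits
  inferInstance

instance : Limits.PreservesFiniteColimits P.V :=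
  have : Limits.PreservesColimitsOfSize.{0, 0} P.V := P.adj.leftAdjoint_preservesColimits
  inferInstance

theorem surjective_U {M N : ModuleCat.{u} T} {f : M ⟶ N} (hf : Function.Surjective f) :
    Function.Surjective (P.U.map f) := by
  rw [← ModuleCat.epi_iff_surjective] at hf ⊢
  infer_instance

theorem surjective_V {M N : ModuleCat.{u} R} {f : M ⟶ N} (hf : Function.Surjective f) :
    Function.Surjective (P.V.map f) := P.swap.surjective_U hf

/-- By naturality f is a retract of V U f. -/
theorem U_faithful {M N : ModuleCat.{u} T} {f : M ⟶ N} (h : P.U.map f = 0) : f = 0 := by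
  have : P.ηT.app M ≫ P.V.map (P.U.map f) = f ≫ P.ηT.app N := (P.ηT.naturality f).symm
  have h2 : f ≫ P.ηT.app N ≫ P.pT.app N = f := by rw [P.retT, Category.comp_id]
  rw [← h2, ← Category.assoc, ← this, h, Functor.map_zero, Limits.comp_zero, Limits.zero_comp]

theorem homEquiv_ne_zero {M : ModuleCat.{u} R} {N : ModuleCat.{u} T} {f : P.V.obj M ⟶ N}
    (hf : f ≠ 0) : P.adj.homEquiv M N f ≠ 0 :=
  (map_ne_zero_iff (P.adj.homAddEquiv M N) (P.adj.homAddEquiv M N).injective).2 hf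

theorem homEquiv_symm_ne_zero {M : ModuleCat.{u} R} {N : ModuleCat.{u} T} {f : M ⟶ P.U.obj N}
    (hf : f ≠ 0) : (P.adj.homEquiv M N).symm f ≠ 0 :=
  (map_ne_zero_iff (P.adj.homAddEquiv M N).symm (P.adj.homAddEquiv M N).symm.injective).2 hf

theorem exists_hom_iff {M : ModuleCat.{u} R} {N : ModuleCat.{u} T} :
    (∃ f : P.V.obj M →ₗ[T] N, f ≠ 0) ↔ ∃ f : M →ₗ[R] P.U.obj N, f ≠ 0 := by
  constructor
  · rintro ⟨f, hf⟩
    refine ⟨(P.adj.homEquiv M N (ModuleCat.ofHom f)).hom, fun h => ?_⟩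
    refine P.homEquiv_ne_zero (f := ModuleCat.ofHom f) (fun h0 => hf ?_) (ModuleCat.hom_ext h)
    exact congrArg ModuleCat.Hom.hom h0
  · rintro ⟨f, hf⟩
    refine ⟨((P.adj.homEquiv M N).symm (ModuleCat.ofHom f)).hom, fun h => ?_⟩
    refine P.homEquiv_symm_ne_zero (f := ModuleCat.ofHom f) (fun h0 => hf ?_) (ModuleCat.hom_ext h)
    exact congrArg ModuleCat.Hom.hom h0

/-- The relation between simple `T`-modules and simple `R`-modules: `L` occurs in `U S`. -/
def Rel (S : Sim T) (L : Sim R) : Prop := ∃ f : L.rep →ₗ[R] P.U.obj S.rep, f ≠ 0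

theorem isSemisimple_U (S : Sim T) : IsSemisimpleModule R (P.U.obj S.rep) :=
  P.ssU _ inferInstance

theorem isSemisimple_V (L : Sim R) : IsSemisimpleModule T (P.V.obj L.rep) :=
  P.ssV _ inferInstance

theorem rel_iff_isQuot_V {S : Sim T} {L : Sim R} : P.Rel S L ↔ IsQuot (P.V.obj L.rep) S :=
  P.exists_hom_iff.symm

theorem rel_iff_isQuot_U {S : Sim T} {L : Sim R} : P.Rel S L ↔ IsQuot (P.U.obj S.rep) L := by
  have := P.isSemisimple_U S
  exact ⟨fun ⟨_, hf⟩ => isQuot_of_isSemisimple hf, exists_of_isQuot_of_isSemisimple⟩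

/-- U S is semisimple, so L embeds in it iff L is a quotient of it; the second adjunction turns the
latter into maps S → V L. -/
theorem rel_swap {S : Sim T} {L : Sim R} : P.swap.Rel L S ↔ P.Rel S L := by
  rw [P.rel_iff_isQuot_U]
  exact P.swap.exists_hom_iff.symm

theorem nontrivial_U (M : ModuleCat.{u} T) [Nontrivial M] : Nontrivial (P.U.obj M) := by
  by_contra h
  rw [not_nontrivial_iff_subsingleton] at h
  have h0 : P.U.map (𝟙 M) = 0 := by
    ext x
    exact Subsingleton.elim _ _
  have := P.U_faithful h0
  obtain ⟨x, hx⟩ := exists_ne (0 : M)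
  exact hx (LinearMap.congr_fun (congrArg ModuleCat.Hom.hom this) x)

theorem exists_rel_right [IsArtinianRing R] (S : Sim T) : ∃ L, P.Rel S L := by
  have : Nontrivial S.rep := IsSimpleModule.nontrivial T _
  have := P.nontrivial_U S.rep
  obtain ⟨L, i, hi⟩ := exists_isSub (R := R) (M := P.U.obj S.rep)
  refine ⟨L, i, ?_⟩
  rintro rfl
  have : Nontrivial L.rep := IsSimpleModule.nontrivial R _
  obtain ⟨x, hx⟩ := exists_ne (0 : L.rep)
  exact hx (hi rfl)

theorem exists_rel_left [IsArtinianRing T] (L : Sim R) : ∃ S, P.Rel S L := by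
  obtain ⟨S, hS⟩ := P.swap.exists_rel_right L
  exact ⟨S, P.rel_swap.1 hS⟩

/-- A map V M → S corresponds to a map M → U S into a semisimple module, which factors through the
top L. -/
theorem rel_of_hasTop {M : ModuleCat.{u} R} {L : Sim R} {S : Sim T}
    (hM : HasTop M L) (hN : IsQuot (P.V.obj M) S) : P.Rel S L := by
  have := P.isSemisimple_U S
  obtain ⟨f, hf⟩ := P.exists_hom_iff.1 hN
  exact hM.exists_of_isSemisimple hf

/-- A map from the cover of L to U M corresponds to one from V of the cover to M. The simple
quotients of its image are linked to L. -/
theorem exists_cf_of_cf_U [IsArtinianRing R] [IsArtinianRing T] {M : ModuleCat.{u} T} {L : Sim R}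
    (h : IsCompositionFactor (P.U.obj M) L) : ∃ S, P.Rel S L ∧ IsCompositionFactor M S := by
  obtain ⟨φ, hφ⟩ := P.exists_hom_iff.2 (cf_iff_cover.1 h)
  have : Module.Finite T (P.V.obj L.cover) := P.finV _ inferInstance
  have : Nontrivial (LinearMap.range φ) := by
    rw [Submodule.nontrivial_iff_ne_bot, Ne, LinearMap.range_eq_bot]
    exact hφ
  obtain ⟨S, hS⟩ := exists_isQuot (R := T) (M := LinearMap.range φ)
  refine ⟨S, P.rel_of_hasTop L.hasTop_cover
    (isQuot_of_surjective hS φ.surjective_rangeRestrict), ?_⟩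
  exact cf_of_injective (Submodule.injective_subtype _) (cf_of_isQuot hS)

theorem exists_cf_U_of_cf [IsArtinianRing R] [IsArtinianRing T] {M : ModuleCat.{u} T} {S : Sim T}
    (h : IsCompositionFactor M S) : ∃ L, P.Rel S L ∧ IsCompositionFactor (P.U.obj M) L := by
  obtain ⟨φ, hφ⟩ := cf_iff_cover.1 h
  have h0 : (P.U.map (ModuleCat.ofHom φ)).hom ≠ 0 := fun h0 => hφ <|
    congrArg ModuleCat.Hom.hom (P.U_faithful (f := ModuleCat.ofHom φ) (ModuleCat.hom_ext h0))
  set ψ := (P.U.map (ModuleCat.ofHom φ)).hom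
  have : Module.Finite R (P.U.obj S.cover) := P.finU _ inferInstance
  have : Module.Finite R (P.U.obj (ModuleCat.of T S.cover)) := this
  have : Nontrivial (LinearMap.range ψ) := by
    rw [Submodule.nontrivial_iff_ne_bot, Ne, LinearMap.range_eq_bot]
    exact h0
  obtain ⟨L, hL⟩ := exists_isQuot (R := R) (M := LinearMap.range ψ)
  refine ⟨L, P.rel_swap.1 (P.swap.rel_of_hasTop S.hasTop_cover (isQuot_of_surjective hL ψ.surjective_rangeRestrict)), ?_⟩
  exact cf_of_injective (Submodule.injective_subtype _) (cf_of_isQuot hL)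

/-- Sets of simple modules which correspond to each other. -/
def Match (X : Set (Sim T)) (Y : Set (Sim R)) : Prop := ∀ S L, P.Rel S L → (S ∈ X ↔ L ∈ Y)

variable {P} in
theorem Match.swap {X : Set (Sim T)} {Y : Set (Sim R)} (h : P.Match X Y) : P.swap.Match Y X :=
  fun L S hL => (h S L (P.rel_swap.1 hL)).symm

section Match

variable [IsArtinianRing R] [IsArtinianRing T] {X : Set (Sim T)} {Y : Set (Sim R)}

variable {P} in
theorem Match.noFactor_U (h : P.Match X Y) {M : ModuleCat.{u} T} (hM : NoFactor X M) :
    NoFactor Y (P.U.obj M) := by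
  intro L hL hc
  obtain ⟨S, hS, hc⟩ := P.exists_cf_of_cf_U hc
  exact hM S ((h S L hS).2 hL) hc

variable {P} in
theorem Match.of_noFactor_U (h : P.Match X Y) {M : ModuleCat.{u} T}
    (hM : NoFactor Y (P.U.obj M)) : NoFactor X M := by
  intro S hS hc
  obtain ⟨L, hL, hc⟩ := P.exists_cf_U_of_cf hc
  exact hM L ((h S L hL).1 hS) hc

variable {P} in
-- The lifting problem is transposed along V ⊣ U; U preserves surjections and the conditions on
-- factors.
theorem Match.isRelProjective_V (h : P.Match X Y) {D : ModuleCat.{u} R}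
    (hD : IsRelProjective Y D) : IsRelProjective X (P.V.obj D) := by
  intro M N p hp hM f
  obtain ⟨g, hg⟩ := hD (P.U.obj M) (P.U.obj N) (P.U.map (ModuleCat.ofHom p)).hom
    (P.surjective_U hp) (h.noFactor_U hM) (P.adj.homEquiv D N (ModuleCat.ofHom f)).hom
  refine ⟨((P.adj.homEquiv D M).symm (ModuleCat.ofHom g)).hom, ?_⟩
  have : ((P.adj.homEquiv D M).symm (ModuleCat.ofHom g)) ≫ ModuleCat.ofHom p =
      ModuleCat.ofHom f := by
    rw [← Adjunction.homEquiv_naturality_right_symm, Equiv.symm_apply_eq]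
    exact ModuleCat.hom_ext hg
  exact congrArg ModuleCat.Hom.hom this

variable {P} in
theorem Match.of_isRelProjective_U (h : P.Match X Y) {D : ModuleCat.{u} T}
    (hD : IsRelProjective Y (P.U.obj D)) : IsRelProjective X D :=
  (h.isRelProjective_V hD).of_retract (i := (P.ηT.app D).hom) (r := (P.pT.app D).hom)
    (congrArg ModuleCat.Hom.hom (P.retT D))

end Match

/-- Compatible partial orders on the simple modules. -/
def OrderCompat (leT : PartialOrder (Sim T)) (leR : PartialOrder (Sim R)) : Prop :=
  ∀ S L S' L', P.Rel S L → P.Rel S' L' → (leT.lt S S' ↔ leR.lt L L')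

variable {P} {leT : PartialOrder (Sim T)} {leR : PartialOrder (Sim R)}

theorem OrderCompat.swap (h : P.OrderCompat leT leR) : P.swap.OrderCompat leR leT :=
  fun L S L' S' hL hL' => (h S L S' L' (P.rel_swap.1 hL) (P.rel_swap.1 hL')).symm

theorem OrderCompat.match (h : P.OrderCompat leT leR) {S : Sim T} {L : Sim R} (hS : P.Rel S L) :
    P.Match {S' | leT.lt S S'} {L' | leR.lt L L'} := fun S' L' hS' => h S L S' L' hS hS'

end FrobPair

/-! ### Simple tops, scalars on tops -/

section Top

variable {R : Type u} [Ring R] {M : Type u} [AddCommGroup M] [Module R M] {L : Sim R}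

theorem hasTop_of_moduleTop [Module.Finite R M] (e : ModuleTop (R := R) M ≃ₗ[R] L.rep) :
    HasTop M L := by
  refine ⟨e.toLinearMap ∘ₗ (Module.jacobson R M).mkQ,
    e.surjective.comp (Submodule.mkQ_surjective _), fun X hX => ?_⟩
  rw [LinearEquiv.ker_comp, Submodule.ker_mkQ] at hX
  by_contra h
  obtain ⟨m, hm, hXm⟩ := (eq_top_or_exists_le_coatom X).resolve_left h
  exact hm.1 (top_le_iff.1 (hX ▸ sup_le hXm (sInf_le hm)))

theorem HasTop.ker_le_of_isSemisimple {τ : M →ₗ[R] L.rep} (hτ : IsEssEpi τ) {N : Type u}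
    [AddCommGroup N] [Module R N] [IsSemisimpleModule R N] (f : M →ₗ[R] N) :
    LinearMap.ker τ ≤ LinearMap.ker f := by
  refine (le_sInf fun m hm => ?_).trans (IsSemisimpleModule.jacobson_le_ker R R M N f)
  by_contra h
  have h' : m < LinearMap.ker τ ⊔ m := lt_of_le_of_ne le_sup_right fun he => h (he ▸ le_sup_left)
  have := hm.2 _ h'
  exact hm.1 (hτ.superfluous m (by rw [sup_comm]; exact this))

theorem exists_surjective_lift [IsArtinianRing R] {q : M →ₗ[R] L.rep} (hq : q ≠ 0) :
    ∃ φ : L.cover →ₗ[R] M, q ∘ₗ φ = L.coverMap :=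
  Module.projective_lifting_property q L.coverMap (LinearMap.surjective_of_ne_zero hq)

theorem isSemisimpleModule_of_socle_eq_top (h : socle (R := R) M = ⊤) : IsSemisimpleModule R M :=
  IsSemisimpleModule.of_sSup_simples_eq_top h

theorem socle_eq_top [IsSemisimpleModule R M] : socle (R := R) M = ⊤ :=
  IsSemisimpleModule.sSup_simples_eq_top R M

theorem eq_of_moduleTop_of_socle [IsSemisimpleModule R M] {L' : Sim R}
    (e : ModuleTop (R := R) M ≃ₗ[R] L.rep) (e' : socle (R := R) M ≃ₗ[R] L'.rep) : L = L' := by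
  have h := IsSemisimpleModule.jacobson_eq_bot R M
  have h' := socle_eq_top (R := R) (M := M)
  exact Sim.eq_of_equiv <| e.symm.trans <| (Submodule.quotEquivOfEqBot _ h).trans <|
    Submodule.topEquiv.symm.trans <| (LinearEquiv.ofEq _ _ h'.symm).trans e'

/-- Scalars from the base field act by endomorphisms. -/
def scalarEnd (k : Type u) [Field k] [Algebra k R] (M : Type u) [AddCommGroup M] [Module R M]
    (c : k) : M →ₗ[R] M where
  toFun m := algebraMap k R c • m
  map_add' m n := smul_add _ m n
  map_smul' r m := by
    rw [smul_smul, Algebra.commutes, mul_smul, RingHom.id_apply]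

/-- The endomorphism preserves the radical and so acts on the simple top, where Schur's lemma makes
it a scalar. -/
theorem HasTop.exists_scalar {k : Type u} [Field k] [IsAlgClosed k] [Algebra k R]
    [FiniteDimensional k R] {τ : M →ₗ[R] L.rep} (hτ : IsEssEpi τ) (f : M →ₗ[R] M) :
    ∃ c : k, τ ∘ₗ f = τ ∘ₗ scalarEnd k M c := by
  have hk : LinearMap.ker τ ≤ LinearMap.ker (τ ∘ₗ f) := HasTop.ker_le_of_isSemisimple hτ _
  let e := τ.quotKerEquivOfSurjective hτ.surjective
  have he (x : M) : e (Submodule.Quotient.mk x) = τ x := rfl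
  obtain ⟨c, hc⟩ := exists_algebraMap_smul (k := k)
    ((LinearMap.ker τ).liftQ (τ ∘ₗ f) hk ∘ₗ e.symm.toLinearMap)
  refine ⟨c, LinearMap.ext fun x => ?_⟩
  have := hc (e (Submodule.Quotient.mk x))
  rw [LinearMap.comp_apply, LinearEquiv.coe_coe, LinearEquiv.symm_apply_apply, he] at this
  exact this.trans (map_smul τ _ _).symm

theorem scalarEnd_injective (k : Type u) [Field k] [Algebra k R] [Nontrivial M] {c c' : k}
    (h : ∀ m : M, algebraMap k R c • m = algebraMap k R c' • m) : c = c' := by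
  by_contra hne
  obtain ⟨m, hm⟩ := exists_ne (0 : M)
  have h0 : algebraMap k R (c - c') • m = 0 := by rw [map_sub, sub_smul, h, sub_self]
  have h1 : algebraMap k R (c - c')⁻¹ • algebraMap k R (c - c') • m = 0 := by rw [h0, smul_zero]
  rw [smul_smul, ← map_mul, inv_mul_cancel₀ (sub_ne_zero.2 hne), map_one, one_smul] at h1
  exact hm h1

end Top

/-! ### Transfer of quasi-heredity along a Frobenius pair -/

namespace FrobPair

variable {k R T : Type u} [Field k] [Ring R] [Ring T] [Algebra k R] [Algebra k T]
  [IsArtinianRing R] [IsArtinianRing T] {P : FrobPair R T} {leT : PartialOrder (Sim T)}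
  {leR : PartialOrder (Sim R)}

-- For M with top S and socle S', find inside U M a submodule N with top L linked to S and a simple
-- submodule L' linked to S' that is not all of N. Adaptedness for R is not enough here, since L and
-- L' may be equal even though S and S' are incomparable; `IsQuasiHereditary.trichotomy` covers that
-- case too.
omit [Algebra k T] in
theorem OrderCompat.isAdapted (hord : P.OrderCompat leT leR) (hR : IsQuasiHereditary k leR) :
    IsAdapted leT := by
  rintro M hM S S' ⟨e⟩ ⟨e'⟩ h₁ h₂
  have hfin : Module.Finite R (P.U.obj M) := P.finU M hM
  -- If U M were semisimple, so would be V U M and its retract M, whence S = S'.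
  have hsoc : socle (R := R) (P.U.obj M) ≠ ⊤ := fun h => by
    have := P.ssV _ (isSemisimpleModule_of_socle_eq_top h)
    have : IsSemisimpleModule T ((P.U ⋙ P.V).obj M) := this
    have : IsSemisimpleModule T M := IsSemisimpleModule.of_injective (P.ηT.app M).hom
      (injective_of_retract (congrArg ModuleCat.Hom.hom (P.retT M)))
    exact h₁ (eq_of_moduleTop_of_socle e e' ▸ leT.le_refl S)
  -- The module N is the image of the cover of L lifted along q. Since q kills the socle but not N,
  -- the module N is not semisimple.
  obtain ⟨L, q, hq, hqs⟩ := exists_isQuot_notMem hsoc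
  obtain ⟨φ, hφ⟩ := exists_surjective_lift hq
  have hL : P.Rel S L := by
    have : IsSemisimpleModule T (P.swap.U.obj L.rep) := P.isSemisimple_V L
    obtain ⟨f, hf⟩ := P.swap.exists_hom_iff.1 ⟨q, hq⟩
    exact P.rel_swap.1 ((hasTop_of_moduleTop e).exists_of_isSemisimple hf)
  have hLn : Nontrivial L.rep := IsSimpleModule.nontrivial R _
  have hφ0 : L.coverMap ≠ 0 := fun h => by
    obtain ⟨x, hx⟩ := exists_ne (0 : L.rep)
    obtain ⟨y, rfl⟩ := L.isProjectiveCover.surjective x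
    exact hx (LinearMap.congr_fun h y)
  have : Nontrivial (LinearMap.range φ) := by
    rw [Submodule.nontrivial_iff_ne_bot, Ne, LinearMap.range_eq_bot]
    exact fun h => hφ0 (by rw [← hφ, h, LinearMap.comp_zero])
  have hN : HasTop (LinearMap.range φ) L := L.hasTop_cover.of_surjective φ.surjective_rangeRestrict
  obtain ⟨L', i, hi⟩ := exists_isSub (R := R) (M := LinearMap.range φ)
  have hA : LinearMap.range i ≠ ⊤ := fun h => by
    have : IsSemisimpleModule R (LinearMap.range φ) := IsSemisimpleModule.congr
      (LinearEquiv.ofBijective i ⟨hi, LinearMap.range_eq_top.1 h⟩).symm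
    have := (le_socle_of_isSemisimple (A := LinearMap.range φ)).trans hqs
    refine hφ0 (hφ.symm.trans (LinearMap.ext fun x => this ⟨x, rfl⟩))
  have hL'n : Nontrivial L'.rep := IsSimpleModule.nontrivial R _
  have hL' : P.Rel S' L' := by
    have := P.isSemisimple_V L'
    obtain ⟨f, hf⟩ := P.exists_hom_iff.2 ⟨(LinearMap.range φ).subtype ∘ₗ i, fun h => by
      obtain ⟨x, hx⟩ := exists_ne (0 : L'.rep)
      exact hx (hi ((Submodule.injective_subtype _ (LinearMap.congr_fun h x)).trans
        (map_zero i).symm))⟩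
    have : IsSemisimpleModule T (LinearMap.range f) := IsSemisimpleModule.range f
    have hle : LinearMap.range f ≤ socle (R := T) M := le_socle_of_isSemisimple
    refine P.rel_iff_isQuot_V.2 ⟨e'.toLinearMap ∘ₗ
      f.codRestrict _ fun x => hle ⟨x, rfl⟩, fun h => hf (LinearMap.ext fun x => ?_)⟩
    have := LinearMap.congr_fun h x
    rw [LinearMap.comp_apply, LinearMap.zero_apply, LinearEquiv.coe_coe,
      LinearEquiv.map_eq_zero_iff] at this
    exact congrArg Subtype.val this
  have hi0 : (LinearEquiv.ofInjective i hi).symm.toLinearMap ≠ 0 := fun h => by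
    obtain ⟨x, hx⟩ := exists_ne (0 : L'.rep)
    have := LinearMap.congr_fun h (LinearEquiv.ofInjective i hi x)
    rw [LinearEquiv.coe_coe, LinearEquiv.symm_apply_apply] at this
    exact hx this
  rcases hR.trichotomy hN hA hi0 with h | h | ⟨L'', hc, h, h'⟩
  · exact absurd ((hord S L S' L' hL hL').2 h).le h₁
  · exact absurd ((hord S' L' S L hL' hL).2 h).le h₂
  · obtain ⟨S'', hS'', hc⟩ := P.exists_cf_of_cf_U (cf_of_injective (Submodule.injective_subtype _) hc)
    exact ⟨S'', hc, (hord _ _ _ _ hL hS'').2 h, (hord _ _ _ _ hL' hS'').2 h'⟩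

/-- All simple quotients of V D are linked to L, so for each of them the required conditions on V D
are those of D, moved through V. -/
theorem OrderCompat.decomposition_V (hord : P.OrderCompat leT leR) (hT : IsAdapted leT)
    (hR : IsAdapted leR) {L : Sim R} {D : ModuleCat.{u} R} (hD : IsStandard leR L D) :
    HasStandardFiltration leT (P.V.obj D) ∧ ∀ x : P.V.obj D, x ≠ 0 →
      ∃ (S : Sim T) (E : ModuleCat.{u} T) (q : P.V.obj D →ₗ[T] E),
        IsQuot (P.V.obj D) S ∧ IsStandard leT S E ∧ q x ≠ 0 := by
  obtain ⟨h₁, h₂, h₃⟩ := hR.isStandard_iff.1 hD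
  have hf := h₁.finite
  refine standard_decomposition hT (P.V.obj D) (P.finV _ hf) fun S hS => ?_
  have hrel : P.Rel S L := P.rel_of_hasTop h₁ hS
  exact ⟨Match.noFactor_U (P := P.swap) (hord.match hrel).swap h₂,
    (hord.match hrel).isRelProjective_V h₃⟩

theorem OrderCompat.hasStandardFiltration_V (hord : P.OrderCompat leT leR) (hT : IsAdapted leT)
    (hR : IsAdapted leR) {M : ModuleCat.{u} R} (hM : HasStandardFiltration leR M) :
    HasStandardFiltration leT (P.V.obj M) := by
  obtain ⟨m, F, hmono, h0, h1, hF⟩ := hM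
  have key : ∀ j ≤ m, HasStandardFiltration leT (P.V.obj (ModuleCat.of R (F j))) := by
    intro j
    induction j with
    | zero =>
      intro _
      have : Limits.IsZero (ModuleCat.of R (F 0)) := by
        rw [h0]
        exact ModuleCat.isZero_of_subsingleton _
      have := ModuleCat.subsingleton_of_isZero (P.V.map_isZero this)
      exact hasStandardFiltration_of_subsingleton _
    | succ j ih =>
      intro hj
      obtain ⟨L, hL⟩ := hF j hj
      have hle : F j ≤ F (j + 1) := hmono (Nat.le_succ j)
      let D := ModuleCat.of R (F (j + 1) ⧸ (F j).submoduleOf (F (j + 1)))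
      let X : ShortComplex (ModuleCat.{u} R) := ShortComplex.mk
        (ModuleCat.ofHom (Submodule.inclusion hle) : ModuleCat.of R (F j) ⟶ ModuleCat.of R (F (j + 1)))
        (ModuleCat.ofHom ((F j).submoduleOf (F (j + 1))).mkQ : _ ⟶ D) (by
          ext x
          exact (Submodule.Quotient.mk_eq_zero _).2 x.2)
      have hX : X.ShortExact := {
        exact := (ShortComplex.ShortExact.moduleCat_exact_iff_function_exact X).2 fun x =>
          ⟨fun h => ⟨⟨x.1, (Submodule.Quotient.mk_eq_zero ((F j).submoduleOf (F (j + 1)))).1 h⟩, rfl⟩, by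
            rintro ⟨y, rfl⟩
            exact (Submodule.Quotient.mk_eq_zero ((F j).submoduleOf (F (j + 1)))).2 y.2⟩
        mono_f := (ModuleCat.mono_iff_injective _).2 (Submodule.inclusion_injective hle)
        epi_g := (ModuleCat.epi_iff_surjective _).2 (Submodule.mkQ_surjective _) }
      have hV := hX.map_of_exact P.V
      refine HasStandardFiltration.of_exact (i := (P.V.map X.f).hom) (p := (P.V.map X.g).hom)
        hV.moduleCat_injective_f hV.moduleCat_surjective_g ?_ (ih (by omega))
        (hord.decomposition_V hT hR (D := D) hL).1
      exact (LinearMap.exact_iff.1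
        ((ShortComplex.ShortExact.moduleCat_exact_iff_function_exact _).1 hV.exact)).symm
  have := key m le_rfl
  rw [h1] at this
  exact this.of_equiv (P.V.mapIso (LinearEquiv.toModuleIso (Submodule.topEquiv (R := R) (M := M)))).toLinearEquiv

/-- After subtracting a scalar, an endomorphism maps D into its radical, and it must be shown to
vanish. Applying U and projecting to a standard summand of U D turns a nonzero one into a factor
linked to S in the radical of a standard R-module. That factor is either a second copy of the top or
yields S < S. -/
theorem OrderCompat.isExceptional [IsAlgClosed k] [FiniteDimensional k T]
    (hord : P.OrderCompat leT leR) (hT : IsAdapted leT)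
    (hR : IsQuasiHereditary k leR) {S : Sim T} {D : ModuleCat.{u} T} (hD : IsStandard leT S D) :
    IsExceptional k D := by
  refine ⟨hD.subsingleton_ext, fun φ => ?_⟩
  obtain ⟨⟨σ, hσ⟩, h₂, h₃⟩ := hT.isStandard_iff.1 hD
  have htop : HasTop D S := ⟨σ, hσ⟩
  obtain ⟨c, hc⟩ := HasTop.exists_scalar (k := k) hσ φ
  have := htop.nontrivial
  have key : ∀ ψ : D →ₗ[T] D, σ ∘ₗ ψ = 0 → ψ = 0 := by
    intro ψ hψ
    by_contra hne
    obtain ⟨δ, hδ⟩ := exists_surjective_lift (q := σ) (fun h => by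
      obtain ⟨x, hx⟩ := @exists_ne S.rep (IsSimpleModule.nontrivial T _) 0
      obtain ⟨y, rfl⟩ := hσ.surjective x
      exact hx (LinearMap.congr_fun h y))
    have hδs : Function.Surjective δ :=
      hσ.surjective_of_comp (hδ ▸ S.isProjectiveCover.surjective)
    let f : S.cover ⟶ D := ModuleCat.ofHom (ψ ∘ₗ δ)
    have hf0 : P.U.map f ≠ 0 := fun h => hne <| LinearMap.ext fun x => by
      obtain ⟨y, rfl⟩ := hδs x
      exact LinearMap.congr_fun (congrArg ModuleCat.Hom.hom (P.U_faithful h)) y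
    obtain ⟨y, hy⟩ : ∃ y, P.U.map f y ≠ 0 := by
      by_contra! h
      exact hf0 (ModuleCat.hom_ext (LinearMap.ext h))
    obtain ⟨L', E, q, hq, hE, hqy⟩ :=
      (hord.swap.decomposition_V hR.adapted hT hD).2 _ hy
    have hqr : ∀ L, IsQuot (P.U.obj D) L → P.Rel S L := fun L h =>
      P.rel_swap.1 (P.swap.rel_of_hasTop htop h)
    obtain ⟨⟨τ, hτ⟩, hE₂, hE₃⟩ := hR.adapted.isStandard_iff.1 hE
    let X := LinearMap.range (q ∘ₗ (P.U.map f).hom)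
    -- Composites to the simple top L' transpose along U ⊣ V to maps from D into the semisimple
    -- module V L'. These kill the radical of D, and ψ takes values there.
    have hX : X ≤ LinearMap.ker τ := by
      have hss := P.isSemisimple_V L'
      let g : P.U.obj D ⟶ L'.rep := ModuleCat.ofHom (τ ∘ₗ q)
      have h0 : ModuleCat.ofHom ψ ≫ P.adj'.homEquiv D L'.rep g = 0 := by
        ext x
        exact HasTop.ker_le_of_isSemisimple hσ (P.adj'.homEquiv D L'.rep g).hom
          (LinearMap.congr_fun hψ x)
      have h1 : P.U.map (ModuleCat.ofHom ψ) ≫ g = 0 := by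
        apply (P.adj'.homEquiv D L'.rep).injective
        rw [Adjunction.homEquiv_naturality_left, h0]
        exact (map_zero (P.adj'.homAddEquiv D L'.rep)).symm
      rintro _ ⟨z, rfl⟩
      have h2 : P.U.map f ≫ g = 0 := by
        have : f = ModuleCat.ofHom δ ≫ ModuleCat.ofHom ψ := rfl
        rw [this, P.U.map_comp, Category.assoc, h1, Limits.comp_zero]
      exact LinearMap.congr_fun (congrArg ModuleCat.Hom.hom h2) z
    have : Nontrivial X := ⟨⟨⟨_, y, rfl⟩, 0, fun h => hqy (congrArg Subtype.val h)⟩⟩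
    have : Module.Finite R (P.U.obj S.cover) := P.finU _ inferInstance
    have : Module.Finite R X := Module.Finite.range _
    obtain ⟨L'', hL''⟩ := exists_isQuot (R := R) (M := X)
    have hrel : P.Rel S L'' := P.rel_swap.1 (P.swap.rel_of_hasTop S.hasTop_cover
      (isQuot_of_surjective hL'' (q ∘ₗ (P.U.map f).hom).surjective_rangeRestrict))
    have hle : leR.le L'' L' := hR.adapted.le_of_cf ⟨τ, hτ⟩ hE₂
      (cf_of_injective (Submodule.injective_subtype _) (cf_of_isQuot hL''))
    -- The simple quotient L'' of X is linked to S, because X is an image of U of the cover of S.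
    -- L'' = L' would make X everything; L'' < L' transfers to S < S.
    by_cases heq : L'' = L'
    · subst heq
      obtain ⟨q', hq'⟩ := hL''
      have hXtop := hR.eq_top_of_ne_zero ⟨τ, hτ⟩ hE₂ hq'
      obtain ⟨x, hx⟩ := @exists_ne L''.rep (IsSimpleModule.nontrivial R _) 0
      obtain ⟨z, rfl⟩ := hτ.surjective x
      exact hx (hX (hXtop ▸ Submodule.mem_top))
    · have := (hord S L'' S L' hrel (hqr _ hq)).2 (lt_of_le_of_ne hle heq)
      exact lt_irrefl _ this
  refine ⟨c, fun m => ?_, fun c' hc' => ?_⟩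
  · have := key (φ - scalarEnd k D c) (by rw [LinearMap.comp_sub, hc, sub_self])
    exact LinearMap.congr_fun (sub_eq_zero.1 this) m
  · refine scalarEnd_injective (R := T) (M := D) k fun m => ?_
    rw [← hc' m]
    have := key (φ - scalarEnd k D c) (by rw [LinearMap.comp_sub, hc, sub_self])
    exact LinearMap.congr_fun (sub_eq_zero.1 this) m

theorem OrderCompat.isQuasiHereditary [IsAlgClosed k] [FiniteDimensional k T]
    (hord : P.OrderCompat leT leR) (e : P.V.obj (ModuleCat.of R R) ≃ₗ[T] T)
    (hR : IsQuasiHereditary k leR) : IsQuasiHereditary k leT :=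
  have hT := hord.isAdapted hR
  ⟨hT, (hord.hasStandardFiltration_V hT hR.adapted (M := ModuleCat.of R R) hR.filtration).of_equiv e,
    fun _ _ hD => hord.isExceptional hT hR hD⟩

end FrobPair

/-! ### Maps on extension groups induced by exact functors -/

section ExtMap

universe v v₁ v₂ v₃ w w₁ w₂ w₃

open Abelian Limits

variable {C : Type v₁} [Category.{v} C] [Abelian C] [HasExt.{w₁} C]
  {D : Type v₂} [Category.{v} D] [Abelian D] [HasExt.{w₂} D]
  {E : Type v₃} [Category.{v} E] [Abelian E] [HasExt.{w₃} E]

/-- Dimension shifting: with a projective middle term, every class in degree n + 1 is the class of a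
short exact sequence times one of degree n. So identities for exact functors need only be checked on
morphisms and on such classes. -/
theorem ext_induction [EnoughProjectives C] {Y : C}
    {motive : ∀ (n : ℕ) (X : C), Ext.{w₁} X Y n → Prop}
    (zero : ∀ (X : C) (f : X ⟶ Y), motive 0 X (Ext.mk₀ f))
    (succ : ∀ (n : ℕ) (S : ShortComplex C) (hS : S.ShortExact) (y : Ext S.X₁ Y n),
      motive n S.X₁ y → motive (n + 1) S.X₃ (hS.extClass.comp y (Nat.add_comm 1 n)))
    {n : ℕ} {X : C} (x : Ext X Y n) : motive n X x := by
  induction n generalizing X with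
  | zero =>
    obtain ⟨f, rfl⟩ := (Ext.mk₀_bijective _ _).2 x
    exact zero X f
  | succ n ih =>
    let S := ShortComplex.mk (kernel.ι (Projective.π X)) (Projective.π X) (kernel.condition _)
    have hS : S.ShortExact :=
      { exact := ShortComplex.exact_of_f_is_kernel S (kernelIsKernel _)
        mono_f := inferInstanceAs (Mono (kernel.ι _))
        epi_g := inferInstanceAs (Epi (Projective.π X)) }
    have : Projective S.X₂ := inferInstanceAs (Projective (Projective.over X))
    obtain ⟨y, rfl⟩ := Ext.contravariant_sequence_exact₃ hS Y x
      (Ext.eq_zero_of_projective _) (Nat.add_comm 1 n)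
    exact succ n S hS y (ih y)

theorem ext_comp_comp_of_eq {X X' K K' Y : C} {e : Ext.{w₁} X K 1} {e' : Ext.{w₁} X' K' 1}
    {f : K ⟶ K'} {g : X ⟶ X'}
    (h : e.comp (Ext.mk₀ f) (add_zero 1) = (Ext.mk₀ g).comp e' (zero_add 1)) {n m : ℕ}
    (y : Ext.{w₁} K' Y n) (hm : 1 + n = m) :
    e.comp ((Ext.mk₀ f).comp y (zero_add n)) hm = (Ext.mk₀ g).comp (e'.comp y hm) (zero_add m) := by
  rw [← Ext.comp_assoc_of_second_deg_zero, h, Ext.comp_assoc _ _ _ (zero_add 1) hm (by omega)]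

variable [EnoughProjectives C]

theorem mapExactFunctor_naturality {Φ Ψ : C ⥤ D} [Φ.Additive] [PreservesFiniteLimits Φ]
    [PreservesFiniteColimits Φ] [Ψ.Additive] [PreservesFiniteLimits Ψ] [PreservesFiniteColimits Ψ]
    (τ : Φ ⟶ Ψ) {X Y : C} {n : ℕ} (x : Ext.{w₁} X Y n) :
    (x.mapExactFunctor Φ).comp (Ext.mk₀ (τ.app Y)) (add_zero n) =
      (Ext.mk₀ (τ.app X)).comp (x.mapExactFunctor Ψ) (zero_add n) := by
  induction x using ext_induction with
  | zero X f =>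
    rw [Ext.mapExactFunctor_mk₀, Ext.mapExactFunctor_mk₀, Ext.mk₀_comp_mk₀, Ext.mk₀_comp_mk₀,
      τ.naturality]
  | succ n S hS y ih =>
    have h := ShortComplex.ShortExact.extClass_naturality (hS.map_of_exact Φ) (hS.map_of_exact Ψ)
      (S.mapNatTrans τ)
    rw [Ext.mapExactFunctor_comp, Ext.mapExactFunctor_comp, Ext.comp_assoc_of_third_deg_zero, ih,
      Ext.mapExactFunctor_extClass, Ext.mapExactFunctor_extClass]
    exact ext_comp_comp_of_eq h _ _

theorem mapExactFunctor_functor_comp (Φ : C ⥤ D) (Ψ : D ⥤ E) [Φ.Additive]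
    [PreservesFiniteLimits Φ] [PreservesFiniteColimits Φ] [Ψ.Additive] [PreservesFiniteLimits Ψ]
    [PreservesFiniteColimits Ψ] {X Y : C} {n : ℕ} (x : Ext.{w₁} X Y n) :
    x.mapExactFunctor (Φ ⋙ Ψ) = (Ext.mapExactFunctor.{w₂, w₃} Ψ (x.mapExactFunctor Φ)) := by
  induction x using ext_induction with
  | zero X f =>
    rw [Ext.mapExactFunctor_mk₀, Ext.mapExactFunctor_mk₀, Ext.mapExactFunctor_mk₀]
    rfl
  | succ n S hS y ih =>
    rw [Ext.mapExactFunctor_comp, Ext.mapExactFunctor_comp, Ext.mapExactFunctor_comp, ih,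
      Ext.mapExactFunctor_extClass, Ext.mapExactFunctor_extClass]
    exact congrArg (fun z => Ext.comp z _ _)
      (Ext.mapExactFunctor_extClass Ψ (hS.map_of_exact Φ)).symm

theorem mapExactFunctor_id {X Y : C} {n : ℕ} (x : Ext.{w₁} X Y n) :
    x.mapExactFunctor (𝟭 C) = x := by
  induction x using ext_induction with
  | zero X f =>
    rw [Ext.mapExactFunctor_mk₀]
    rfl
  | succ n S hS y ih =>
    rw [Ext.mapExactFunctor_comp, ih, Ext.mapExactFunctor_extClass]
    rfl

/-- If the identity functor is a natural retract of `Φ ⋙ Ψ`, then an extension can be recovered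
from its image. -/
theorem eq_of_mapExactFunctor_retract (Φ : C ⥤ D) (Ψ : D ⥤ C) [Φ.Additive]
    [PreservesFiniteLimits Φ] [PreservesFiniteColimits Φ] [Ψ.Additive] [PreservesFiniteLimits Ψ]
    [PreservesFiniteColimits Ψ] {η : 𝟭 C ⟶ Φ ⋙ Ψ} {p : Φ ⋙ Ψ ⟶ 𝟭 C}
    (hηp : ∀ X, η.app X ≫ p.app X = 𝟙 X) {X Y : C} {n : ℕ} (x : Ext.{w₁} X Y n) :
    x = (Ext.mk₀ (η.app X)).comp ((Ext.mapExactFunctor.{w₂, w₁} Ψ (x.mapExactFunctor Φ)).comp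
      (Ext.mk₀ (p.app Y)) (add_zero n)) (zero_add n) := by
  have h := mapExactFunctor_naturality p x
  rw [mapExactFunctor_functor_comp, mapExactFunctor_id] at h
  refine Eq.trans ?_ (congrArg (fun z => (Ext.mk₀ (η.app X)).comp z (zero_add n)) h.symm)
  have h2 : (Ext.mk₀ (η.app X)).comp ((Ext.mk₀ (p.app X)).comp x (zero_add n)) (zero_add n) = x := by
    rw [Ext.mk₀_comp_mk₀_assoc, hηp]
    exact Ext.mk₀_id_comp x
  exact h2.symm

omit [EnoughProjectives C]

/-- The square formed by two extensions and two morphisms commutes. -/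
def ExtComm {X Y X' Y' : C} {n : ℕ} (x : Ext.{w₁} X Y n) (x' : Ext.{w₁} X' Y' n) (f : X ⟶ X')
    (g : Y ⟶ Y') : Prop :=
  x.comp (Ext.mk₀ g) (add_zero n) = (Ext.mk₀ f).comp x' (zero_add n)

theorem ExtComm.trans {X Y X' Y' X'' Y'' : C} {n : ℕ} {x : Ext.{w₁} X Y n} {x' : Ext.{w₁} X' Y' n}
    {x'' : Ext.{w₁} X'' Y'' n} {f : X ⟶ X'} {g : Y ⟶ Y'} {f' : X' ⟶ X''} {g' : Y' ⟶ Y''}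
    (h : ExtComm x x' f g) (h' : ExtComm x' x'' f' g') : ExtComm x x'' (f ≫ f') (g ≫ g') := by
  rw [ExtComm, ← Ext.mk₀_comp_mk₀, ← Ext.mk₀_comp_mk₀, ← Ext.comp_assoc_of_third_deg_zero, h,
    Ext.comp_assoc_of_third_deg_zero, h', Ext.comp_assoc_of_second_deg_zero]

theorem ExtComm.map (Φ : C ⥤ D) [Φ.Additive] [PreservesFiniteLimits Φ] [PreservesFiniteColimits Φ]
    {X Y X' Y' : C} {n : ℕ} {x : Ext.{w₁} X Y n} {x' : Ext.{w₁} X' Y' n}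
    {f : X ⟶ X'} {g : Y ⟶ Y'} (h : ExtComm x x' f g) :
    ExtComm (Ext.mapExactFunctor.{w₁, w₂} Φ x) (Ext.mapExactFunctor.{w₁, w₂} Φ x') (Φ.map f)
      (Φ.map g) := by
  rw [ExtComm, ← Ext.mapExactFunctor_mk₀, ← Ext.mapExactFunctor_mk₀, ← Ext.mapExactFunctor_comp, h,
    Ext.mapExactFunctor_comp]

theorem ExtComm.eq {X Y X' Y' : C} {n : ℕ} {x : Ext.{w₁} X Y n} {x' : Ext.{w₁} X' Y' n}
    {f : X ⟶ X'} {g : Y ⟶ Y'} (h : ExtComm x x' f g) {i : X' ⟶ X} (hi : i ≫ f = 𝟙 X') :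
    (Ext.mk₀ i).comp (x.comp (Ext.mk₀ g) (add_zero n)) (zero_add n) = x' := by
  rw [h, Ext.mk₀_comp_mk₀_assoc, hi, Ext.mk₀_id_comp]

theorem extComm_of_iso {X Y X' Y' : C} {n : ℕ} (x' : Ext.{w₁} X' Y' n) (f : X ⟶ X') (g : Y ≅ Y') :
    ExtComm ((Ext.mk₀ f).comp (x'.comp (Ext.mk₀ g.inv) (add_zero n)) (zero_add n)) x' f g.hom := by
  rw [ExtComm, Ext.comp_assoc_of_third_deg_zero, Ext.comp_assoc_of_third_deg_zero,
    Ext.mk₀_comp_mk₀, Iso.inv_hom_id, Ext.comp_mk₀_id]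

end ExtMap

/-! ### Finitely generated semisimple modules -/

section SemisimpleInduction

variable {R : Type u} [Ring R]

/-- Split off one simple summand at a time. The splitting is handed over as morphisms with biproduct
identities because additive functors preserve these. -/
theorem semisimple_induction [IsArtinianRing R] {P : ModuleCat.{u} R → Prop}
    (zero : ∀ W : ModuleCat.{u} R, Limits.IsZero W → P W)
    (add : ∀ (W W' : ModuleCat.{u} R) (Y : Sim R) (i₁ : Y.rep ⟶ W) (p₁ : W ⟶ Y.rep) (i₂ : W' ⟶ W)
      (p₂ : W ⟶ W'), i₁ ≫ p₁ = 𝟙 _ → i₂ ≫ p₂ = 𝟙 _ → i₁ ≫ p₂ = 0 → i₂ ≫ p₁ = 0 →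
      p₁ ≫ i₁ + p₂ ≫ i₂ = 𝟙 W → P W' → P W)
    (W : ModuleCat.{u} R) (hW : Module.Finite R W) (hs : IsSemisimpleModule R W) : P W := by
  refine finite_induction (P := fun W : ModuleCat.{u} R => IsSemisimpleModule R W → P W)
    (fun W hW ih hs => ?_) W hW hs
  rcases subsingleton_or_nontrivial W with h | h
  · exact zero W (ModuleCat.isZero_of_subsingleton W)
  obtain ⟨Y, i, hi⟩ := exists_isSub (R := R) (M := W)
  obtain ⟨N, hN⟩ := exists_isCompl (LinearMap.range i)
  have hY : Nontrivial Y.rep := IsSimpleModule.nontrivial R _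
  have hNt : N ≠ ⊤ := by
    rintro rfl
    obtain ⟨x, hx⟩ := exists_ne (0 : Y.rep)
    have h0 : i x = 0 := (Submodule.disjoint_def.1 hN.disjoint) _ ⟨x, rfl⟩ trivial
    exact hx (hi (h0.trans (map_zero i).symm))
  have hNs : IsSemisimpleModule R N := inferInstance
  let e := LinearEquiv.ofInjective i hi
  have hπ₁ (x : Y.rep) : (LinearMap.range i).projectionOnto N hN (i x) = ⟨i x, x, rfl⟩ :=
    Submodule.projectionOnto_apply_left hN ⟨i x, x, rfl⟩
  refine add W (ModuleCat.of R N) Y (ModuleCat.ofHom i)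
    (ModuleCat.ofHom (e.symm.toLinearMap ∘ₗ (LinearMap.range i).projectionOnto N hN))
    (ModuleCat.ofHom N.subtype) (ModuleCat.ofHom (N.projectionOnto _ hN.symm)) ?_ ?_ ?_ ?_ ?_
    (ih N hNt hNs)
  · ext x
    change e.symm ((LinearMap.range i).projectionOnto N hN (i x)) = x
    rw [hπ₁]
    exact e.symm_apply_apply x
  · ext x
    exact congrArg Subtype.val (Submodule.projectionOnto_apply_left hN.symm x)
  · ext x
    exact congrArg Subtype.val (Submodule.projectionOnto_apply_right hN.symm ⟨i x, x, rfl⟩)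
  · ext x
    change e.symm ((LinearMap.range i).projectionOnto N hN x) = 0
    rw [Submodule.projectionOnto_apply_right hN x, map_zero]
  · ext x
    change i (e.symm ((LinearMap.range i).projectionOnto N hN x)) +
      (N.projectionOnto _ hN.symm x : W) = x
    have : i (e.symm ((LinearMap.range i).projectionOnto N hN x)) =
        ((LinearMap.range i).projectionOnto N hN x : W) :=
      congrArg Subtype.val (e.apply_symm_apply ((LinearMap.range i).projectionOnto N hN x))
    rw [this, Submodule.coe_projectionOnto_apply, Submodule.coe_projectionOnto_apply]
    exact Submodule.projection_add_projection_eq_self hN x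

theorem semisimple_induction_of_simple [IsArtinianRing R] {P : ModuleCat.{u} R → Prop}
    (zero : ∀ W : ModuleCat.{u} R, Limits.IsZero W → P W)
    (add : ∀ (W W' : ModuleCat.{u} R) (Y : Sim R) (i₁ : Y.rep ⟶ W) (p₁ : W ⟶ Y.rep) (i₂ : W' ⟶ W)
      (p₂ : W ⟶ W'), p₁ ≫ i₁ + p₂ ≫ i₂ = 𝟙 W → P Y.rep → P W' → P W)
    {W : ModuleCat.{u} R} (hW : Module.Finite R W) (hs : IsSemisimpleModule R W)
    (h : ∀ Y : Sim R, IsQuot W Y → P Y.rep) : P W := by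
  refine semisimple_induction (P := fun W => (∀ Y : Sim R, IsQuot W Y → P Y.rep) → P W)
    (fun W hW _ => zero W hW) (fun W W' Y i₁ p₁ i₂ p₂ h₁ h₂ _ _ hid ih hq => ?_) W hW hs h
  refine add W W' Y i₁ p₁ i₂ p₂ hid (hq Y ⟨p₁.hom, fun h0 => ?_⟩) (ih fun Y' hY' => hq Y'
    (isQuot_of_surjective hY' (surjective_of_retract (congrArg ModuleCat.Hom.hom h₂))))
  obtain ⟨x, hx⟩ := @exists_ne Y.rep (IsSimpleModule.nontrivial R _) 0
  exact hx ((LinearMap.congr_fun (congrArg ModuleCat.Hom.hom h₁) x).symm.trans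
    (LinearMap.congr_fun h0 (i₁ x)))

open Abelian

variable {S : Type u} [Ring S] (F : ModuleCat.{u} R ⥤ ModuleCat.{u} S)
  [F.Additive] [Limits.PreservesFiniteLimits F] [Limits.PreservesFiniteColimits F]

theorem ext_eq_add_left {X X₁ X₂ Y : ModuleCat.{u} R} {n : ℕ} {i₁ : X₁ ⟶ X} {p₁ : X ⟶ X₁}
    {i₂ : X₂ ⟶ X} {p₂ : X ⟶ X₂} (h : p₁ ≫ i₁ + p₂ ≫ i₂ = 𝟙 X) (x : Ext.{u} X Y n) :
    x = (Ext.mk₀ p₁).comp ((Ext.mk₀ i₁).comp x (zero_add n)) (zero_add n) +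
      (Ext.mk₀ p₂).comp ((Ext.mk₀ i₂).comp x (zero_add n)) (zero_add n) := by
  rw [Ext.mk₀_comp_mk₀_assoc, Ext.mk₀_comp_mk₀_assoc, ← Ext.add_comp, ← Ext.mk₀_add, h,
    Ext.mk₀_id_comp]

theorem ext_eq_add_right {X Y Y₁ Y₂ : ModuleCat.{u} R} {n : ℕ} {i₁ : Y₁ ⟶ Y} {p₁ : Y ⟶ Y₁}
    {i₂ : Y₂ ⟶ Y} {p₂ : Y ⟶ Y₂} (h : p₁ ≫ i₁ + p₂ ≫ i₂ = 𝟙 Y) (x : Ext.{u} X Y n) :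
    x = (x.comp (Ext.mk₀ p₁) (add_zero n)).comp (Ext.mk₀ i₁) (add_zero n) +
      (x.comp (Ext.mk₀ p₂) (add_zero n)).comp (Ext.mk₀ i₂) (add_zero n) := by
  rw [Ext.comp_assoc_of_third_deg_zero, Ext.comp_assoc_of_third_deg_zero, Ext.mk₀_comp_mk₀,
    Ext.mk₀_comp_mk₀, ← Ext.comp_add, ← Ext.mk₀_add, h, Ext.comp_mk₀_id]

theorem subsingleton_ext_of_isZero_left {X Y : ModuleCat.{u} R} (h : Limits.IsZero X) (n : ℕ) :
    Subsingleton (Ext.{u} X Y n) :=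
  subsingleton_of_forall_eq 0 fun x => by
    rw [← Ext.mk₀_id_comp x, h.eq_of_src (𝟙 X) 0, Ext.mk₀_zero, Ext.zero_comp]

theorem subsingleton_ext_of_isZero_right {X Y : ModuleCat.{u} R} (h : Limits.IsZero Y) (n : ℕ) :
    Subsingleton (Ext.{u} X Y n) :=
  subsingleton_of_forall_eq 0 fun x => by
    rw [← Ext.comp_mk₀_id x, h.eq_of_src (𝟙 Y) 0, Ext.mk₀_zero, Ext.comp_zero]

variable [IsArtinianRing R]

theorem subsingleton_ext_of_simple {n : ℕ} {X Y : ModuleCat.{u} R} (hX : Module.Finite R X)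
    (hXs : IsSemisimpleModule R X) (hY : Module.Finite R Y) (hYs : IsSemisimpleModule R Y)
    (h : ∀ (L L' : Sim R), IsQuot X L → IsQuot Y L' → Subsingleton (Ext.{u} L.rep L'.rep n)) :
    Subsingleton (Ext.{u} X Y n) := by
  refine semisimple_induction_of_simple (P := fun X => Subsingleton (Ext.{u} X Y n))
    (fun X hX => subsingleton_ext_of_isZero_left hX n)
    (fun X X' L i₁ p₁ i₂ p₂ hid h₁ h₂ => ?_) hX hXs (fun L hL => ?_)
  · refine subsingleton_of_forall_eq 0 fun x => ?_
    rw [ext_eq_add_left hid x, Subsingleton.elim ((Ext.mk₀ i₁).comp x (zero_add n)) 0,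
      Subsingleton.elim ((Ext.mk₀ i₂).comp x (zero_add n)) 0, Ext.comp_zero, Ext.comp_zero, add_zero]
  · refine semisimple_induction_of_simple (P := fun Y => Subsingleton (Ext.{u} L.rep Y n))
      (fun Y hY => subsingleton_ext_of_isZero_right hY n)
      (fun Y Y' L' i₁ p₁ i₂ p₂ hid h₁ h₂ => ?_) hY hYs (fun L' hL' => h L L' hL hL')
    refine subsingleton_of_forall_eq 0 fun x => ?_
    rw [ext_eq_add_right hid x, Subsingleton.elim (x.comp (Ext.mk₀ p₁) (add_zero n)) 0,
      Subsingleton.elim (x.comp (Ext.mk₀ p₂) (add_zero n)) 0, Ext.zero_comp, Ext.zero_comp, add_zero]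

/-- Ext is additive in both variables. The extension beyond simple modules is needed because the
restriction of a simple module is only semisimple. -/
theorem surjective_mapExt_of_simple {n : ℕ}
    (h : ∀ L L' : Sim R, Function.Surjective (F.mapExtAddHom L.rep L'.rep n :
      Ext.{u} L.rep L'.rep n → Ext.{u} _ _ n))
    {X Y : ModuleCat.{u} R} (hX : Module.Finite R X)
    (hXs : IsSemisimpleModule R X) (hY : Module.Finite R Y) (hYs : IsSemisimpleModule R Y) :
    Function.Surjective (F.mapExtAddHom X Y n : Ext.{u} X Y n → Ext.{u} _ _ n) := by
  refine semisimple_induction_of_simple (P := fun X => Function.Surjective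
    (F.mapExtAddHom X Y n : Ext.{u} X Y n → Ext.{u} _ _ n)) (fun X hX x => ?_)
    (fun X X' L i₁ p₁ i₂ p₂ hid hL ih x => ?_) hX hXs (fun L _ => ?_)
  · have := subsingleton_ext_of_isZero_left (Y := F.obj Y) (F.map_isZero hX) n
    exact ⟨0, Subsingleton.elim _ _⟩
  · have hid' : F.map p₁ ≫ F.map i₁ + F.map p₂ ≫ F.map i₂ = 𝟙 (F.obj X) := by
      rw [← F.map_comp, ← F.map_comp, ← F.map_add, hid, F.map_id]
    obtain ⟨y₁, h₁⟩ := hL ((Ext.mk₀ (F.map i₁)).comp x (zero_add n))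
    obtain ⟨y₂, h₂⟩ := ih ((Ext.mk₀ (F.map i₂)).comp x (zero_add n))
    refine ⟨(Ext.mk₀ p₁).comp y₁ (zero_add n) + (Ext.mk₀ p₂).comp y₂ (zero_add n), ?_⟩
    rw [Functor.mapExtAddHom_apply] at h₁ h₂ ⊢
    rw [Ext.mapExactFunctor_add, Ext.mapExactFunctor_comp, Ext.mapExactFunctor_comp, h₁, h₂,
      Ext.mapExactFunctor_mk₀, Ext.mapExactFunctor_mk₀, ← ext_eq_add_left hid']
  · refine semisimple_induction_of_simple (P := fun Y => Function.Surjective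
      (F.mapExtAddHom L.rep Y n : Ext.{u} L.rep Y n → Ext.{u} _ _ n)) (fun Y hY y => ?_)
      (fun Y Y' L' i₁ p₁ i₂ p₂ hid hL ih y => ?_) hY hYs (fun L' _ => h L L')
    · have := subsingleton_ext_of_isZero_right (X := F.obj L.rep) (F.map_isZero hY) n
      exact ⟨0, Subsingleton.elim _ _⟩
    · have hid' : F.map p₁ ≫ F.map i₁ + F.map p₂ ≫ F.map i₂ = 𝟙 (F.obj Y) := by
        rw [← F.map_comp, ← F.map_comp, ← F.map_add, hid, F.map_id]
      obtain ⟨y₁, h₁⟩ := hL (y.comp (Ext.mk₀ (F.map p₁)) (add_zero n))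
      obtain ⟨y₂, h₂⟩ := ih (y.comp (Ext.mk₀ (F.map p₂)) (add_zero n))
      refine ⟨y₁.comp (Ext.mk₀ i₁) (add_zero n) + y₂.comp (Ext.mk₀ i₂) (add_zero n), ?_⟩
      rw [Functor.mapExtAddHom_apply] at h₁ h₂ ⊢
      rw [Ext.mapExactFunctor_add, Ext.mapExactFunctor_comp, Ext.mapExactFunctor_comp, h₁, h₂,
        Ext.mapExactFunctor_mk₀, Ext.mapExactFunctor_mk₀, ← ext_eq_add_right hid']

theorem injective_mapExt_of_simple {n : ℕ}
    (h : ∀ L L' : Sim R, Function.Injective (F.mapExtAddHom L.rep L'.rep n :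
      Ext.{u} L.rep L'.rep n → Ext.{u} _ _ n))
    {X Y : ModuleCat.{u} R} (hX : Module.Finite R X)
    (hXs : IsSemisimpleModule R X) (hY : Module.Finite R Y) (hYs : IsSemisimpleModule R Y) :
    Function.Injective (F.mapExtAddHom X Y n : Ext.{u} X Y n → Ext.{u} _ _ n) := by
  refine semisimple_induction_of_simple (P := fun X => Function.Injective
    (F.mapExtAddHom X Y n : Ext.{u} X Y n → Ext.{u} _ _ n)) (fun X hX => ?_)
    (fun X X' L i₁ p₁ i₂ p₂ hid hL ih => ?_) hX hXs (fun L _ => ?_)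
  · have := subsingleton_ext_of_isZero_left (Y := Y) hX n
    exact Function.injective_of_subsingleton _
  · rw [injective_iff_map_eq_zero] at ih hL ⊢
    intro y hy
    rw [Functor.mapExtAddHom_apply] at hy
    rw [ext_eq_add_left hid y,
      hL ((Ext.mk₀ i₁).comp y (zero_add n)) (by
        rw [Functor.mapExtAddHom_apply, Ext.mapExactFunctor_comp, hy, Ext.comp_zero]),
      ih ((Ext.mk₀ i₂).comp y (zero_add n)) (by
        rw [Functor.mapExtAddHom_apply, Ext.mapExactFunctor_comp, hy, Ext.comp_zero]),
      Ext.comp_zero, Ext.comp_zero, add_zero]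
  · refine semisimple_induction_of_simple (P := fun Y => Function.Injective
      (F.mapExtAddHom L.rep Y n : Ext.{u} L.rep Y n → Ext.{u} _ _ n)) (fun Y hY => ?_)
      (fun Y Y' L' i₁ p₁ i₂ p₂ hid hL ih => ?_) hY hYs (fun L' _ => h L L')
    · have := subsingleton_ext_of_isZero_right (X := L.rep) hY n
      exact Function.injective_of_subsingleton _
    · rw [injective_iff_map_eq_zero] at ih hL ⊢
      intro y hy
      rw [Functor.mapExtAddHom_apply] at hy
      rw [ext_eq_add_right hid y,
        hL (y.comp (Ext.mk₀ p₁) (add_zero n)) (by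
          rw [Functor.mapExtAddHom_apply, Ext.mapExactFunctor_comp, hy, Ext.zero_comp]),
        ih (y.comp (Ext.mk₀ p₂) (add_zero n)) (by
          rw [Functor.mapExtAddHom_apply, Ext.mapExactFunctor_comp, hy, Ext.zero_comp]),
        Ext.zero_comp, Ext.zero_comp, add_zero]

end SemisimpleInduction

/-! ### Squares of Frobenius pairs -/

/-- Two functors which are compatible with two Frobenius pairs. -/
structure FrobSquare {C D R T : Type u} [Ring C] [Ring D] [Ring R] [Ring T] (P : FrobPair C D)
    (P' : FrobPair R T) (F : ModuleCat.{u} C ⥤ ModuleCat.{u} R)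
    (F' : ModuleCat.{u} D ⥤ ModuleCat.{u} T) where
  α : P.U ⋙ F ≅ F' ⋙ P'.U
  β : P.V ⋙ F' ≅ F ⋙ P'.V
  compatT : ∀ Y, F'.map (P.pT.app Y) =
    β.hom.app (P.U.obj Y) ≫ P'.V.map (α.hom.app Y) ≫ P'.pT.app (F'.obj Y)
  compatR : ∀ Y, F.map (P.pR.app Y) =
    α.hom.app (P.V.obj Y) ≫ P'.U.map (β.hom.app Y) ≫ P'.pR.app (F.obj Y)

namespace FrobSquare

variable {C D R T : Type u} [Ring C] [Ring D] [Ring R] [Ring T] {P : FrobPair C D}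
  {P' : FrobPair R T} {F : ModuleCat.{u} C ⥤ ModuleCat.{u} R}
  {F' : ModuleCat.{u} D ⥤ ModuleCat.{u} T}

/-- The square with the Frobenius pairs in the opposite order. -/
def swap (sq : FrobSquare P P' F F') : FrobSquare P.swap P'.swap F' F where
  α := sq.β
  β := sq.α
  compatT := sq.compatR
  compatR := sq.compatT

open Abelian

variable (sq : FrobSquare P P' F F') [F.Additive] [Limits.PreservesFiniteLimits F]
  [Limits.PreservesFiniteColimits F] [F'.Additive] [Limits.PreservesFiniteLimits F']
  [Limits.PreservesFiniteColimits F'] {n : ℕ} {X Y : ModuleCat.{u} D}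

-- Restrict y along U', carry it over to F U by the square, and lift it there to x. Then V x, cut
-- down by the retraction U ⋙ V → 1, is a preimage of y; `compatT` says that F' takes this
-- retraction to the corresponding one on the other side.
include sq in
theorem surjective_mapExt (h : Function.Surjective (F.mapExtAddHom (P.U.obj X) (P.U.obj Y) n :
      Ext.{u} _ _ n → Ext.{u} _ _ n)) :
    Function.Surjective (F'.mapExtAddHom X Y n : Ext.{u} _ _ n → Ext.{u} _ _ n) := by
  intro y
  obtain ⟨x, hx⟩ := h ((Ext.mk₀ (sq.α.hom.app X)).comp ((Ext.mapExactFunctor.{u, u} P'.U y).comp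
    (Ext.mk₀ (sq.α.app Y).inv) (add_zero n)) (zero_add n))
  have h₁ : ExtComm (Ext.mapExactFunctor.{u, u} F x) (Ext.mapExactFunctor.{u, u} P'.U y)
      (sq.α.hom.app X) (sq.α.hom.app Y) := by
    rw [← Functor.mapExtAddHom_apply, hx]
    exact extComm_of_iso _ _ (sq.α.app Y)
  have h₂ : ExtComm (Ext.mapExactFunctor.{u, u} F' (Ext.mapExactFunctor.{u, u} P.V x))
      (Ext.mapExactFunctor.{u, u} P'.V (Ext.mapExactFunctor.{u, u} F x))
      (sq.β.hom.app (P.U.obj X)) (sq.β.hom.app (P.U.obj Y)) := by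
    rw [← mapExactFunctor_functor_comp, ← mapExactFunctor_functor_comp]
    exact mapExactFunctor_naturality sq.β.hom x
  have h₃ : ExtComm (Ext.mapExactFunctor.{u, u} P'.V (Ext.mapExactFunctor.{u, u} P'.U y)) y
      (P'.pT.app (F'.obj X)) (P'.pT.app (F'.obj Y)) := by
    have := mapExactFunctor_naturality P'.pT y
    rwa [mapExactFunctor_functor_comp, mapExactFunctor_id] at this
  have h₄ := h₂.trans ((h₁.map P'.V).trans h₃)
  refine ⟨(Ext.mk₀ (P.ηT.app X)).comp ((Ext.mapExactFunctor.{u, u} P.V x).comp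
    (Ext.mk₀ (P.pT.app Y)) (add_zero n)) (zero_add n), ?_⟩
  rw [Functor.mapExtAddHom_apply, Ext.mapExactFunctor_comp, Ext.mapExactFunctor_comp,
    Ext.mapExactFunctor_mk₀, Ext.mapExactFunctor_mk₀, sq.compatT]
  refine h₄.eq (i := F'.map (P.ηT.app X)) ?_
  rw [← sq.compatT, ← F'.map_comp, P.retT]
  exact F'.map_id X

-- If F' x = 0, then F (U x) vanishes, being U' (F' x) up to isomorphism. So U x = 0, and x is
-- recovered from U x by the retraction.
include sq in
theorem injective_mapExt (h : Function.Injective (F.mapExtAddHom (P.U.obj X) (P.U.obj Y) n :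
      Ext.{u} _ _ n → Ext.{u} _ _ n)) :
    Function.Injective (F'.mapExtAddHom X Y n : Ext.{u} _ _ n → Ext.{u} _ _ n) := by
  rw [injective_iff_map_eq_zero] at h ⊢
  intro x hx
  rw [Functor.mapExtAddHom_apply] at hx
  have h₁ : ExtComm (Ext.mapExactFunctor.{u, u} F (Ext.mapExactFunctor.{u, u} P.U x))
      (Ext.mapExactFunctor.{u, u} P'.U (Ext.mapExactFunctor.{u, u} F' x))
      (sq.α.hom.app X) (sq.α.hom.app Y) := by
    rw [← mapExactFunctor_functor_comp, ← mapExactFunctor_functor_comp]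
    exact mapExactFunctor_naturality sq.α.hom x
  have h₂ := h (Ext.mapExactFunctor.{u, u} P.U x) (by
    rw [Functor.mapExtAddHom_apply, ← Ext.comp_mk₀_id (Ext.mapExactFunctor F _)]
    have : Ext.mk₀ (𝟙 (F.obj (P.U.obj Y))) = (Ext.mk₀ (sq.α.hom.app Y)).comp
        (Ext.mk₀ (sq.α.inv.app Y)) (zero_add 0) := by
      rw [Ext.mk₀_comp_mk₀, Iso.hom_inv_id_app]
      rfl
    rw [this]
    refine (Ext.comp_assoc_of_third_deg_zero _ _ _ _).symm.trans ?_
    rw [h₁, hx, Ext.mapExactFunctor_zero, Ext.comp_zero, Ext.zero_comp])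
  rw [eq_of_mapExactFunctor_retract P.U P.V P.retT x, h₂, Ext.mapExactFunctor_zero, Ext.zero_comp,
    Ext.comp_zero]

end FrobSquare

theorem FrobPair.subsingleton_ext {C D : Type u} [Ring C] [Ring D] (P : FrobPair C D)
    {X Y : ModuleCat.{u} D} {n : ℕ}
    (h : Subsingleton (Abelian.Ext.{u} (P.U.obj X) (P.U.obj Y) n)) :
    Subsingleton (Abelian.Ext.{u} X Y n) :=
  subsingleton_of_forall_eq 0 fun x => by
    rw [eq_of_mapExactFunctor_retract P.U P.V P.retT x,
      Subsingleton.elim (Abelian.Ext.mapExactFunctor.{u, u} P.U x) 0,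
      Abelian.Ext.mapExactFunctor_zero, Abelian.Ext.zero_comp, Abelian.Ext.comp_zero]

/-! ### Functors which behave like induction from an exact Borel subalgebra -/

/-- The properties of `R ⊗_C -`, for an exact Borel subalgebra `C` of `R`, which do not refer
to an order on the simple `C`-modules. -/
structure IsBorelFunctor {C R : Type u} [Ring C] [Ring R] (F : ModuleCat.{u} C ⥤ ModuleCat.{u} R)
    (le : PartialOrder (Sim R)) : Prop where
  nontrivial : ∀ Y : Sim C, Nontrivial (F.obj Y.rep)
  noFactor : ∀ (Y : Sim C) (M : Sim R), IsQuot (F.obj Y.rep) M →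
    NoFactor {L | le.lt M L} (F.obj Y.rep)
  isRelProjective : ∀ (Y : Sim C) (M : Sim R), IsQuot (F.obj Y.rep) M →
    IsRelProjective {L | le.lt M L} (F.obj Y.rep)
  -- This condition replaces the bijection between simple modules: it forces F Y to have a simple
  -- top for simple Y, and different Y to have different tops. Semisimple rather than simple X and Y
  -- are allowed so that U and V can be applied.
  exists_map : ∀ (X Y : ModuleCat.{u} C) (Z : ModuleCat.{u} R), Module.Finite C X →
    IsSemisimpleModule C X → Module.Finite C Y → IsSemisimpleModule C Y → IsSemisimpleModule R Z →
    ∀ (q : F.obj Y ⟶ Z), Function.Surjective q → ∀ ψ : F.obj X ⟶ Z, ∃ f : X ⟶ Y, F.map f ≫ q = ψ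
  exists_isQuot_obj : ∀ M : Sim R, ∃ Y : Sim C, IsQuot (F.obj Y.rep) M
  lt_of_ext : ∀ (Y Y' : Sim C) (M M' : Sim R), ¬ Subsingleton (Abelian.Ext.{u} Y.rep Y'.rep 1) →
    IsQuot (F.obj Y.rep) M → IsQuot (F.obj Y'.rep) M' → le.lt M M'

/-! ### Additive functors on finitely generated semisimple modules -/

section Additive

variable {C R : Type u} [Ring C] [Ring R] [IsArtinianRing C]
  (F : ModuleCat.{u} C ⥤ ModuleCat.{u} R) [F.Additive] {X : Set (Sim R)} {W : ModuleCat.{u} C}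

theorem noFactor_obj_of_simple [IsArtinianRing R] (hW : Module.Finite C W)
    (hs : IsSemisimpleModule C W) (h : ∀ Y, IsQuot W Y → NoFactor X (F.obj Y.rep)) :
    NoFactor X (F.obj W) := by
  refine semisimple_induction_of_simple (P := fun W => NoFactor X (F.obj W)) (fun W hW => ?_)
    (fun W W' Y i₁ p₁ i₂ p₂ hid h₁ h₂ => ?_) hW hs h
  · have := ModuleCat.subsingleton_of_isZero (F.map_isZero hW)
    intro L _ hL
    obtain ⟨φ, hφ⟩ := cf_iff_cover.1 hL
    exact hφ (LinearMap.ext fun x => Subsingleton.elim _ _)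
  · refine NoFactor.of_exact (i := (F.map i₁).hom) (p := (F.map p₂).hom) (fun x hx => ?_) h₁ h₂
    have hid' : F.map p₁ ≫ F.map i₁ + F.map p₂ ≫ F.map i₂ = 𝟙 (F.obj W) := by
      rw [← F.map_comp, ← F.map_comp, ← F.map_add, hid, F.map_id]
    have h3 := LinearMap.congr_fun (congrArg ModuleCat.Hom.hom hid') x
    have h4 : (F.map i₁) (F.map p₁ x) + (F.map i₂) (F.map p₂ x) = x := h3
    have h5 : F.map p₂ x = 0 := hx
    rw [h5, map_zero, add_zero] at h4
    exact ⟨_, h4⟩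

theorem isRelProjective_obj_of_simple (hW : Module.Finite C W)
    (hs : IsSemisimpleModule C W) (h : ∀ Y, IsQuot W Y → IsRelProjective X (F.obj Y.rep)) :
    IsRelProjective X (F.obj W) := by
  refine semisimple_induction_of_simple (P := fun W => IsRelProjective X (F.obj W)) (fun W hW => ?_)
    (fun W W' Y i₁ p₁ i₂ p₂ hid h₁ h₂ => ?_) hW hs h
  · have := ModuleCat.subsingleton_of_isZero (F.map_isZero hW)
    intro A B p _ _ f
    exact ⟨0, LinearMap.ext fun x => by
      rw [Subsingleton.elim x 0, map_zero, map_zero]⟩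
  · intro A B p hp hA f
    obtain ⟨g₁, hg₁⟩ := h₁ A B p hp hA (f ∘ₗ (F.map i₁).hom)
    obtain ⟨g₂, hg₂⟩ := h₂ A B p hp hA (f ∘ₗ (F.map i₂).hom)
    have hid' : F.map p₁ ≫ F.map i₁ + F.map p₂ ≫ F.map i₂ = 𝟙 (F.obj W) := by
      rw [← F.map_comp, ← F.map_comp, ← F.map_add, hid, F.map_id]
    refine ⟨g₁ ∘ₗ (F.map p₁).hom + g₂ ∘ₗ (F.map p₂).hom, ?_⟩
    rw [LinearMap.comp_add, ← LinearMap.comp_assoc, hg₁, ← LinearMap.comp_assoc, hg₂]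
    change f ∘ₗ (F.map i₁).hom ∘ₗ (F.map p₁).hom + f ∘ₗ (F.map i₂).hom ∘ₗ (F.map p₂).hom = f
    rw [← LinearMap.comp_add]
    exact (congrArg (fun g => f ∘ₗ g) (congrArg ModuleCat.Hom.hom hid')).trans
      (LinearMap.comp_id f)

theorem exists_isQuot_obj_of_simple (hW : Module.Finite C W)
    (hs : IsSemisimpleModule C W) {M : Sim R} (h : IsQuot (F.obj W) M) :
    ∃ Y, IsQuot W Y ∧ IsQuot (F.obj Y.rep) M := by
  by_contra! hn
  obtain ⟨q, hq⟩ := h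
  refine hq (semisimple_induction_of_simple (P := fun W => ∀ q : F.obj W →ₗ[R] M.rep, q = 0)
    (fun W hW => ?_) (fun W W' Y i₁ p₁ i₂ p₂ hid h₁ h₂ q => ?_) hW hs (fun Y hY q => ?_) q)
  · have := ModuleCat.subsingleton_of_isZero (F.map_isZero hW)
    exact fun q => LinearMap.ext fun x => by rw [Subsingleton.elim x 0, map_zero, map_zero]
  · have hid' : F.map p₁ ≫ F.map i₁ + F.map p₂ ≫ F.map i₂ = 𝟙 (F.obj W) := by
      rw [← F.map_comp, ← F.map_comp, ← F.map_add, hid, F.map_id]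
    ext1 x
    have h4 : (F.map i₁) (F.map p₁ x) + (F.map i₂) (F.map p₂ x) = x :=
      LinearMap.congr_fun (congrArg ModuleCat.Hom.hom hid') x
    rw [← h4, map_add]
    have e₁ := LinearMap.congr_fun (h₁ (q ∘ₗ (F.map i₁).hom)) (F.map p₁ x)
    have e₂ := LinearMap.congr_fun (h₂ (q ∘ₗ (F.map i₂).hom)) (F.map p₂ x)
    exact (congrArg₂ (· + ·) e₁ e₂).trans (add_zero _)
  · by_contra h0
    exact hn Y hY ⟨q, h0⟩

end Additive

theorem isSemisimpleModule_prod {R : Type u} [Ring R] (M N : Type u) [AddCommGroup M] [Module R M]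
    [AddCommGroup N] [Module R N] [IsSemisimpleModule R M] [IsSemisimpleModule R N] :
    IsSemisimpleModule R (M × N) := by
  have h₁ := IsSemisimpleModule.range (LinearMap.inl R M N)
  have h₂ := IsSemisimpleModule.range (LinearMap.inr R M N)
  have h := IsSemisimpleModule.sup h₁ h₂
  rw [LinearMap.sup_range_inl_inr] at h
  exact IsSemisimpleModule.congr Submodule.topEquiv.symm

/-! ### Exact Borel structures described by the induction functor -/

namespace IsBorelFunctor

variable {C R : Type u} [Ring C] [Ring R] {F : ModuleCat.{u} C ⥤ ModuleCat.{u} R} [F.Additive]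
  {le : PartialOrder (Sim R)}

/-- Two independent simple quotients q and q' would give a surjection (q, q') from F Y onto a
semisimple module. The map (q, 0) must factor as (q, q') after F f with f an endomorphism of the
simple module Y. If f = 0 then q = 0; if f is invertible then q' = 0. -/
theorem hasTop (h : IsBorelFunctor F le) {Y : Sim C} (hfin : Module.Finite R (F.obj Y.rep))
    {M : Sim R} (hM : IsQuot (F.obj Y.rep) M) : HasTop (F.obj Y.rep) M := by
  obtain ⟨q, hq⟩ := hM
  have hqs := LinearMap.surjective_of_ne_zero hq
  refine ⟨q, hqs, fun X hX => ?_⟩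
  by_contra hXt
  obtain ⟨M', q', hq', hX'⟩ := exists_isQuot_notMem hXt
  have hqs' := LinearMap.surjective_of_ne_zero hq'
  have h₁ (m : M.rep) : ∃ x, q x = m ∧ q' x = 0 := by
    obtain ⟨x, rfl⟩ := hqs m
    obtain ⟨y, hy, z, hz, rfl⟩ := Submodule.mem_sup.1 (hX ▸ Submodule.mem_top : x ∈ X ⊔ LinearMap.ker q)
    exact ⟨y, by rw [map_add, LinearMap.mem_ker.1 hz, add_zero], hX' hy⟩
  have h₂ (m : M'.rep) : ∃ x, q x = 0 ∧ q' x = m := by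
    obtain ⟨x, rfl⟩ := hqs' m
    obtain ⟨y, hy, z, hz, rfl⟩ := Submodule.mem_sup.1 (hX ▸ Submodule.mem_top : x ∈ X ⊔ LinearMap.ker q)
    exact ⟨z, hz, by rw [map_add, LinearMap.mem_ker.1 (hX' hy), zero_add]⟩
  obtain ⟨f, hf⟩ := h.exists_map Y.rep Y.rep (ModuleCat.of R (M.rep × M'.rep)) inferInstance
    inferInstance inferInstance inferInstance
    (isSemisimpleModule_prod M.rep M'.rep) (ModuleCat.ofHom (q.prod q'))
    (by
      rintro ⟨m, m'⟩
      obtain ⟨x, hx, hx'⟩ := h₁ m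
      obtain ⟨y, hy, hy'⟩ := h₂ m'
      exact ⟨x + y, Prod.ext (by simp [hx, hy]) (by simp [hx', hy'])⟩)
    (ModuleCat.ofHom (q.prod 0))
  have hf₁ (x : F.obj Y.rep) : q (F.map f x) = q x :=
    congrArg Prod.fst (LinearMap.congr_fun (congrArg ModuleCat.Hom.hom hf) x)
  have hf₂ (x : F.obj Y.rep) : q' (F.map f x) = 0 :=
    congrArg Prod.snd (LinearMap.congr_fun (congrArg ModuleCat.Hom.hom hf) x)
  by_cases h0 : f.hom = 0
  · have : f = 0 := ModuleCat.hom_ext h0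
    refine hq (LinearMap.ext fun x => ?_)
    rw [← hf₁, this, F.map_zero]
    exact map_zero q
  · have : IsIso f := (ConcreteCategory.isIso_iff_bijective f).2 (LinearMap.bijective_of_ne_zero h0)
    refine hq' (LinearMap.ext fun x => ?_)
    have hx : F.map f (F.map (inv f) x) = x := by
      rw [← ConcreteCategory.comp_apply, ← F.map_comp, IsIso.inv_hom_id, F.map_id]
      rfl
    rw [← hx, hf₂]
    rfl

theorem existsUnique_isQuot (h : IsBorelFunctor F le) {Y : Sim C}
    (hfin : Module.Finite R (F.obj Y.rep)) : ∃! M : Sim R, IsQuot (F.obj Y.rep) M := by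
  have := h.nontrivial Y
  obtain ⟨M, hM⟩ := exists_isQuot (R := R) (M := F.obj Y.rep)
  exact ⟨M, hM, fun M' hM' => (h.hasTop hfin hM).eq_of_isQuot hM'⟩

theorem eq_of_isQuot (h : IsBorelFunctor F le) {Y Y' : Sim C} {M : Sim R}
    (hY : IsQuot (F.obj Y.rep) M) (hY' : IsQuot (F.obj Y'.rep) M) : Y = Y' := by
  obtain ⟨q, hq⟩ := hY
  obtain ⟨q', hq'⟩ := hY'
  obtain ⟨f, hf⟩ := h.exists_map Y.rep Y'.rep M.rep inferInstance inferInstance inferInstance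
    inferInstance inferInstance (ModuleCat.ofHom q') (LinearMap.surjective_of_ne_zero hq')
    (ModuleCat.ofHom q)
  refine Sim.eq_of_ne_zero f.hom fun h0 => hq ?_
  have : f = 0 := ModuleCat.hom_ext h0
  rw [this, F.map_zero] at hf
  exact (congrArg ModuleCat.Hom.hom (hf.symm.trans Limits.zero_comp))

/-- A functor as in the definition determines an exact Borel structure. -/
theorem exists_order [IsArtinianRing C] [IsArtinianRing R] (h : IsBorelFunctor F le)
    (hle : IsAdapted le) (hfin : ∀ Y : Sim C, Module.Finite R (F.obj Y.rep)) :
    ∃ leC : PartialOrder (Sim C), IsDirected leC ∧ ∃ i : Sim C ≃ Sim R,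
      (∀ L L' : Sim C, leC.le L L' ↔ le.le (i L) (i L')) ∧
      ∀ L : Sim C, IsStandard le (i L) (F.obj L.rep) := by
  choose i hi hi' using fun Y => h.existsUnique_isQuot (hfin Y)
  have hinj : Function.Injective i := fun Y Y' hY => h.eq_of_isQuot (hi Y) (hY ▸ hi Y')
  have hsurj : Function.Surjective i := fun M => by
    obtain ⟨Y, hY⟩ := h.exists_isQuot_obj M
    exact ⟨Y, (hi' Y M hY).symm⟩
  refine ⟨@PartialOrder.lift _ _ le i hinj, isDirected_iff.2 fun L L' hL =>
    h.lt_of_ext L L' _ _ hL (hi L) (hi L'), Equiv.ofBijective i ⟨hinj, hsurj⟩,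
    fun _ _ => Iff.rfl, fun L => ?_⟩
  exact hle.isStandard_iff.2 ⟨h.hasTop (hfin L) (hi L), h.noFactor L _ (hi L),
    h.isRelProjective L _ (hi L)⟩

/-- Peel off a simple summand of Y. Solve first modulo the image Z₁ of that summand using the rest
of Y, then correct the error, which lies in Z₁, by a map into the summand. Additivity in X is
immediate. -/
theorem exists_map_of_simple [IsArtinianRing C]
    (h : ∀ (X Y : Sim C) (Z : ModuleCat.{u} R), IsSemisimpleModule R Z →
      ∀ (q : F.obj Y.rep ⟶ Z), Function.Surjective q → ∀ ψ : F.obj X.rep ⟶ Z,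
        ∃ f : X.rep ⟶ Y.rep, F.map f ≫ q = ψ)
    (X Y : ModuleCat.{u} C) (Z : ModuleCat.{u} R) (hX : Module.Finite C X)
    (hXs : IsSemisimpleModule C X) (hY : Module.Finite C Y) (hYs : IsSemisimpleModule C Y)
    (hZ : IsSemisimpleModule R Z) (q : F.obj Y ⟶ Z) (hq : Function.Surjective q)
    (ψ : F.obj X ⟶ Z) : ∃ f : X ⟶ Y, F.map f ≫ q = ψ := by
  revert Z
  refine semisimple_induction_of_simple (P := fun Y => ∀ Z : ModuleCat.{u} R,
    IsSemisimpleModule R Z → ∀ (q : F.obj Y ⟶ Z), Function.Surjective q → ∀ ψ : F.obj X ⟶ Z,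
      ∃ f : X ⟶ Y, F.map f ≫ q = ψ) (fun Y hY Z hZ q hq ψ => ?_)
      (fun Y Y' L i₁ p₁ i₂ p₂ hid h₁ h₂ Z hZ q hq ψ => ?_) hY hYs (fun L _ Z hZ q hq ψ => ?_)
  · have := ModuleCat.subsingleton_of_isZero (F.map_isZero hY)
    have : Subsingleton Z := hq.subsingleton
    exact ⟨0, by ext x; exact Subsingleton.elim _ _⟩
  · let q₁ : F.obj L.rep ⟶ Z := F.map i₁ ≫ q
    let Z₁ : Submodule R Z := LinearMap.range q₁.hom
    have hid' : F.map p₁ ≫ F.map i₁ + F.map p₂ ≫ F.map i₂ = 𝟙 (F.obj Y) := by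
      rw [← F.map_comp, ← F.map_comp, ← F.map_add, hid, F.map_id]
    obtain ⟨f₂, hf₂⟩ := h₂ (ModuleCat.of R (Z ⧸ Z₁))
      (inferInstanceAs (IsSemisimpleModule R (Z ⧸ Z₁)))
      (F.map i₂ ≫ q ≫ ModuleCat.ofHom Z₁.mkQ) (fun z => by
        obtain ⟨z, rfl⟩ := Submodule.mkQ_surjective _ z
        obtain ⟨y, rfl⟩ := hq z
        refine ⟨F.map p₂ y, ?_⟩
        have h4 : (F.map i₁) (F.map p₁ y) + (F.map i₂) (F.map p₂ y) = y :=
          LinearMap.congr_fun (congrArg ModuleCat.Hom.hom hid') y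
        change Z₁.mkQ (q (F.map i₂ (F.map p₂ y))) = Z₁.mkQ (q y)
        rw [← sub_eq_zero, ← map_sub, ← map_sub]
        refine (Submodule.Quotient.mk_eq_zero Z₁).2 ⟨-F.map p₁ y, ?_⟩
        change q (F.map i₁ (-F.map p₁ y)) = _
        rw [map_neg]
        refine congrArg q ?_
        rw [eq_sub_iff_add_eq, neg_add_eq_iff_eq_add]
        exact h4.symm) (ψ ≫ ModuleCat.ofHom Z₁.mkQ)
    have hmem (x : F.obj X) : (ψ - F.map f₂ ≫ F.map i₂ ≫ q) x ∈ Z₁ := by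
      rw [← Submodule.Quotient.mk_eq_zero]
      have := LinearMap.congr_fun (congrArg ModuleCat.Hom.hom hf₂) x
      change Z₁.mkQ (ψ x - q (F.map i₂ (F.map f₂ x))) = 0
      rw [map_sub, sub_eq_zero]
      exact this.symm
    obtain ⟨f₁, hf₁⟩ := h₁ (ModuleCat.of R Z₁) (inferInstanceAs (IsSemisimpleModule R Z₁))
      (ModuleCat.ofHom q₁.hom.rangeRestrict) q₁.hom.surjective_rangeRestrict
      (ModuleCat.ofHom ((ψ - F.map f₂ ≫ F.map i₂ ≫ q).hom.codRestrict Z₁ hmem))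
    have hf₁' : F.map f₁ ≫ q₁ = ψ - F.map f₂ ≫ F.map i₂ ≫ q :=
      congrArg (fun g => g ≫ ModuleCat.ofHom Z₁.subtype) hf₁
    refine ⟨f₁ ≫ i₁ + f₂ ≫ i₂, ?_⟩
    rw [F.map_add, F.map_comp, F.map_comp, Preadditive.add_comp, Category.assoc, Category.assoc,
      hf₁', sub_add_cancel]
  · refine semisimple_induction_of_simple (P := fun X => ∀ ψ : F.obj X ⟶ Z,
      ∃ f : X ⟶ L.rep, F.map f ≫ q = ψ) (fun X hX ψ => ⟨0, (F.map_isZero hX).eq_of_src _ _⟩)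
      (fun X X' L' i₁ p₁ i₂ p₂ hid h₁ h₂ ψ => ?_) hX hXs (fun L' _ ψ => h L' L Z hZ q hq ψ) ψ
    obtain ⟨f₁, hf₁⟩ := h₁ (F.map i₁ ≫ ψ)
    obtain ⟨f₂, hf₂⟩ := h₂ (F.map i₂ ≫ ψ)
    refine ⟨p₁ ≫ f₁ + p₂ ≫ f₂, ?_⟩
    rw [F.map_add, F.map_comp, F.map_comp, Preadditive.add_comp, Category.assoc, Category.assoc,
      hf₁, hf₂, ← Category.assoc, ← Category.assoc, ← Preadditive.add_comp, ← F.map_comp,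
      ← F.map_comp, ← F.map_add, hid, F.map_id, Category.id_comp]

/-- The one nontrivial field is `exists_map`. For simple X and Y and ψ ≠ 0, the surjection q
identifies Z with the top of F Y, so X and Y have the same top and are equal. Then ψ and q differ by
a scalar, by Schur's lemma, and F takes scalars to scalars. -/
theorem of_isStandard [IsArtinianRing C] {k : Type u} [Field k] [IsAlgClosed k]
    [Algebra k C] [Algebra k R] [FiniteDimensional k R] [IsArtinianRing R]
    (hlin : ∀ (M : ModuleCat.{u} C) (c : k),
      (F.map (ModuleCat.ofHom (scalarEnd k M c))).hom = scalarEnd k (F.obj M) c)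
    {leC : PartialOrder (Sim C)} (hle : IsAdapted le) (hC : IsDirected leC) (i : Sim C ≃ Sim R)
    (hi : ∀ L L' : Sim C, leC.le L L' ↔ le.le (i L) (i L'))
    (hF : ∀ L : Sim C, IsStandard le (i L) (F.obj L.rep)) : IsBorelFunctor F le where
  nontrivial Y := (isStandard_iff.1 (hF Y)).1.nontrivial
  noFactor Y M hM := by
    obtain ⟨h₁, h₂, h₃⟩ := hle.isStandard_iff.1 (hF Y)
    rwa [h₁.eq_of_isQuot hM]
  isRelProjective Y M hM := by
    obtain ⟨h₁, h₂, h₃⟩ := hle.isStandard_iff.1 (hF Y)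
    rwa [h₁.eq_of_isQuot hM]
  exists_map := exists_map_of_simple fun X Y Z hZ q hq ψ => by
    by_cases hψ : ψ = 0
    · exact ⟨0, by rw [hψ, F.map_zero]; exact Limits.zero_comp⟩
    obtain ⟨τ, hτ⟩ := (isStandard_iff.1 (hF Y)).1
    have hk : LinearMap.ker τ ≤ LinearMap.ker q.hom := HasTop.ker_le_of_isSemisimple hτ q.hom
    let e := τ.quotKerEquivOfSurjective hτ.surjective
    let q' : (i Y).rep →ₗ[R] Z := (LinearMap.ker τ).liftQ q.hom hk ∘ₗ e.symm.toLinearMap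
    have hq' (x : F.obj Y.rep) : q' (τ x) = q x := by
      change (LinearMap.ker τ).liftQ q.hom hk (e.symm (e (Submodule.Quotient.mk x))) = _
      rw [LinearEquiv.symm_apply_apply]
      rfl
    have hq's : Function.Surjective q' := fun z => by
      obtain ⟨x, rfl⟩ := hq z
      exact ⟨τ x, hq' x⟩
    have hq'0 : q' ≠ 0 := fun h0 => hψ <| by
      ext x
      obtain ⟨y, hy⟩ := hq's (ψ x)
      exact hy.symm.trans (LinearMap.congr_fun h0 y)
    let e' := LinearEquiv.ofBijective q'
      ⟨(LinearMap.injective_or_eq_zero q').resolve_right hq'0, hq's⟩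
    let ψ' : F.obj X.rep →ₗ[R] (i Y).rep := e'.symm.toLinearMap ∘ₗ ψ.hom
    have hψ' (x : F.obj X.rep) : q' (ψ' x) = ψ x := e'.apply_symm_apply _
    have hXY : X = Y := i.injective <| ((isStandard_iff.1 (hF X)).1.eq_of_isQuot ⟨ψ', fun h0 =>
      hψ (by
        ext x
        refine (hψ' x).symm.trans ((congrArg q' (LinearMap.congr_fun h0 x)).trans ?_)
        exact map_zero q')⟩).symm
    subst hXY
    have hk' : LinearMap.ker τ ≤ LinearMap.ker ψ' := HasTop.ker_le_of_isSemisimple hτ ψ'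
    obtain ⟨c, hc⟩ := exists_algebraMap_smul (k := k)
      ((LinearMap.ker τ).liftQ ψ' hk' ∘ₗ e.symm.toLinearMap)
    have hcx (x : F.obj X.rep) : ψ' x = algebraMap k R c • τ x := by
      rw [← hc]
      change _ = (LinearMap.ker τ).liftQ ψ' hk' (e.symm (e (Submodule.Quotient.mk x)))
      rw [LinearEquiv.symm_apply_apply]
      rfl
    refine ⟨ModuleCat.ofHom (scalarEnd k X.rep c), ?_⟩
    ext x
    refine (congrArg q (LinearMap.congr_fun (hlin X.rep c) x)).trans ?_
    rw [← hψ' x, hcx, map_smul, hq']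
    exact map_smul q.hom _ _
  exists_isQuot_obj M := ⟨i.symm M, by
    have := (isStandard_iff.1 (hF (i.symm M))).1.isQuot
    rwa [i.apply_symm_apply] at this⟩
  lt_of_ext Y Y' M M' h hM hM' := by
    rw [(isStandard_iff.1 (hF Y)).1.eq_of_isQuot hM, (isStandard_iff.1 (hF Y')).1.eq_of_isQuot hM']
    have := isDirected_iff.1 hC Y Y' h
    exact lt_of_le_of_ne ((hi Y Y').1 this.le) fun he => this.ne (i.injective he)

end IsBorelFunctor

theorem map_retract {C R : Type u} [Ring C] [Ring R] (F : ModuleCat.{u} C ⥤ ModuleCat.{u} R)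
    {X Y : ModuleCat.{u} C} {i : Y ⟶ X} {r : X ⟶ Y} (h : i ≫ r = 𝟙 Y) :
    F.map i ≫ F.map r = 𝟙 (F.obj Y) := by
  rw [← F.map_comp, h, F.map_id]

/-! ### Transfer of Borel functors along a square -/

namespace FrobSquare

variable {C D R T : Type u} [Ring C] [Ring D] [Ring R] [Ring T] [IsArtinianRing C]
  [IsArtinianRing D] [IsArtinianRing R] [IsArtinianRing T] {P : FrobPair C D}
  {P' : FrobPair R T} {F : ModuleCat.{u} C ⥤ ModuleCat.{u} R}
  {F' : ModuleCat.{u} D ⥤ ModuleCat.{u} T} [F.Additive] [F'.Additive]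
  {leR : PartialOrder (Sim R)} {leT : PartialOrder (Sim T)}

-- S is a retract of V Y, so F' S is a retract of F' V Y, which is V' F Y, and F Y has top M.
omit [IsArtinianRing C] [IsArtinianRing D] [IsArtinianRing R] [IsArtinianRing T] [F.Additive]
  [F'.Additive] in
theorem rel_of_isQuot (sq : FrobSquare P P' F F') {S : Sim D} {Y : Sim C} (hSY : P.Rel S Y) {N : Sim T} {M : Sim R}
    (hN : IsQuot (F'.obj S.rep) N) (hM : HasTop (F.obj Y.rep) M) : P'.Rel N M := by
  have hs := P.isSemisimple_V Y
  obtain ⟨g, hg⟩ := P.rel_iff_isQuot_V.1 hSY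
  obtain ⟨s, hs⟩ := IsSemisimpleModule.lifting_property g (LinearMap.surjective_of_ne_zero hg) LinearMap.id
  have hsg : (ModuleCat.ofHom s : S.rep ⟶ P.V.obj Y.rep) ≫ ModuleCat.ofHom g = 𝟙 S.rep :=
    ModuleCat.hom_ext hs
  obtain ⟨q, hq⟩ := hN
  refine P'.rel_of_hasTop hM ⟨q ∘ₗ (sq.β.inv.app Y.rep ≫ F'.map (ModuleCat.ofHom g)).hom,
    fun h0 => hq ?_⟩
  have h1 : F'.map (ModuleCat.ofHom s : S.rep ⟶ P.V.obj Y.rep) ≫ sq.β.hom.app Y.rep ≫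
      sq.β.inv.app Y.rep ≫ F'.map (ModuleCat.ofHom g) = 𝟙 (F'.obj S.rep) := by
    rw [← Category.assoc (sq.β.hom.app Y.rep), Iso.hom_inv_id_app]
    exact (congrArg _ (Category.id_comp _)).trans (map_retract F' hsg)
  ext1 x
  have h2 := LinearMap.congr_fun (congrArg ModuleCat.Hom.hom h1) x
  refine (congrArg q h2).symm.trans (LinearMap.congr_fun h0 _)

theorem isBorelFunctor (sq : FrobSquare P P' F F') (hord : P'.OrderCompat leT leR)
    (hfin : ∀ M : ModuleCat.{u} C, Module.Finite C M → Module.Finite R (F.obj M))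
    (h : IsBorelFunctor F leR) : IsBorelFunctor F' leT := by
  have hUfin (S : Sim D) : Module.Finite C (P.U.obj S.rep) := P.finU _ inferInstance
  have htop {Y : Sim C} {M : Sim R} (hM : IsQuot (F.obj Y.rep) M) : HasTop (F.obj Y.rep) M :=
    h.hasTop (hfin _ inferInstance) hM
  have hex (Y : Sim C) : ∃ M : Sim R, IsQuot (F.obj Y.rep) M := by
    have := h.nontrivial Y
    have := hfin Y.rep inferInstance
    exact exists_isQuot
  -- The set of simple modules above M depends only on N, not on the choice of M linked to it. So
  -- the different simple summands Y of U S all impose the same condition on factors.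
  have hmatch {N : Sim T} {M : Sim R} (hNM : P'.Rel N M) :
      {L | leR.lt M L} = {L | ∃ S, P'.Rel S L ∧ leT.lt N S} := by
    ext L
    constructor
    · intro hL
      obtain ⟨S, hS⟩ := P'.exists_rel_left L
      exact ⟨S, hS, (hord _ _ _ _ hNM hS).2 hL⟩
    · rintro ⟨S, hS, hS'⟩
      exact (hord _ _ _ _ hNM hS).1 hS'
  have hmatch' (N : Sim T) : P'.Match {S | leT.lt N S} {L | ∃ S, P'.Rel S L ∧ leT.lt N S} := by
    obtain ⟨M, hM⟩ := P'.exists_rel_right N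
    rw [← hmatch hM]
    exact hord.match hM
  constructor
  · intro S
    obtain ⟨Y, i, hi⟩ := P.exists_rel_right S
    have := P.isSemisimple_U S
    obtain ⟨r, hr⟩ := IsSemisimpleModule.extension_property i
      ((LinearMap.injective_or_eq_zero i).resolve_right hi) LinearMap.id
    have hir : (ModuleCat.ofHom i : Y.rep ⟶ P.U.obj S.rep) ≫ ModuleCat.ofHom r = 𝟙 Y.rep :=
      ModuleCat.hom_ext hr
    by_contra hS
    rw [not_nontrivial_iff_subsingleton] at hS
    have h0 : Limits.IsZero (F.obj (P.U.obj S.rep)) :=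
      (P'.U.map_isZero (ModuleCat.isZero_of_subsingleton (F'.obj S.rep))).of_iso (sq.α.app S.rep)
    have h1 : 𝟙 (F.obj Y.rep) = 0 := (map_retract F hir).symm.trans
      ((congrArg (· ≫ F.map (ModuleCat.ofHom r)) (h0.eq_of_tgt (F.map (ModuleCat.ofHom i)) 0)).trans
        Limits.zero_comp)
    obtain ⟨x, hx⟩ := @exists_ne _ (h.nontrivial Y) 0
    exact hx (LinearMap.congr_fun (congrArg ModuleCat.Hom.hom h1) x)
  · intro S N hN
    refine (hmatch' N).of_noFactor_U ?_
    refine NoFactor.of_equiv (noFactor_obj_of_simple F (hUfin S) (P.isSemisimple_U S) fun Y hY => ?_)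
      (sq.α.app S.rep).toLinearEquiv.symm
    obtain ⟨M, hM⟩ := hex Y
    rw [← hmatch (sq.rel_of_isQuot (P.rel_iff_isQuot_U.2 hY) hN (htop hM))]
    exact h.noFactor Y M hM
  · intro S N hN
    refine (hmatch' N).of_isRelProjective_U ?_
    refine IsRelProjective.of_equiv (isRelProjective_obj_of_simple F (hUfin S) (P.isSemisimple_U S)
      fun Y hY => ?_) (sq.α.app S.rep).toLinearEquiv.symm
    obtain ⟨M, hM⟩ := hex Y
    rw [← hmatch (sq.rel_of_isQuot (P.rel_iff_isQuot_U.2 hY) hN (htop hM))]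
    exact h.isRelProjective Y M hM
  · intro X Y Z hX hXs hY hYs hZ q hq ψ
    -- Solve the factorisation problem after applying U', then return with V and the two
    -- retractions. Compatibility of the square with these makes the answer solve the original
    -- problem.
    obtain ⟨f, hf⟩ := h.exists_map (P.U.obj X) (P.U.obj Y) (P'.U.obj Z) (P.finU _ hX) (P.ssU _ hXs)
      (P.finU _ hY) (P.ssU _ hYs) (P'.ssU _ hZ) (sq.α.hom.app Y ≫ P'.U.map q)
      ((P'.surjective_U hq).comp (sq.α.app Y).toLinearEquiv.surjective)
      (sq.α.hom.app X ≫ P'.U.map ψ)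
    refine ⟨P.ηT.app X ≫ P.V.map f ≫ P.pT.app Y, ?_⟩
    have e₁ : F'.map (P.pT.app Y) ≫ q =
        sq.β.hom.app (P.U.obj Y) ≫ P'.V.map (sq.α.hom.app Y ≫ P'.U.map q) ≫ P'.pT.app Z := by
      have := P'.pT.naturality q
      rw [sq.compatT, P'.V.map_comp]
      simp only [Category.assoc]
      exact congrArg (fun z => sq.β.hom.app (P.U.obj Y) ≫ P'.V.map (sq.α.hom.app Y) ≫ z) this.symm
    have e₂ : F'.map (P.pT.app X) ≫ ψ =
        sq.β.hom.app (P.U.obj X) ≫ P'.V.map (sq.α.hom.app X ≫ P'.U.map ψ) ≫ P'.pT.app Z := by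
      have := P'.pT.naturality ψ
      rw [sq.compatT, P'.V.map_comp]
      simp only [Category.assoc]
      exact congrArg (fun z => sq.β.hom.app (P.U.obj X) ≫ P'.V.map (sq.α.hom.app X) ≫ z) this.symm
    have e₃ : F'.map (P.V.map f) ≫ sq.β.hom.app (P.U.obj Y) =
        sq.β.hom.app (P.U.obj X) ≫ P'.V.map (F.map f) := sq.β.hom.naturality f
    have e₄ : F'.map (P.V.map f) ≫ F'.map (P.pT.app Y) ≫ q = F'.map (P.pT.app X) ≫ ψ := by
      rw [e₁, e₂, ← Category.assoc, e₃, Category.assoc, ← hf, P'.V.map_comp (F.map f),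
        Category.assoc]
    rw [F'.map_comp, F'.map_comp, Category.assoc, Category.assoc, e₄, ← Category.assoc,
      ← F'.map_comp, P.retT]
    exact (congrArg (fun z => z ≫ ψ) (F'.map_id X)).trans (Category.id_comp ψ)
  · intro N
    obtain ⟨M, hM⟩ := P'.exists_rel_right N
    obtain ⟨Y, q, hq⟩ := h.exists_isQuot_obj M
    have hf : IsQuot (F'.obj (P.V.obj Y.rep)) N := by
      have h1 : IsQuot (P'.V.obj (F.obj Y.rep)) N :=
        isQuot_of_surjective (P'.rel_iff_isQuot_V.1 hM)
          (P'.surjective_V (f := ModuleCat.ofHom q) (LinearMap.surjective_of_ne_zero hq))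
      exact isQuot_of_surjective h1 (sq.β.app Y.rep).toLinearEquiv.surjective
    obtain ⟨S, -, hS⟩ := exists_isQuot_obj_of_simple F' (P.finV _ inferInstance)
      (P.isSemisimple_V Y) hf
    exact ⟨S, hS⟩
  · intro S S' N N' hS hN hN'
    by_contra hlt
    refine hS (P.subsingleton_ext (subsingleton_ext_of_simple (hUfin S) (P.isSemisimple_U S)
      (hUfin S') (P.isSemisimple_U S') fun Y Y' hY hY' => ?_))
    by_contra hYY
    obtain ⟨M, hM⟩ := hex Y
    obtain ⟨M', hM'⟩ := hex Y'
    exact hlt ((hord _ _ _ _ (sq.rel_of_isQuot (P.rel_iff_isQuot_U.2 hY) hN (htop hM))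
      (sq.rel_of_isQuot (P.rel_iff_isQuot_U.2 hY') hN' (htop hM'))).2
      (h.lt_of_ext Y Y' M M' hYY hM hM'))

end FrobSquare

/-! ### Frobenius extensions -/

section TensorAdd

variable {S R : Type u} [Ring S] [Ring R] {f : S →+* R} {M : Type u} [AddCommGroup M] [Module S M]

theorem tensorMk_add_left (a b : R) (m : M) :
    tensorMk f (a + b) m = tensorMk f a m + tensorMk f b m := by
  simp only [tensorMk, TensorProduct.add_tmul, map_add]

/-- The additive map `a ↦ a ⊗ m`. -/
noncomputable def tensorMkLeft (f : S →+* R) (m : M) : R →+ TensorOver f M :=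
  AddMonoidHom.mk' (fun a => tensorMk f a m) fun a b => tensorMk_add_left a b m

/-- The additive map `m ↦ a ⊗ m`. -/
noncomputable def tensorMkRight (f : S →+* R) (M : Type u) [AddCommGroup M] [Module S M] (a : R) :
    M →+ TensorOver f M :=
  AddMonoidHom.mk' (fun m => tensorMk f a m) fun m n => tensorMk_add a m n

theorem tensorMk_sum_left {ι : Type*} (s : Finset ι) (a : ι → R) (m : M) :
    tensorMk f (∑ i ∈ s, a i) m = ∑ i ∈ s, tensorMk f (a i) m :=
  map_sum (tensorMkLeft f m) a s

theorem tensorMk_sum_right {ι : Type*} (s : Finset ι) (a : R) (m : ι → M) :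
    tensorMk f a (∑ i ∈ s, m i) = ∑ i ∈ s, tensorMk f a (m i) :=
  map_sum (tensorMkRight f M a) m s

theorem tensorMk_zero_right (a : R) : tensorMk f a (0 : M) = 0 :=
  map_zero (tensorMkRight f M a)

theorem tensorOver_induction {P : TensorOver f M → Prop} (x : TensorOver f M) (zero : P 0)
    (mk : ∀ a m, P (tensorMk f a m)) (add : ∀ x y, P x → P y → P (x + y)) : P x := by
  obtain ⟨x, rfl⟩ := Submodule.mkQ_surjective _ x
  induction x with
  | zero => rwa [map_zero]
  | tmul a m => exact mk a m
  | add x y hx hy =>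
    rw [map_add]
    exact add _ _ hx hy

/-- The additive map out of `R ⊗_S M` given by a balanced map. -/
noncomputable def tensorLiftAdd {N : Type u} [AddCommGroup N] (b : R →+ M →+ N)
    (hb : ∀ a s m, b (a * f s) m = b a (s • m)) : TensorOver f M →+ N :=
  QuotientAddGroup.lift (tensorRelations f M).toAddSubgroup
    (TensorProduct.liftAddHom b fun n a m => by rw [map_zsmul, map_zsmul]; rfl) (by
    intro x hx
    change TensorProduct.liftAddHom b _ x = 0
    -- The relations span an R-submodule but b is only additive, so the induction must carry all
    -- multiples r • x along.
    have key : ∀ r : R, TensorProduct.liftAddHom b (fun n a m => by rw [map_zsmul, map_zsmul]; rfl) (r • x) = 0 := by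
      refine Submodule.span_induction (p := fun x _ => ∀ r : R,
        TensorProduct.liftAddHom b (fun n a m => by rw [map_zsmul, map_zsmul]; rfl) (r • x) = 0) ?_ ?_ ?_ ?_
        (show x ∈ tensorRelations f M from hx)
      · rintro _ ⟨a, s, m, rfl⟩ r
        rw [smul_sub, TensorProduct.smul_tmul', TensorProduct.smul_tmul', map_sub,
          TensorProduct.liftAddHom_tmul, TensorProduct.liftAddHom_tmul, smul_eq_mul, smul_eq_mul,
          ← mul_assoc, hb, sub_self]
      · intro r
        rw [smul_zero, map_zero]
      · intro x y _ _ hx hy r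
        rw [smul_add, map_add, hx, hy, add_zero]
      · intro a x _ hx r
        rw [smul_smul, hx]
    simpa using key 1)

theorem tensorLiftAdd_mk {N : Type u} [AddCommGroup N] (b : R →+ M →+ N)
    (hb : ∀ a s m, b (a * f s) m = b a (s • m)) (a : R) (m : M) :
    tensorLiftAdd b hb (tensorMk f a m) = b a m := rfl

variable (f) in
/-- The class of `a ⊗ n` in `R ⊗_S N`, for an `R`-module `N`. -/
noncomputable def resMk {N : ModuleCat.{u} R} (a : R) (n : N) :
    TensorOver f ((ModuleCat.restrictScalars.{u} f).obj N) :=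
  tensorMk f (M := (ModuleCat.restrictScalars.{u} f).obj N) a n

section ResMk

variable {N N' : ModuleCat.{u} R}

theorem resMk_add (a : R) (m n : N) : resMk f a (m + n) = resMk f a m + resMk f a n :=
  tensorMk_add (M := (ModuleCat.restrictScalars.{u} f).obj N) a m n

theorem smul_resMk (b a : R) (n : N) : b • resMk f a n = resMk f (b * a) n :=
  smul_tensorMk (M := (ModuleCat.restrictScalars.{u} f).obj N) b a n

theorem resMk_smul (a : R) (s : S) (n : N) : resMk f a (f s • n) = resMk f (a * f s) n :=
  tensorMk_smul (M := (ModuleCat.restrictScalars.{u} f).obj N) a s n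

theorem resMk_sum_left {ι : Type*} (s : Finset ι) (a : ι → R) (n : N) :
    resMk f (∑ i ∈ s, a i) n = ∑ i ∈ s, resMk f (a i) n :=
  tensorMk_sum_left (M := (ModuleCat.restrictScalars.{u} f).obj N) s a n

theorem resMk_sum_right {ι : Type*} (s : Finset ι) (a : R) (n : ι → N) :
    resMk f a (∑ i ∈ s, n i) = ∑ i ∈ s, resMk f a (n i) :=
  tensorMk_sum_right (M := (ModuleCat.restrictScalars.{u} f).obj N) s a n

theorem tensorMap_resMk (g : N ⟶ N') (a : R) (n : N) :
    tensorMap (f := f) ((ModuleCat.restrictScalars.{u} f).map g).hom (resMk f a n) =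
      resMk f a (g n) :=
  tensorMap_mk _ a _

theorem counit_resMk (a : R) (n : N) :
    ((inductionAdjunction f).counit.app N).hom (resMk f a n) = a • n := by
  have : resMk f a n = a • resMk f 1 n := by rw [smul_resMk, mul_one]
  rw [this]
  refine (map_smul ((inductionAdjunction f).counit.app N).hom a _).trans ?_
  exact congrArg (a • ·) (tensorExtend_mk f (M := (ModuleCat.restrictScalars.{u} f).obj N)
    (N := N) LinearMap.id n)

end ResMk

theorem finite_tensorOver (f : S →+* R) (M : Type u) [AddCommGroup M] [Module S M]
    [Module.Finite S M] : Module.Finite R (TensorOver f M) := by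
  classical
  obtain ⟨s, hs⟩ := Module.Finite.fg_top (R := S) (M := M)
  refine ⟨⟨s.image (fun m => tensorMk f 1 m), eq_top_iff.2 fun x _ => ?_⟩⟩
  refine tensorOver_induction (P := fun x => x ∈ Submodule.span R _) x (Submodule.zero_mem _)
    (fun t m => ?_) fun x y => Submodule.add_mem _
  have ht : tensorMk f t m = t • tensorMk f 1 m := by rw [smul_tensorMk, mul_one]
  rw [ht]
  refine Submodule.smul_mem _ _ ?_
  refine Submodule.span_induction (p := fun m _ => tensorMk f 1 m ∈ Submodule.span R _)
    (fun m hm => Submodule.subset_span ?_) ?_ (fun m n _ _ hm hn => ?_) (fun r' m _ hm => ?_)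
    (hs ▸ Submodule.mem_top : m ∈ Submodule.span S (s : Set M))
  · exact Finset.mem_coe.2 (Finset.mem_image_of_mem _ hm)
  · rw [tensorMk_zero_right]
    exact Submodule.zero_mem _
  · rw [tensorMk_add]
    exact Submodule.add_mem _ hm hn
  · rw [tensorMk_smul, one_mul, ← mul_one (f r'), ← smul_tensorMk]
    exact Submodule.smul_mem _ _ hm

end TensorAdd

/-! ### Semisimplicity and the Jacobson radical -/

section JacobsonSemisimple

variable {R : Type u} [Ring R] [IsArtinianRing R] {M : Type u} [AddCommGroup M] [Module R M]

theorem isSemisimpleModule_of_jacobson_smul (h : ∀ r ∈ Ring.jacobson R, ∀ m : M, r • m = 0) :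
    IsSemisimpleModule R M := by
  have h : Module.IsTorsionBySet R M (Ring.jacobson R) := fun m r => h r r.2 m
  let _ := h.module
  exact (h.semilinearMap.isSemisimpleModule_iff_of_bijective Function.bijective_id).2
    inferInstance

omit [IsArtinianRing R] in
theorem jacobson_smul_eq_zero [IsSemisimpleModule R M] {r : R} (hr : r ∈ Ring.jacobson R) (m : M) :
    r • m = 0 := by
  have := Ring.jacobson_smul_top_le R M
    (Submodule.smul_mem_smul hr (Submodule.mem_top (x := m)))
  rw [IsSemisimpleModule.jacobson_eq_bot] at this
  exact this

end JacobsonSemisimple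

theorem exists_retraction {R : Type u} [Ring R] {M N : ModuleCat.{u} R} [IsSemisimpleModule R N]
    (i : M ⟶ N) (hi : Function.Injective i) : ∃ r : N ⟶ M, i ≫ r = 𝟙 M := by
  obtain ⟨r, hr⟩ := IsSemisimpleModule.extension_property i.hom hi LinearMap.id
  exact ⟨ModuleCat.ofHom r, ModuleCat.hom_ext hr⟩

/-- A Frobenius extension `j : R → T`, with Frobenius homomorphism `c` and dual bases `u`, `v`,
which is split and separable, and is compatible with the Jacobson radical. -/
structure FrobExt (R T : Type u) [Ring R] [Ring T] (ι : Type*) [Fintype ι] where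
  j : R →+* T
  c : T →+ R
  u : ι → T
  v : ι → T
  c_mul_left : ∀ r t, c (j r * t) = r * c t
  c_mul_right : ∀ t r, c (t * j r) = c t * r
  c_one : c 1 = 1
  sum_left : ∀ t, ∑ g, u g * j (c (v g * t)) = t
  sum_right : ∀ t, ∑ g, j (c (t * u g)) * v g = t
  /-- The inverse of `∑ u g * v g`. -/
  e : T
  e_comm : ∀ t, e * t = t * e
  e_mul_sum : e * ∑ g, u g * v g = 1
  jac_left : ∀ g, ∀ r ∈ Ring.jacobson R, ∃ r' ∈ Ring.jacobson R, j r * u g = u g * j r'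
  jac_right : ∀ g, ∀ r ∈ Ring.jacobson R, ∃ r' ∈ Ring.jacobson R, u g * j r = j r' * u g

namespace FrobExt

variable {R T : Type u} [Ring R] [Ring T] {ι : Type*} [Fintype ι] (E : FrobExt R T ι)

theorem c_j (r : R) : E.c (E.j r) = r := by
  rw [← mul_one (E.j r), E.c_mul_left, E.c_one, mul_one]

/-- Restriction of scalars along a Frobenius extension. -/
noncomputable abbrev res : ModuleCat.{u} T ⥤ ModuleCat.{u} R := ModuleCat.restrictScalars E.j

/-- The element `∑ u g ⊗ v g n`. -/
noncomputable def casimir {N : ModuleCat.{u} T} (n : N) : TensorOver E.j (E.res.obj N) :=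
  ∑ g, resMk E.j (E.u g) (E.v g • n)

theorem casimir_add {N : ModuleCat.{u} T} (n n' : N) :
    E.casimir (n + n') = E.casimir n + E.casimir n' := by
  simp only [casimir, smul_add, resMk_add, Finset.sum_add_distrib]

/-- The Casimir element ∑ u g ⊗ v g commutes with T: expand t * u g by `sum_left`, move the
coefficients across the tensor sign, and collect by `sum_right`. -/
theorem casimir_smul {N : ModuleCat.{u} T} (t : T) (n : N) :
    E.casimir (t • n) = t • E.casimir n := by
  have h1 (g : ι) : t • resMk E.j (E.u g) (E.v g • n) =
      ∑ h, resMk E.j (E.u h) ((E.j (E.c (E.v h * t * E.u g)) * E.v g) • n) := by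
    rw [smul_resMk, ← E.sum_left (t * E.u g), resMk_sum_left]
    refine Finset.sum_congr rfl fun h _ => ?_
    rw [← resMk_smul, ← mul_assoc (E.v h), mul_smul]
  rw [casimir, casimir, Finset.smul_sum, Finset.sum_congr rfl fun g _ => h1 g, Finset.sum_comm]
  refine Finset.sum_congr rfl fun h _ => ?_
  rw [← resMk_sum_right, smul_smul, ← Finset.sum_smul, E.sum_right]

/-- The unit of the adjunction between restriction and induction. -/
noncomputable def unit : 𝟭 (ModuleCat.{u} T) ⟶ E.res ⋙ induction E.j where
  app N := ModuleCat.ofHom (X := N) (Y := TensorOver E.j (E.res.obj N))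
    { toFun := E.casimir
      map_add' := E.casimir_add
      map_smul' := E.casimir_smul }
  naturality N N' f := by
    ext n
    change E.casimir (f n) = tensorMap (E.res.map f).hom (E.casimir n)
    rw [casimir, casimir, map_sum]
    refine Finset.sum_congr rfl fun g _ => ?_
    rw [tensorMap_resMk]
    exact congrArg (resMk E.j (E.u g)) (map_smul f.hom _ _).symm

/-- The map `t ⊗ m ↦ c(t) m`. -/
noncomputable def coeffMap (M : ModuleCat.{u} R) : TensorOver E.j M →+ M :=
  tensorLiftAdd (AddMonoidHom.mk' (fun t => AddMonoidHom.mk' (fun m : M => E.c t • m) (smul_add _))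
      fun a b => by ext m; exact (congrArg (· • m) (map_add E.c a b)).trans (add_smul _ _ _))
    fun a s m => by
      change E.c (a * E.j s) • m = E.c a • s • m
      rw [E.c_mul_right, mul_smul]

theorem coeffMap_mk (M : ModuleCat.{u} R) (t : T) (m : M) :
    E.coeffMap M (tensorMk E.j t m) = E.c t • m := tensorLiftAdd_mk _ _ t m

/-- The counit of the adjunction between restriction and induction. -/
noncomputable def counit : induction E.j ⋙ E.res ⟶ 𝟭 (ModuleCat.{u} R) where
  app M := ModuleCat.ofHom (X := E.res.obj ((induction E.j).obj M)) (Y := M)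
    { toFun := E.coeffMap M
      map_add' := map_add _
      map_smul' := fun r x => by
        refine tensorOver_induction (P := fun x => E.coeffMap M (E.j r • x) = r • E.coeffMap M x) x
          ?_ (fun t m => ?_) fun x y hx hy => ?_
        · rw [smul_zero, map_zero, smul_zero]
        · rw [smul_tensorMk, coeffMap_mk, coeffMap_mk, E.c_mul_left, mul_smul]
        · rw [smul_add, map_add, hx, hy, map_add, smul_add] }
  naturality M M' f := by
    ext x
    refine tensorOver_induction (P := fun x => E.coeffMap M' (tensorMap f.hom x) =
      f (E.coeffMap M x)) x ?_ (fun t m => ?_) fun x y hx hy => ?_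
    · rw [map_zero, map_zero, map_zero, map_zero]
    · rw [tensorMap_mk, coeffMap_mk, coeffMap_mk]
      exact (map_smul f.hom _ _).symm
    · rw [map_add, map_add, hx, hy, map_add, map_add]

/-- Restriction is left adjoint to induction. -/
noncomputable def resAdjunction : E.res ⊣ induction E.j where
  unit := E.unit
  counit := E.counit
  left_triangle_components N := by
    ext n
    change E.coeffMap (E.res.obj N) (∑ g, resMk E.j (E.u g) (E.v g • n)) = n
    rw [map_sum]
    have (g : ι) : E.coeffMap (E.res.obj N) (resMk E.j (E.u g) (E.v g • n)) =
        (E.j (E.c (E.u g)) * E.v g) • n :=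
      (E.coeffMap_mk _ _ _).trans (mul_smul (E.j (E.c (E.u g))) (E.v g) n).symm
    refine (Finset.sum_congr rfl fun g _ => this g).trans ?_
    refine (Finset.sum_smul (R := T) (M := N) (x := n)).symm.trans ?_
    have h := E.sum_right 1
    simp only [one_mul] at h
    exact (congrArg (fun t : T => t • (show N from n)) h).trans (one_smul T (show N from n))
  right_triangle_components M := by
    ext1
    refine tensorOver_linearMap_ext fun m => ?_
    change tensorMap (E.counit.app M).hom (∑ g, resMk E.j (N := (induction E.j).obj M) (E.u g)
      (E.v g • tensorMk E.j 1 m)) = tensorMk E.j 1 m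
    rw [map_sum]
    have (g : ι) : tensorMap (E.counit.app M).hom (resMk E.j
        (N := (induction E.j).obj M) (E.u g) (E.v g • tensorMk E.j 1 m)) =
        tensorMk E.j (E.u g * E.j (E.c (E.v g * 1))) m := by
      refine (tensorMap_mk _ _ _).trans ?_
      change tensorMk E.j (E.u g) (E.coeffMap M (E.v g • tensorMk E.j 1 m)) = _
      rw [smul_tensorMk, coeffMap_mk, tensorMk_smul]
    refine (Finset.sum_congr rfl fun g _ => this g).trans ?_
    rw [← tensorMk_sum_left, E.sum_left]

/-- Multiplication by the central element `e`. -/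
def mulE (N : ModuleCat.{u} T) : N ⟶ N := ModuleCat.ofHom
  { toFun := fun n => E.e • n
    map_add' := smul_add _
    map_smul' := fun t n => by rw [smul_smul, E.e_comm, mul_smul, RingHom.id_apply] }

theorem finite_res (N : ModuleCat.{u} T) (hN : Module.Finite T N) :
    Module.Finite R (E.res.obj N) := by
  classical
  obtain ⟨s, hs⟩ := hN.fg_top
  let X : Submodule R (E.res.obj N) := Submodule.span R (M := E.res.obj N)
    {x | ∃ m ∈ s, ∃ g, x = (E.v g • m : N)}
  have key : ∀ (t : T), ∀ m ∈ s, (t • m : N) ∈ X := fun t m hm => by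
    rw [← E.sum_right t, Finset.sum_smul]
    refine Submodule.sum_mem (M := E.res.obj N) X fun g _ => ?_
    rw [mul_smul]
    exact X.smul_mem (E.c (t * E.u g)) (Submodule.subset_span ⟨m, hm, g, rfl⟩)
  have h2 : ∀ (n : N) (t : T), (t • n : N) ∈ X := fun n => by
    refine Submodule.span_induction (p := fun (n : N) _ => ∀ t : T, (t • n : N) ∈ X)
      (fun m hm t => key t m hm) (fun t => ?_) (fun m m' _ _ h h' t => ?_) (fun t' m _ h t => ?_)
      (hs ▸ Submodule.mem_top : n ∈ Submodule.span T (s : Set N))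
    · rw [smul_zero]
      exact X.zero_mem
    · rw [smul_add]
      exact X.add_mem (h t) (h' t)
    · rw [smul_smul]
      exact h _
  refine ⟨Submodule.fg_def.2 ⟨_, ?_, show X = ⊤ from eq_top_iff.2 fun n _ => ?_⟩⟩
  · refine Set.Finite.subset ((s ×ˢ Finset.univ).image fun x : N × ι => (E.v x.2 • x.1 : N)).finite_toSet ?_
    rintro _ ⟨m, hm, g, rfl⟩
    exact Finset.mem_coe.2 (Finset.mem_image_of_mem (fun x : N × ι => (E.v x.2 • x.1 : N))
      (Finset.mem_product.2 ⟨hm, Finset.mem_univ g⟩ : (m, g) ∈ s ×ˢ Finset.univ))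
  · exact (congrArg (fun x : N => x ∈ X) (one_smul T (show N from n))).mp (h2 n 1)

/-- Let J be the radical of R. By `jac_right`, K = J N is a T-submodule, so it has a complement C,
and J C lies in K ∩ C = 0. Hence J K = J N = K, and nilpotency of J gives K = 0. -/
theorem isSemisimpleModule_res [IsArtinianRing R] (N : ModuleCat.{u} T)
    (hN : IsSemisimpleModule T N) : IsSemisimpleModule R (E.res.obj N) := by
  let J := Ring.jacobson R
  let K : Submodule R (E.res.obj N) := J • ⊤
  have hu (g : ι) (n : E.res.obj N) (hn : n ∈ K) : (E.u g • (show N from n) : N) ∈ K := by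
    refine Submodule.smul_induction_on (p := fun n : E.res.obj N =>
      (E.u g • (show N from n) : N) ∈ K) hn (fun r hr n _ => ?_) (fun x y hx hy => ?_)
    · obtain ⟨r', hr', h⟩ := E.jac_right g r hr
      change (E.u g • E.j r • (show N from n) : N) ∈ K
      rw [smul_smul, h, mul_smul]
      exact Submodule.smul_mem_smul (N := (⊤ : Submodule R (E.res.obj N))) hr' Submodule.mem_top
    · exact (congrArg (fun x : N => x ∈ K)
        (smul_add (E.u g) (show N from x) (show N from y)).symm).mp (K.add_mem hx hy)
  let K' : Submodule T N :=
    { carrier := {n : N | n ∈ K}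
      add_mem' := K.add_mem
      zero_mem' := K.zero_mem
      smul_mem' := fun t n hn => by
        change (t • n : N) ∈ K
        rw [← E.sum_left t, Finset.sum_smul]
        refine Submodule.sum_mem (M := E.res.obj N) K fun g _ => ?_
        rw [mul_smul]
        exact hu g _ (K.smul_mem _ hn) }
  obtain ⟨C', hC'⟩ := exists_isCompl K'
  let C : Submodule R (E.res.obj N) :=
    { carrier := {n : E.res.obj N | (show N from n) ∈ C'}
      add_mem' := C'.add_mem
      zero_mem' := C'.zero_mem
      smul_mem' := fun r n hn => C'.smul_mem (E.j r) hn }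
  have hsup : K ⊔ C = ⊤ := eq_top_iff.2 fun n _ => by
    obtain ⟨x, hx, y, hy, h⟩ := Submodule.mem_sup.1
      (hC'.sup_eq_top ▸ Submodule.mem_top : (show N from n) ∈ K' ⊔ C')
    exact Submodule.mem_sup.2 ⟨x, hx, y, hy, h⟩
  have hJC : J • C = ⊥ := le_bot_iff.1 fun n hn => by
    have h1 : n ∈ K := Submodule.smul_mono le_rfl le_top hn
    have h2 : n ∈ C := Submodule.smul_le_right hn
    exact (Submodule.disjoint_def.1 hC'.disjoint) n h1 h2
  have hK : J • K = K := by
    conv_rhs => rw [show K = J • ⊤ from rfl, ← hsup, Submodule.smul_sup, hJC, sup_bot_eq]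
  obtain ⟨n, hn⟩ := IsSemiprimaryRing.isNilpotent (R := R)
  have hpow : ∀ i : ℕ, J ^ i • K = K := fun i => by
    induction i with
    | zero => simp [Submodule.pow_zero, Ideal.one_eq_top]
    | succ i ih => rw [Ideal.IsTwoSided.pow_succ, Submodule.mul_smul, ih, hK]
  have hbot : K = ⊥ := by
    rw [← hpow n, hn]
    exact Submodule.bot_smul K
  refine isSemisimpleModule_of_jacobson_smul fun r hr n => ?_
  have : r • n ∈ K := Submodule.smul_mem_smul hr Submodule.mem_top
  rwa [hbot] at this

/-- The inclusion of a `T`-module into the module induced from its restriction. -/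
noncomputable def sepUnit : 𝟭 (ModuleCat.{u} T) ⟶ E.res ⋙ induction E.j where
  app N := E.mulE N ≫ E.unit.app N
  naturality N N' f := by
    have h : f ≫ E.mulE N' = E.mulE N ≫ f := by
      ext n
      exact (map_smul f.hom E.e n).symm
    have := E.unit.naturality f
    change f ≫ E.mulE N' ≫ _ = (E.mulE N ≫ _) ≫ _
    rw [← Category.assoc, h, Category.assoc, Category.assoc, ← this]
    rfl

theorem counit_casimir (N : ModuleCat.{u} T) (n : N) :
    ((inductionAdjunction E.j).counit.app N).hom (E.casimir n) = (∑ g, E.u g * E.v g) • n := by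
  rw [casimir, Finset.sum_smul]
  refine (map_sum ((inductionAdjunction E.j).counit.app N).hom _ _).trans
    (Finset.sum_congr rfl fun g _ => ?_)
  exact (counit_resMk (E.u g) (E.v g • n)).trans (mul_smul _ _ n).symm

theorem sepUnit_counit (N : ModuleCat.{u} T) :
    E.sepUnit.app N ≫ (inductionAdjunction E.j).counit.app N = 𝟙 N := by
  ext n
  refine (E.counit_casimir N (E.e • n)).trans ?_
  rw [smul_smul, ← E.e_comm, E.e_mul_sum, one_smul]
  rfl

/-- Maschke's averaging: an R-linear retraction is induced up to T and composed with the
separability section and the counit. -/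
theorem isSemisimpleModule_of_res (N : ModuleCat.{u} T) (hN : IsSemisimpleModule R (E.res.obj N)) :
    IsSemisimpleModule T N := by
  refine { exists_isCompl := fun X => ?_ }
  let i : ModuleCat.of T X ⟶ N := ModuleCat.ofHom X.subtype
  obtain ⟨r, hr⟩ := exists_retraction (E.res.map i) X.injective_subtype
  let ρ : N ⟶ ModuleCat.of T X := E.sepUnit.app N ≫ (induction E.j).map r ≫
    (inductionAdjunction E.j).counit.app (ModuleCat.of T X)
  have hV : (E.res ⋙ induction E.j).map i ≫ (induction E.j).map r = 𝟙 _ :=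
    ((induction E.j).map_comp _ _).symm.trans
      ((congrArg _ hr).trans ((induction E.j).map_id _))
  have hρ : i ≫ ρ = 𝟙 _ := by
    refine Eq.trans ?_ (E.sepUnit_counit (ModuleCat.of T X))
    refine (Category.assoc _ _ _).symm.trans ?_
    refine (congrArg (· ≫ _) (E.sepUnit.naturality i)).trans ?_
    refine (Category.assoc _ _ _).trans (congrArg (E.sepUnit.app (ModuleCat.of T X) ≫ ·) ?_)
    refine (Category.assoc _ _ _).symm.trans ?_
    exact (congrArg (· ≫ (inductionAdjunction E.j).counit.app (ModuleCat.of T X)) hV).trans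
      (Category.id_comp _)
  exact ⟨LinearMap.ker ρ.hom, LinearMap.isCompl_of_proj fun x =>
    LinearMap.congr_fun (congrArg ModuleCat.Hom.hom hρ) x⟩

/-- By `jac_left` the radical of R can be moved past every u g onto M, where it acts by zero. So the
induced module is semisimple over R, and Maschke's argument applies. -/
theorem isSemisimpleModule_induction [IsArtinianRing R] (M : ModuleCat.{u} R)
    (hM : IsSemisimpleModule R M) : IsSemisimpleModule T ((induction E.j).obj M) := by
  have hR : IsSemisimpleModule R (E.res.obj ((induction E.j).obj M)) := by
    refine isSemisimpleModule_of_jacobson_smul fun r hr x => ?_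
    change E.j r • (show TensorOver E.j M from x) = 0
    refine tensorOver_induction (P := fun x => E.j r • x = 0) x (smul_zero _) (fun t m => ?_)
      fun x y hx hy => by rw [smul_add, hx, hy, add_zero]
    rw [← E.sum_left t, tensorMk_sum_left, Finset.smul_sum]
    refine Finset.sum_eq_zero fun g _ => ?_
    obtain ⟨r', hr', h⟩ := E.jac_left g r hr
    rw [smul_tensorMk, ← mul_assoc, h, mul_assoc, ← map_mul, ← tensorMk_smul, mul_smul,
      jacobson_smul_eq_zero hr', tensorMk_zero_right]
  exact E.isSemisimpleModule_of_res _ hR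

/-- The Frobenius pair of functors given by a Frobenius extension. -/
noncomputable def frobPair [IsArtinianRing R] [IsArtinianRing T] : FrobPair R T where
  U := E.res
  V := induction E.j
  additiveU := inferInstance
  additiveV := inferInstance
  adj := inductionAdjunction E.j
  adj' := E.resAdjunction
  ηT := E.sepUnit
  pT := (inductionAdjunction E.j).counit
  retT := E.sepUnit_counit
  ηR := (inductionAdjunction E.j).unit
  pR := E.counit
  retR M := by
    ext m
    change E.coeffMap M (tensorMk E.j 1 m) = m
    rw [coeffMap_mk, E.c_one, one_smul]
  finU := E.finite_res
  finV M hM := finite_tensorOver E.j M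
  ssU := E.isSemisimpleModule_res
  ssV := E.isSemisimpleModule_induction

end FrobExt

/-! ### Induction along compatible Frobenius extensions -/

section InductionComp

variable {S R T : Type u} [Ring S] [Ring R] [Ring T] (f : S →+* R) (g : R →+* T) (h : S →+* T)
  (hh : ∀ s, g (f s) = h s)

/-- The map `R ⊗_S M → T ⊗_S M` induced by a ring homomorphism `R → T`. -/
noncomputable def tensorBaseMap (M : Type u) [AddCommGroup M] [Module S M] :
    TensorOver f M →+ TensorOver h M :=
  tensorLiftAdd (AddMonoidHom.mk' (fun r => tensorMkRight h M (g r)) fun a b => by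
      ext m
      exact (congrArg (tensorMk h · m) (map_add g a b)).trans (tensorMk_add_left _ _ m))
    fun a s m => by
      change tensorMk h (g (a * f s)) m = tensorMk h (g a) (s • m)
      rw [tensorMk_smul, map_mul, hh]

theorem tensorBaseMap_mk (M : Type u) [AddCommGroup M] [Module S M] (r : R) (m : M) :
    tensorBaseMap f g h hh M (tensorMk f r m) = tensorMk h (g r) m := rfl

theorem tensorBaseMap_smul (M : Type u) [AddCommGroup M] [Module S M] (r : R)
    (x : TensorOver f M) : tensorBaseMap f g h hh M (r • x) = g r • tensorBaseMap f g h hh M x := by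
  refine tensorOver_induction (P := fun x => tensorBaseMap f g h hh M (r • x) =
    g r • tensorBaseMap f g h hh M x) x ?_ (fun t m => ?_) fun x y hx hy => ?_
  · rw [smul_zero, map_zero, smul_zero]
  · rw [smul_tensorMk, tensorBaseMap_mk, tensorBaseMap_mk, smul_tensorMk, map_mul]
  · rw [smul_add, map_add, hx, hy, map_add, smul_add]

theorem tensorOver_linearMap_ext₂ {f : S →+* R} {g : R →+* T} {M : Type u} [AddCommGroup M]
    [Module S M] {N : Type u} [AddCommGroup N] [Module T N]
    {a b : TensorOver g (TensorOver f M) →ₗ[T] N}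
    (H : ∀ r m, a (tensorMk g 1 (tensorMk f r m)) = b (tensorMk g 1 (tensorMk f r m))) : a = b := by
  refine tensorOver_linearMap_ext fun x => ?_
  refine tensorOver_induction (P := fun x => a (tensorMk g 1 x) = b (tensorMk g 1 x)) x ?_ H
    fun x y hx hy => ?_
  · rw [tensorMk_zero_right, map_zero, map_zero]
  · rw [tensorMk_add, map_add, map_add, hx, hy]

/-- Transitivity of induction on a module. -/
noncomputable def tensorTransEquiv (M : Type u) [AddCommGroup M] [Module S M] :
    TensorOver g (TensorOver f M) ≃ₗ[T] TensorOver h M :=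
  LinearEquiv.ofLinearMap
    (tensorLift (tensorBaseMap f g h hh M) (tensorBaseMap_smul f g h hh M))
    (tensorLift (AddMonoidHom.mk' (fun m => tensorMk g 1 (tensorMk f 1 m)) fun a b => by
      rw [tensorMk_add, tensorMk_add]) fun s m => by
      change tensorMk g 1 (tensorMk f 1 (s • m)) = h s • tensorMk g 1 (tensorMk f 1 m)
      rw [tensorMk_smul, one_mul, ← mul_one (f s), ← smul_tensorMk, tensorMk_smul, one_mul,
        smul_tensorMk, mul_one, hh])
    (tensorOver_linearMap_ext fun m => by
      rw [LinearMap.comp_apply, tensorLift_mk, one_smul]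
      change tensorLift _ _ (tensorMk g 1 (tensorMk f 1 m)) = _
      rw [tensorLift_mk, one_smul, tensorBaseMap_mk, map_one]
      rfl)
    (tensorOver_linearMap_ext₂ fun r m => by
      rw [LinearMap.comp_apply, tensorLift_mk, one_smul, tensorBaseMap_mk, tensorLift_mk]
      change g r • tensorMk g 1 (tensorMk f 1 m) = tensorMk g 1 (tensorMk f r m)
      rw [smul_tensorMk, mul_one, ← mul_one r, ← smul_tensorMk r 1 m, tensorMk_smul, one_mul,
        mul_one])

theorem tensorTransEquiv_mk (M : Type u) [AddCommGroup M] [Module S M] (t : T) (r : R) (m : M) :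
    tensorTransEquiv f g h hh M (tensorMk g t (tensorMk f r m)) = tensorMk h (t * g r) m := by
  refine (tensorLift_mk _ (tensorBaseMap_smul f g h hh M) t _).trans ?_
  rw [tensorBaseMap_mk, smul_tensorMk]

theorem tensorTransEquiv_symm_mk (M : Type u) [AddCommGroup M] [Module S M] (t : T) (m : M) :
    (tensorTransEquiv f g h hh M).symm (tensorMk h t m) = tensorMk g t (tensorMk f 1 m) := by
  rw [LinearEquiv.symm_apply_eq, tensorTransEquiv_mk, map_one, mul_one]

end InductionComp

section MkRes

variable {B D A : Type u} [Ring B] [Ring D] [Ring A] (φ : B →+* A) (j : B →+* D)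
  {Y : ModuleCat.{u} D}

/-- The class of `a ⊗ y` in `A ⊗_B Y`, for a `D`-module `Y` regarded as a `B`-module. -/
noncomputable def mkRes (a : A) (y : Y) : TensorOver φ ((ModuleCat.restrictScalars.{u} j).obj Y) :=
  tensorMk φ (M := (ModuleCat.restrictScalars.{u} j).obj Y) a y

theorem mkRes_add (a : A) (x y : Y) : mkRes φ j a (x + y) = mkRes φ j a x + mkRes φ j a y :=
  tensorMk_add (M := (ModuleCat.restrictScalars.{u} j).obj Y) a x y

theorem mkRes_add_left (a b : A) (y : Y) : mkRes φ j (a + b) y = mkRes φ j a y + mkRes φ j b y :=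
  tensorMk_add_left (M := (ModuleCat.restrictScalars.{u} j).obj Y) a b y

theorem mkRes_smul (a : A) (b : B) (y : Y) : mkRes φ j a (j b • y) = mkRes φ j (a * φ b) y :=
  tensorMk_smul (M := (ModuleCat.restrictScalars.{u} j).obj Y) a b y

theorem mkRes_sum_left {ι : Type*} (s : Finset ι) (a : ι → A) (y : Y) :
    mkRes φ j (∑ i ∈ s, a i) y = ∑ i ∈ s, mkRes φ j (a i) y :=
  tensorMk_sum_left (M := (ModuleCat.restrictScalars.{u} j).obj Y) s a y

theorem mkRes_sum_right {ι : Type*} (s : Finset ι) (a : A) (y : ι → Y) :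
    mkRes φ j a (∑ i ∈ s, y i) = ∑ i ∈ s, mkRes φ j a (y i) :=
  tensorMk_sum_right (M := (ModuleCat.restrictScalars.{u} j).obj Y) s a y

end MkRes

/-- A morphism of Frobenius extensions. -/
structure FrobExt.Hom {B D A T : Type u} [Ring B] [Ring D] [Ring A] [Ring T] {ι : Type*}
    [Fintype ι] (E : FrobExt B D ι) (E' : FrobExt A T ι) (φ : B →+* A) (ψ : D →+* T) : Prop where
  map_j : ∀ b, ψ (E.j b) = E'.j (φ b)
  map_c : ∀ d, φ (E.c d) = E'.c (ψ d)
  map_u : ∀ g, ψ (E.u g) = E'.u g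
  map_v : ∀ g, ψ (E.v g) = E'.v g

namespace FrobExt.Hom

variable {B D A T : Type u} [Ring B] [Ring D] [Ring A] [Ring T] {ι : Type*} [Fintype ι]
  {E : FrobExt B D ι} {E' : FrobExt A T ι} {φ : B →+* A} {ψ : D →+* T} (H : E.Hom E' φ ψ)

include H

/-- The map `A ⊗_B Y → T ⊗_D Y`. -/
noncomputable def baseChange (Y : ModuleCat.{u} D) :
    TensorOver φ (E.res.obj Y) →ₗ[A] E'.res.obj ((induction ψ).obj Y) :=
  tensorLift (N := E'.res.obj ((induction ψ).obj Y)) (tensorMkRight ψ Y 1) fun b y => by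
    change tensorMk ψ 1 (E.j b • (show Y from y)) = E'.j (φ b) • tensorMk ψ 1 (show Y from y)
    rw [tensorMk_smul, one_mul, smul_tensorMk, mul_one, H.map_j]

theorem baseChange_mk (Y : ModuleCat.{u} D) (a : A) (y : Y) :
    H.baseChange Y (mkRes φ E.j a y) = tensorMk ψ (E'.j a) y := by
  refine (tensorLift_mk (N := E'.res.obj ((induction ψ).obj Y)) _ _ a _).trans ?_
  change E'.j a • tensorMk ψ 1 y = _
  rw [smul_tensorMk, mul_one]

/-- This is the balancing condition that makes the inverse of the base change map well defined; it
is the centrality computation for the Casimir element again. -/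
theorem sum_mkRes (Y : ModuleCat.{u} D) (t : T) (d : D) (y : Y) :
    ∑ g, mkRes φ E.j (E'.c (t * ψ d * E'.u g)) (E.v g • y) =
      ∑ g, mkRes φ E.j (E'.c (t * E'.u g)) (E.v g • d • y) := by
  have h1 (g : ι) : mkRes φ E.j (E'.c (t * ψ d * E'.u g)) (E.v g • y) =
      ∑ h, mkRes φ E.j (E'.c (t * E'.u h)) ((E.j (E.c (E.v h * d * E.u g)) * E.v g) • y) := by
    have : t * ψ d * E'.u g = ∑ h, t * E'.u h * E'.j (φ (E.c (E.v h * d * E.u g))) := by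
      rw [mul_assoc, ← H.map_u, ← map_mul, ← E.sum_left (d * E.u g), map_sum, Finset.mul_sum]
      refine Finset.sum_congr rfl fun h _ => ?_
      rw [map_mul, H.map_u, H.map_j, mul_assoc (E.v h), mul_assoc t]
    rw [this, map_sum, mkRes_sum_left]
    refine Finset.sum_congr rfl fun h _ => ?_
    rw [E'.c_mul_right, ← mkRes_smul, smul_smul]
  rw [Finset.sum_congr rfl fun g _ => h1 g, Finset.sum_comm]
  refine Finset.sum_congr rfl fun h _ => ?_
  rw [← mkRes_sum_right, ← Finset.sum_smul, E.sum_right, mul_smul]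

/-- The inverse of `A ⊗_B Y → T ⊗_D Y`. -/
noncomputable def baseChangeInv (Y : ModuleCat.{u} D) :
    TensorOver ψ Y →+ TensorOver φ (E.res.obj Y) :=
  tensorLiftAdd
    (AddMonoidHom.mk' (fun t => AddMonoidHom.mk'
        (fun y => ∑ g, mkRes φ E.j (E'.c (t * E'.u g)) (E.v g • y)) fun x y => by
          simp only [smul_add, mkRes_add, Finset.sum_add_distrib]) fun a b => by
        ext y
        change ∑ g, mkRes φ E.j (E'.c ((a + b) * E'.u g)) (E.v g • y) =
          ∑ g, mkRes φ E.j (E'.c (a * E'.u g)) (E.v g • y) +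
            ∑ g, mkRes φ E.j (E'.c (b * E'.u g)) (E.v g • y)
        simp only [add_mul, map_add, mkRes_add_left, Finset.sum_add_distrib])
    fun t d y => H.sum_mkRes Y t d y

theorem baseChangeInv_mk (Y : ModuleCat.{u} D) (t : T) (y : Y) :
    H.baseChangeInv Y (tensorMk ψ t y) =
      ∑ g, mkRes φ E.j (E'.c (t * E'.u g)) (E.v g • y) := rfl

/-- The isomorphism `A ⊗_B Y ≃ T ⊗_D Y`. -/
noncomputable def baseChangeEquiv (Y : ModuleCat.{u} D) :
    TensorOver φ (E.res.obj Y) ≃ₗ[A] E'.res.obj ((induction ψ).obj Y) :=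
  { H.baseChange Y with
    invFun := H.baseChangeInv Y
    left_inv := fun x => by
      change H.baseChangeInv Y (H.baseChange Y x) = x
      refine tensorOver_induction (P := fun x => H.baseChangeInv Y (H.baseChange Y x) = x) x ?_
        (fun a y => ?_) fun x y hx hy => ?_
      · rw [map_zero]
        exact map_zero (H.baseChangeInv Y)
      · refine (congrArg (H.baseChangeInv Y) (H.baseChange_mk Y a y)).trans ?_
        refine (H.baseChangeInv_mk Y (E'.j a) y).trans ?_
        have h1 (g : ι) : mkRes φ E.j (E'.c (E'.j a * E'.u g)) (E.v g • (show Y from y)) =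
            mkRes φ E.j a ((E.j (E.c (E.u g)) * E.v g) • (show Y from y)) := by
          rw [E'.c_mul_left, ← H.map_u, ← H.map_c, ← mkRes_smul, smul_smul]
        refine (Finset.sum_congr rfl fun g _ => h1 g).trans ?_
        have h := E.sum_right 1
        simp only [one_mul] at h
        rw [← mkRes_sum_right, ← Finset.sum_smul, h, one_smul]
        rfl
      · rw [map_add]
        exact (map_add (H.baseChangeInv Y) _ _).trans (congrArg₂ _ hx hy)
    right_inv := fun x => by
      change H.baseChange Y (H.baseChangeInv Y x) = x
      refine tensorOver_induction (P := fun x => (H.baseChange Y (H.baseChangeInv Y x) :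
        TensorOver ψ Y) = x) x ?_
        (fun t y => ?_) fun x y hx hy => ?_
      · exact (congrArg (H.baseChange Y) (map_zero (H.baseChangeInv Y))).trans (map_zero _)
      · rw [baseChangeInv_mk]
        refine (map_sum (H.baseChange Y) _ _).trans ?_
        refine (Finset.sum_congr rfl fun g _ => (H.baseChange_mk Y _ _).trans
          (tensorMk_smul (E'.j (E'.c (t * E'.u g))) (E.v g) y)).trans ?_
        refine (tensorMk_sum_left Finset.univ
          (fun g => E'.j (E'.c (t * E'.u g)) * ψ (E.v g)) y).symm.trans ?_
        simp only [H.map_v, E'.sum_right]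
      · exact (congrArg (H.baseChange Y) (map_add (H.baseChangeInv Y) x y)).trans
          ((map_add (H.baseChange Y) _ _).trans (congrArg₂ _ hx hy)) }

theorem baseChangeEquiv_mk (Y : ModuleCat.{u} D) (a : A) (y : Y) :
    H.baseChangeEquiv Y (mkRes φ E.j a y) = tensorMk ψ (E'.j a) y :=
  H.baseChange_mk Y a y

/-- Restriction commutes with induction. -/
noncomputable def resInduction : E.res ⋙ induction φ ≅ induction ψ ⋙ E'.res :=
  NatIso.ofComponents (fun Y => LinearEquiv.toModuleIso
      (X₁ := TensorOver φ (E.res.obj Y)) (X₂ := E'.res.obj ((induction ψ).obj Y))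
      (H.baseChangeEquiv Y)) fun {Y Y'} f => by
    ext1
    refine tensorOver_linearMap_ext (N := E'.res.obj ((induction ψ).obj Y')) fun y => ?_
    refine (congrArg (H.baseChangeEquiv Y') (tensorMap_mk (E.res.map f).hom 1 y)).trans ?_
    refine (H.baseChangeEquiv_mk Y' 1 (f y)).trans ?_
    refine Eq.trans ?_ (congrArg (tensorMap (f := ψ) f.hom) (H.baseChangeEquiv_mk Y 1 y)).symm
    exact (tensorMap_mk f.hom (E'.j 1) _).symm

/-- The isomorphism `T ⊗_D (D ⊗_B X) ≃ T ⊗_A (A ⊗_B X)`. -/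
noncomputable def inductionInductionEquiv (X : Type u) [AddCommGroup X] [Module B X] :
    TensorOver ψ (TensorOver E.j X) ≃ₗ[T] TensorOver E'.j (TensorOver φ X) :=
  (tensorTransEquiv E.j ψ (E'.j.comp φ) H.map_j X).trans
    (tensorTransEquiv φ E'.j (E'.j.comp φ) (fun _ => rfl) X).symm

theorem inductionInductionEquiv_mk (X : Type u) [AddCommGroup X] [Module B X] (t : T) (d : D)
    (x : X) : H.inductionInductionEquiv X (tensorMk ψ t (tensorMk E.j d x)) =
      tensorMk E'.j (t * ψ d) (tensorMk φ 1 x) := by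
  rw [inductionInductionEquiv, LinearEquiv.trans_apply, tensorTransEquiv_mk,
    tensorTransEquiv_symm_mk]

/-- Induction commutes with induction. -/
noncomputable def inductionInduction : induction E.j ⋙ induction ψ ≅ induction φ ⋙ induction E'.j :=
  NatIso.ofComponents (fun X => LinearEquiv.toModuleIso
      (X₁ := TensorOver ψ (TensorOver E.j X)) (X₂ := TensorOver E'.j (TensorOver φ X))
      (H.inductionInductionEquiv X)) fun {X X'} f => by
    ext1
    refine tensorOver_linearMap_ext₂ (f := E.j) (g := ψ) (M := X)
      (N := TensorOver E'.j (TensorOver φ X')) fun d x => ?_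
    refine (congrArg (inductionInductionEquiv H X') ((tensorMap_mk (tensorMap f.hom) 1 _).trans
      (congrArg (tensorMk ψ 1) (tensorMap_mk f.hom d x)))).trans ?_
    refine (H.inductionInductionEquiv_mk X' 1 d (f x)).trans (Eq.symm ?_)
    refine (congrArg (tensorMap (f := E'.j) (tensorMap (f := φ) f.hom))
      (H.inductionInductionEquiv_mk X 1 d x)).trans ?_
    rw [tensorMap_mk, tensorMap_mk]

/-- The square of Frobenius pairs given by a morphism of Frobenius extensions. -/
noncomputable def frobSquare [IsArtinianRing B] [IsArtinianRing D] [IsArtinianRing A]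
    [IsArtinianRing T] : FrobSquare E.frobPair E'.frobPair (induction φ) (induction ψ) where
  α := H.resInduction
  β := H.inductionInduction
  compatT Y := by
    ext1
    refine tensorOver_linearMap_ext₂ (f := E.j) (g := ψ) (M := E.res.obj Y) (N := TensorOver ψ Y)
      fun d y => ?_
    refine (tensorMap_mk _ 1 _).trans
      ((congrArg (tensorMk ψ 1) (counit_resMk (N := Y) d y)).trans (Eq.symm ?_))
    refine (congrArg (fun z => ((inductionAdjunction E'.j).counit.app ((induction ψ).obj Y)).hom
      (tensorMap (f := E'.j) (H.resInduction.hom.app Y).hom z))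
      (H.inductionInductionEquiv_mk (E.res.obj Y) 1 d y)).trans ?_
    refine (congrArg ((inductionAdjunction E'.j).counit.app ((induction ψ).obj Y)).hom
      ((tensorMap_mk _ _ _).trans (congrArg (tensorMk E'.j (1 * ψ d))
        (H.baseChange_mk Y 1 y)))).trans ?_
    refine (counit_resMk (N := (induction ψ).obj Y) (1 * ψ d) (tensorMk ψ (E'.j 1) y)).trans ?_
    refine (smul_tensorMk (1 * ψ d) (E'.j 1) _).trans ?_
    rw [map_one, mul_one]
    exact (tensorMk_smul (f := ψ) 1 d (show Y from y)).symm
  compatR X := by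
    ext1
    have key : ∀ (d : D) (x : X), tensorMap (f := φ) (E.counit.app X).hom
          (mkRes φ E.j (Y := (induction E.j).obj X) 1 (tensorMk E.j d x)) =
        E'.coeffMap ((induction φ).obj X) (H.inductionInductionEquiv X
          (H.baseChange ((induction E.j).obj X)
            (mkRes φ E.j (Y := (induction E.j).obj X) 1 (tensorMk E.j d x)))) := fun d x => by
      refine (tensorMap_mk _ 1 _).trans
        ((congrArg (tensorMk φ 1) (E.coeffMap_mk X d x)).trans (Eq.symm ?_))
      refine (congrArg (fun z => E'.coeffMap ((induction φ).obj X) (H.inductionInductionEquiv X z))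
        (H.baseChange_mk ((induction E.j).obj X) 1 (tensorMk E.j d x))).trans ?_
      refine (congrArg (E'.coeffMap ((induction φ).obj X))
        (H.inductionInductionEquiv_mk X (E'.j 1) d x)).trans ?_
      refine (E'.coeffMap_mk _ _ _).trans ((smul_tensorMk (f := φ) _ 1 x).trans ?_)
      rw [map_one, one_mul, ← H.map_c, tensorMk_smul, one_mul, mul_one]
    refine tensorOver_linearMap_ext (f := φ) (N := TensorOver φ X) fun x => ?_
    let mk : TensorOver E.j X →+ TensorOver φ (E.res.obj ((induction E.j).obj X)) :=
      tensorMkRight φ (E.res.obj ((induction E.j).obj X)) 1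
    exact DFunLike.congr_fun (tensorOver_hom_ext (f := E.j) (M := X)
      (g := (tensorMap (f := φ) (E.counit.app X).hom).toAddMonoidHom.comp mk)
      (h := (E'.coeffMap ((induction φ).obj X)).comp
        ((H.inductionInductionEquiv X).toLinearMap.toAddMonoidHom.comp
          ((H.baseChange ((induction E.j).obj X)).toAddMonoidHom.comp mk))) key) x

end FrobExt.Hom

/-! ### Projectivity and dual bases -/

section DualBasis

/-- `R` has a finite dual basis as a right `S`-module. -/
def HasRightDualBasis {S R : Type u} [Ring S] [Ring R] (f : S →+* R) : Prop :=
  ∃ (n : ℕ) (a : Fin n → R) (F : Fin n → R →+ S), (∀ i r s, F i (r * f s) = F i r * s) ∧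
    ∀ r, ∑ i, a i * f (F i r) = r

theorem HasRightDualBasis.of_fintype {S R : Type u} [Ring S] [Ring R] {f : S →+* R} {κ : Type*}
    [Fintype κ] (a : κ → R) (F : κ → R →+ S) (hF : ∀ i r s, F i (r * f s) = F i r * s)
    (h : ∀ r, ∑ i, a i * f (F i r) = r) : HasRightDualBasis f := by
  let e := (Fintype.equivFin κ).symm
  refine ⟨Fintype.card κ, a ∘ e, F ∘ e, fun i => hF _, fun r => ?_⟩
  exact (e.sum_comp fun i => a i * f (F i r)).trans (h r)

theorem HasRightDualBasis.isRightProjective {S R : Type u} [Ring S] [Ring R] {f : S →+* R}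
    (h : HasRightDualBasis f) : IsRightProjective f := by
  obtain ⟨n, a, F, hF, h⟩ := h
  let _ : Module Sᵐᵒᵖ R := Module.compHom R (RingHom.op f)
  let i : R →ₗ[Sᵐᵒᵖ] (Fin n → Sᵐᵒᵖ) :=
    { toFun := fun r j => MulOpposite.op (F j r)
      map_add' := fun r s => by
        ext j
        simp
      map_smul' := fun s r => by
        ext j
        change MulOpposite.op (F j (r * f s.unop)) = s * MulOpposite.op (F j r)
        rw [hF]
        rfl }
  let p : (Fin n → Sᵐᵒᵖ) →ₗ[Sᵐᵒᵖ] R :=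
    { toFun := fun c => ∑ j, a j * f (c j).unop
      map_add' := fun c d => by simp [mul_add, Finset.sum_add_distrib]
      map_smul' := fun s c => by
        change _ = (∑ j, a j * f (c j).unop) * f s.unop
        rw [Finset.sum_mul]
        refine Finset.sum_congr rfl fun j _ => ?_
        rw [mul_assoc, ← map_mul]
        rfl }
  exact Module.Projective.of_split i p (LinearMap.ext h)

/-- Finite generation by b makes R a retract of a finite free right module; the dual basis is read
off from the two maps. -/
theorem IsRightProjective.hasRightDualBasis {S R : Type u} [Ring S] [Ring R] {f : S →+* R}
    (h : IsRightProjective f) {κ : Type*} [Fintype κ] (b : κ → R)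
    (hb : ∀ r, ∃ s : κ → S, r = ∑ i, b i * f (s i)) : HasRightDualBasis f := by
  let _ : Module Sᵐᵒᵖ R := Module.compHom R (RingHom.op f)
  have hfin : Module.Finite Sᵐᵒᵖ R := by
    refine ⟨Submodule.fg_def.2 ⟨_, Set.finite_range b, eq_top_iff.2 fun r _ => ?_⟩⟩
    obtain ⟨s, rfl⟩ := hb r
    exact Submodule.sum_mem _ fun i _ => Submodule.smul_mem _ (MulOpposite.op (s i))
      (Submodule.subset_span ⟨i, rfl⟩)
  have hproj : Module.Projective Sᵐᵒᵖ R := h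
  obtain ⟨n, p, i, -, -, hpi⟩ := Module.Finite.exists_comp_eq_id_of_projective Sᵐᵒᵖ R
  refine ⟨n, fun j => p (Pi.single j 1), fun j => AddMonoidHom.mk' (fun r => (i r j).unop)
    fun r s => by simp, fun j r s => ?_, fun r => ?_⟩
  · change (i (MulOpposite.op s • r) j).unop = _
    rw [map_smul]
    rfl
  · conv_rhs => rw [← LinearMap.id_apply (R := Sᵐᵒᵖ) r, ← hpi, LinearMap.comp_apply,
      ← Finset.univ_sum_single (i r), map_sum]
    refine Finset.sum_congr rfl fun j _ => ?_
    have : Pi.single j (i r j) = i r j • (Pi.single j 1 : Fin n → Sᵐᵒᵖ) := by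
      rw [← Pi.single_smul, smul_eq_mul, mul_one]
    rw [this, map_smul]
    rfl

end DualBasis

namespace FrobExt.Hom

variable {B D A T : Type u} [Ring B] [Ring D] [Ring A] [Ring T] {ι : Type*} [Fintype ι]
  {E : FrobExt B D ι} {E' : FrobExt A T ι} {φ : B →+* A} {ψ : D →+* T} (H : E.Hom E' φ ψ)

include H

theorem mul_u (d : D) (g : ι) :
    ψ d * E'.u g = ∑ h, E'.u h * E'.j (φ (E.c (E.v h * d * E.u g))) := by
  rw [← H.map_u, ← map_mul, ← E.sum_left (d * E.u g), map_sum]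
  refine Finset.sum_congr rfl fun h _ => ?_
  rw [map_mul, H.map_u, H.map_j, mul_assoc (E.v h)]

/-- The elements are j(aᵢ), and the functionals are t ↦ ∑ j(Fᵢ(c(t u_g))) v_g; the Casimir identity
makes the latter right D-linear. -/
theorem hasRightDualBasis (h : HasRightDualBasis φ) : HasRightDualBasis ψ := by
  obtain ⟨n, a, F, hF, h⟩ := h
  refine ⟨n, fun i => E'.j (a i), fun i => AddMonoidHom.mk'
    (fun t => ∑ g, E.j (F i (E'.c (t * E'.u g))) * E.v g) fun s t => by
      simp only [add_mul, map_add, Finset.sum_add_distrib], fun i t d => ?_, fun t => ?_⟩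
  · change ∑ g, E.j (F i (E'.c (t * ψ d * E'.u g))) * E.v g =
      (∑ g, E.j (F i (E'.c (t * E'.u g))) * E.v g) * d
    have h1 (g : ι) : E.j (F i (E'.c (t * ψ d * E'.u g))) * E.v g =
        ∑ h, E.j (F i (E'.c (t * E'.u h))) * (E.j (E.c (E.v h * d * E.u g)) * E.v g) := by
      rw [mul_assoc, H.mul_u, Finset.mul_sum, map_sum, map_sum, map_sum, Finset.sum_mul]
      refine Finset.sum_congr rfl fun h _ => ?_
      rw [← mul_assoc t, E'.c_mul_right, hF, map_mul, mul_assoc]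
    rw [Finset.sum_congr rfl fun g _ => h1 g, Finset.sum_comm, Finset.sum_mul]
    refine Finset.sum_congr rfl fun h _ => ?_
    rw [← Finset.mul_sum, E.sum_right, mul_assoc]
  · change ∑ i, E'.j (a i) * ψ (∑ g, E.j (F i (E'.c (t * E'.u g))) * E.v g) = t
    have h1 (i : Fin n) : E'.j (a i) * ψ (∑ g, E.j (F i (E'.c (t * E'.u g))) * E.v g) =
        ∑ g, E'.j (a i * φ (F i (E'.c (t * E'.u g)))) * E'.v g := by
      rw [map_sum, Finset.mul_sum]
      refine Finset.sum_congr rfl fun g _ => ?_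
      rw [map_mul ψ, H.map_j, H.map_v, ← mul_assoc, map_mul E'.j]
    rw [Finset.sum_congr rfl fun i _ => h1 i, Finset.sum_comm]
    simp only [← Finset.sum_mul, ← map_sum, h, E'.sum_right]

/-- Here the elements are c(aᵢ u_g) and the functionals r ↦ c(v_g Fᵢ(j r)), indexed by pairs (i, g).
-/
theorem hasRightDualBasis_of (h : HasRightDualBasis ψ) : HasRightDualBasis φ := by
  obtain ⟨n, a, F, hF, h⟩ := h
  refine HasRightDualBasis.of_fintype (κ := Fin n × ι) (fun x => E'.c (a x.1 * E'.u x.2))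
    (fun x => AddMonoidHom.mk' (fun r => E.c (E.v x.2 * F x.1 (E'.j r))) fun r s => by
      simp only [map_add, mul_add]) (fun x r s => ?_) fun r => ?_
  · change E.c (E.v x.2 * F x.1 (E'.j (r * φ s))) = E.c (E.v x.2 * F x.1 (E'.j r)) * s
    rw [map_mul E'.j, ← H.map_j, hF, ← mul_assoc, E.c_mul_right]
  · change ∑ x : Fin n × ι, E'.c (a x.1 * E'.u x.2) * φ (E.c (E.v x.2 * F x.1 (E'.j r))) = r
    have h1 (i : Fin n) : ∑ g, E'.c (a i * E'.u g) * φ (E.c (E.v g * F i (E'.j r))) =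
        E'.c (a i * ψ (F i (E'.j r))) := by
      conv_rhs => rw [← E.sum_left (F i (E'.j r)), map_sum, Finset.mul_sum, map_sum]
      refine Finset.sum_congr rfl fun g _ => ?_
      rw [map_mul ψ, H.map_u, H.map_j, ← mul_assoc, E'.c_mul_right]
    rw [Fintype.sum_prod_type, Finset.sum_congr rfl fun i _ => h1 i, ← map_sum, h, E'.c_j]

end FrobExt.Hom

/-- A Frobenius extension restricts to subrings, if the data do. -/
def FrobExt.ofInjective {B D A T : Type u} [Ring B] [Ring D] [Ring A] [Ring T] {ι : Type*}
    [Fintype ι] (E' : FrobExt A T ι) (φ : B →+* A) (ψ : D →+* T) (hφ : Function.Injective φ)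
    (hψ : Function.Injective ψ) (j : B →+* D) (c : D →+ B) (u v : ι → D) (e : D)
    (map_j : ∀ b, ψ (j b) = E'.j (φ b)) (map_c : ∀ d, φ (c d) = E'.c (ψ d))
    (map_u : ∀ g, ψ (u g) = E'.u g) (map_v : ∀ g, ψ (v g) = E'.v g) (map_e : ψ e = E'.e)
    (jac_left : ∀ g, ∀ r ∈ Ring.jacobson B, ∃ r' ∈ Ring.jacobson B, j r * u g = u g * j r')
    (jac_right : ∀ g, ∀ r ∈ Ring.jacobson B, ∃ r' ∈ Ring.jacobson B, u g * j r = j r' * u g) :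
    FrobExt B D ι where
  j := j
  c := c
  u := u
  v := v
  e := e
  c_mul_left r t := hφ (by rw [map_c, map_mul ψ, map_mul φ, map_j, E'.c_mul_left, map_c])
  c_mul_right t r := hφ (by rw [map_c, map_mul ψ, map_mul φ, map_j, E'.c_mul_right, map_c])
  c_one := hφ (by rw [map_c, map_one ψ, map_one φ, E'.c_one])
  sum_left t := hψ (by simp only [map_sum, map_mul, map_u, map_j, map_c, map_v, E'.sum_left])
  sum_right t := hψ (by simp only [map_sum, map_mul, map_u, map_j, map_c, map_v, E'.sum_right])
  e_comm t := hψ (by rw [map_mul, map_mul, map_e, E'.e_comm])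
  e_mul_sum := hψ (by simp only [map_sum, map_mul, map_u, map_v, map_e, E'.e_mul_sum, map_one])
  jac_left := jac_left
  jac_right := jac_right

/-- The isomorphism `R ⊗_S S ≃ R`. -/
noncomputable def tensorOverSelf {S R : Type u} [Ring S] [Ring R] (f : S →+* R) :
    TensorOver f S ≃ₗ[R] R :=
  LinearEquiv.ofLinearMap (tensorLift f.toAddMonoidHom fun s m => map_mul f s m)
    (LinearMap.toSpanSingleton R _ (tensorMk f 1 1))
    (LinearMap.ext_ring (by
      rw [LinearMap.comp_apply, LinearMap.toSpanSingleton_apply, one_smul, tensorLift_mk]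
      exact (one_smul R (f 1)).trans (map_one f)))
    (tensorOver_linearMap_ext fun s => by
      rw [LinearMap.comp_apply, tensorLift_mk, one_smul]
      change f s • tensorMk f 1 (1 : S) = tensorMk f 1 s
      rw [smul_tensorMk, mul_one, ← one_mul (f s), ← tensorMk_smul, smul_eq_mul, mul_one])

theorem induction_map_scalarEnd {k A : Type u} [Field k] [Ring A] [Algebra k A]
    (B : Subalgebra k A) (M : ModuleCat.{u} B) (c : k) :
    ((induction (incl B)).map (ModuleCat.ofHom (scalarEnd k M c))).hom =
      scalarEnd k ((induction (incl B)).obj M) c := by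
  refine tensorOver_linearMap_ext (f := incl B) (N := TensorOver (incl B) M) fun m => ?_
  refine (tensorMap_mk _ 1 m).trans ?_
  change tensorMk (incl B) 1 (algebraMap k B c • m) =
    algebraMap k A c • tensorMk (incl B) 1 m
  rw [tensorMk_smul, smul_tensorMk, one_mul, mul_one]
  rfl

theorem IsRightProjective.hasRightDualBasis_incl {k A : Type u} [Field k] [Ring A] [Algebra k A]
    [FiniteDimensional k A] {B : Subalgebra k A} (h : IsRightProjective (incl B)) :
    HasRightDualBasis (incl B) := by
  refine h.hasRightDualBasis (Module.finBasis k A) fun r => ⟨fun i => algebraMap k B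
    ((Module.finBasis k A).repr r i), ?_⟩
  conv_lhs => rw [← (Module.finBasis k A).sum_repr r]
  refine Finset.sum_congr rfl fun i _ => ?_
  rw [Algebra.smul_def]
  exact Algebra.commutes _ _

/-! ### Skew group algebras -/

section SkewExt

variable {k A G : Type u} [Field k] [Ring A] [Algebra k A] [Group G] [MulSemiringAction G A]

theorem smul_mem_jacobson (g : G) {r : A} (hr : r ∈ Ring.jacobson A) :
    g • r ∈ Ring.jacobson A := by
  have : RingHomSurjective (MulSemiringAction.toRingHom G A g) :=
    ⟨fun a => ⟨g⁻¹ • a, smul_inv_smul g a⟩⟩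
  exact Ring.le_comap_jacobson (MulSemiringAction.toRingHom G A g) hr

variable [SMulCommClass G k A]

/-- The coefficient of `1` in an element of a skew group algebra. -/
noncomputable def coeffOne (A G : Type u) [Ring A] [Group G] : SkewMonoidAlgebra A G →+ A :=
  AddMonoidHom.mk' (fun t => t.coeff 1) fun s t => by rw [SkewMonoidAlgebra.coeff_add]; rfl

open SkewMonoidAlgebra in
variable (k A G) in
/-- `A * G` is a Frobenius extension of `A`. -/
noncomputable def skewExt [Fintype G] (hG : (Nat.card G : k) ≠ 0) :
    FrobExt A (SkewMonoidAlgebra A G) G where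
  j := singleOneRingHom
  c := coeffOne A G
  u g := single g 1
  v g := single g⁻¹ 1
  c_mul_left r t := coeff_single_one_mul t r 1
  c_mul_right t r := (coeff_mul_single_one t r 1).trans (by rw [one_smul]; rfl)
  c_one := by
    change (1 : SkewMonoidAlgebra A G).coeff 1 = 1
    rw [coeff_one, Finsupp.single_eq_same]
  sum_left t := by
    have h (g : G) : single g (1 : A) * singleOneRingHom (coeffOne A G (single g⁻¹ 1 * t)) =
        single g (t.coeff g) := by
      change single g (1 : A) * single 1 ((single g⁻¹ 1 * t).coeff 1) = _
      rw [coeff_single_mul, single_mul_single]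
      simp
    rw [Finset.sum_congr rfl fun g _ => h g]
    conv_rhs => rw [← sum_single t, sum_def, Finsupp.sum_fintype _ _ (by simp)]
  sum_right t := by
    have h (g : G) : singleOneRingHom (coeffOne A G (t * single g 1)) * single g⁻¹ (1 : A) =
        single g⁻¹ (t.coeff g⁻¹) := by
      change single (1 : G) ((t * single g 1).coeff 1) * single g⁻¹ (1 : A) = _
      rw [coeff_mul_single, single_mul_single]
      simp
    rw [Finset.sum_congr rfl fun g _ => h g]
    conv_rhs => rw [← sum_single t, sum_def, Finsupp.sum_fintype _ _ (by simp)]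
    exact Equiv.sum_comp (Equiv.inv G) fun g => single g (t.coeff g)
  -- Each product u g * v g is 1, so their sum is |G|; this is where invertibility of |G| is used.
  e := algebraMap k _ (Nat.card G : k)⁻¹
  e_comm t := Algebra.commutes _ _
  e_mul_sum := by
    have h (g : G) : single g (1 : A) * single g⁻¹ (1 : A) = 1 := by
      rw [single_mul_single]
      simp
    rw [Finset.sum_congr rfl fun g _ => h g, Finset.sum_const, Finset.card_univ,
      ← Nat.card_eq_fintype_card, nsmul_eq_mul, mul_one,
      ← map_natCast (algebraMap k (SkewMonoidAlgebra A G)), ← map_mul, inv_mul_cancel₀ hG, map_one]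
  jac_left g r hr := ⟨g⁻¹ • r, smul_mem_jacobson g⁻¹ hr, by
    change single (1 : G) r * single g 1 = single g 1 * single 1 (g⁻¹ • r)
    rw [single_mul_single, single_mul_single]
    simp⟩
  jac_right g r hr := ⟨g • r, smul_mem_jacobson g hr, by
    change single g 1 * single (1 : G) r = single 1 (g • r) * single g 1
    rw [single_mul_single, single_mul_single]
    simp⟩

variable {B : Subalgebra k A} (hB : ∀ g : G, B.map (MulSemiringAction.toAlgHom k A g) = B)

include hB in
theorem smul_mem_of_map_eq (g : G) {b : A} (hb : b ∈ B) : g • b ∈ B := by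
  have : g • b ∈ B.map (MulSemiringAction.toAlgHom k A g) := ⟨b, hb, rfl⟩
  rwa [hB g] at this

/-- The action of `G` on an invariant subalgebra. -/
@[reducible]
def subalgebraAction : MulSemiringAction G B where
  smul g b := ⟨g • (b : A), smul_mem_of_map_eq hB g b.2⟩
  one_smul b := Subtype.ext (one_smul G (b : A))
  mul_smul g h b := Subtype.ext (mul_smul g h (b : A))
  smul_zero g := Subtype.ext (smul_zero g)
  smul_add g b c := Subtype.ext (smul_add g (b : A) c)
  smul_one g := Subtype.ext (smul_one g)
  smul_mul g b c := Subtype.ext (smul_mul' g (b : A) c)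

theorem single_mem_skewSubalgebra (g : G) {b : A} (hb : b ∈ B) :
    SkewMonoidAlgebra.single g b ∈ skewSubalgebra B hB := fun h => by
  classical
  rw [SkewMonoidAlgebra.coeff_single_apply]
  split_ifs
  · exact hb
  · exact B.zero_mem

/-- The inclusion of `B` into `B * G`. -/
noncomputable def skewSubalgebraSingle : B →+* skewSubalgebra B hB :=
  (SkewMonoidAlgebra.singleOneRingHom.comp (incl B)).codRestrict (skewSubalgebra B hB)
    fun b => single_mem_skewSubalgebra hB 1 b.2

open SkewMonoidAlgebra in
/-- `B * G` is a Frobenius extension of `B`. -/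
noncomputable def skewSubExt [Fintype G] (hG : (Nat.card G : k) ≠ 0) :
    FrobExt B (skewSubalgebra B hB) G :=
  (skewExt k A G hG).ofInjective (incl B) (incl (skewSubalgebra B hB)) Subtype.val_injective
    Subtype.val_injective (skewSubalgebraSingle hB)
    (AddMonoidHom.mk' (fun t => ⟨coeffOne A G t, t.2 1⟩) fun s t => Subtype.ext (map_add _ _ _))
    (fun g => ⟨single g 1, single_mem_skewSubalgebra hB g B.one_mem⟩)
    (fun g => ⟨single g⁻¹ 1, single_mem_skewSubalgebra hB g⁻¹ B.one_mem⟩)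
    (algebraMap k _ (Nat.card G : k)⁻¹) (fun _ => rfl) (fun _ => rfl) (fun _ => rfl) (fun _ => rfl)
    rfl
    (fun g r hr => by
      let _ := subalgebraAction hB
      refine ⟨g⁻¹ • r, smul_mem_jacobson g⁻¹ hr, Subtype.ext ?_⟩
      change single (1 : G) (r : A) * single g 1 = single g 1 * single 1 (g⁻¹ • (r : A))
      rw [single_mul_single, single_mul_single]
      simp)
    (fun g r hr => by
      let _ := subalgebraAction hB
      refine ⟨g • r, smul_mem_jacobson g hr, Subtype.ext ?_⟩
      change single g 1 * single (1 : G) (r : A) = single 1 (g • (r : A)) * single g 1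
      rw [single_mul_single, single_mul_single]
      simp)

theorem skewSubExt_hom [Fintype G] (hG : (Nat.card G : k) ≠ 0) :
    (skewSubExt hB hG).Hom (skewExt k A G hG) (incl B) (incl (skewSubalgebra B hB)) where
  map_j _ := rfl
  map_c _ := rfl
  map_u _ := rfl
  map_v _ := rfl

end SkewExt

/-! ### Orbits of simple modules and compatibility of the induced order -/

section InducedOrder

theorem finiteDimensional_skew (k A G : Type u) [Field k] [Ring A] [Algebra k A]
    [FiniteDimensional k A] [Finite G] : FiniteDimensional k (SkewMonoidAlgebra A G) :=
  Module.Finite.equiv (SkewMonoidAlgebra.coeffLinearEquiv (k := A) (G := G) (S := k)).symm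

theorem isSummand_iff_exists_ne_zero {R : Type u} [Ring R] (W : ModuleCat.{u} R)
    (hW : IsSemisimpleModule R W) (L : Sim R) :
    IsSummand (R := R) W L.rep ↔ ∃ f : L.rep →ₗ[R] W, f ≠ 0 := by
  constructor
  · rintro ⟨i, p, hpi⟩
    refine ⟨i, fun h => ?_⟩
    have : Nontrivial L.rep := IsSimpleModule.nontrivial R L.rep
    obtain ⟨x, hx⟩ := exists_ne (0 : L.rep)
    rw [h] at hpi
    exact hx ((LinearMap.congr_fun hpi x).symm.trans (map_zero p))
  · rintro ⟨f, hf⟩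
    obtain ⟨p, hp⟩ := IsSemisimpleModule.extension_property f
      (LinearMap.injective_of_ne_zero hf) LinearMap.id
    exact ⟨f, p, hp⟩

variable {k A G : Type u} [Field k] [Ring A] [Group G] [MulSemiringAction G A]

theorem exists_single_smul_ne_zero {N X : Type u} [AddCommGroup N]
    [Module (SkewMonoidAlgebra A G) N] [IsSimpleModule (SkewMonoidAlgebra A G) N]
    [AddCommGroup X] {q : N →+ X} (hq : q ≠ 0) {n : N} (hn : n ≠ 0) :
    ∃ (g : G) (a : A), q (SkewMonoidAlgebra.single g a • n) ≠ 0 := by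
  by_contra! h
  refine hq (AddMonoidHom.ext fun m => ?_)
  obtain ⟨t, rfl⟩ := IsSimpleModule.toSpanSingleton_surjective (SkewMonoidAlgebra A G) hn m
  rw [LinearMap.toSpanSingleton_apply, AddMonoidHom.zero_apply]
  induction t using SkewMonoidAlgebra.induction_on with
  | zero => rw [zero_smul, map_zero]
  | single g a => exact h g a
  | add s t hs ht => rw [add_smul, map_add, hs, ht, add_zero]

/-- The map `gL → L'`, `x ↦ q (g i(x))`. -/
noncomputable def twistMap {N : ModuleCat.{u} (SkewMonoidAlgebra A G)} {L L' : ModuleCat.{u} A}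
    (i : L →ₗ[A] restrict N) (q : restrict N →ₗ[A] L') (g : G) : twist g L →ₗ[A] L' where
  toFun y := q ((SkewMonoidAlgebra.single g (1 : A)) • (i y : N) : N)
  map_add' y z := by
    refine Eq.trans ?_ (q.map_add _ _)
    exact congrArg q ((congrArg (fun n : N => SkewMonoidAlgebra.single g (1 : A) • n)
      (i.map_add y z)).trans (smul_add (SkewMonoidAlgebra.single g (1 : A)) (i y : N) (i z : N)))
  map_smul' a y := by
    refine Eq.trans ?_ (q.map_smul a _)
    refine congrArg q ((congrArg (fun n : N => SkewMonoidAlgebra.single g (1 : A) • n)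
      (i.map_smul (g⁻¹ • a) y)).trans ?_)
    change SkewMonoidAlgebra.single g (1 : A) • SkewMonoidAlgebra.single (1 : G) (g⁻¹ • a) •
      (i y : N) = SkewMonoidAlgebra.single (1 : G) a • SkewMonoidAlgebra.single g (1 : A) • (i y : N)
    rw [smul_smul, smul_smul, SkewMonoidAlgebra.single_mul_single,
      SkewMonoidAlgebra.single_mul_single]
    simp

/-- S is generated over A * G by any nonzero vector of L, so the projection to L' is nonzero on some
translate g a i(x). This gives a nonzero map gL → L' between simple modules. -/
theorem eq_twist_of_isSummand {S : Sim (SkewMonoidAlgebra A G)} {L L' : Sim A}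
    (hL : IsSummand (R := A) (restrict S.rep) L.rep)
    (hL' : IsSummand (R := A) (restrict S.rep) L'.rep) : ∃ g : G, L' = L.twist g := by
  obtain ⟨i, p, hpi⟩ := hL
  obtain ⟨i', q, hqi⟩ := hL'
  have : Nontrivial L.rep := IsSimpleModule.nontrivial A L.rep
  have : Nontrivial L'.rep := IsSimpleModule.nontrivial A L'.rep
  obtain ⟨x, hx⟩ := exists_ne (0 : L.rep)
  obtain ⟨x', hx'⟩ := exists_ne (0 : L'.rep)
  have hix : (show S.rep from i x) ≠ 0 := fun h => hx
    ((LinearMap.congr_fun hpi x).symm.trans ((congrArg p h).trans (map_zero p)))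
  have hq : (show S.rep →+ L'.rep from q.toAddMonoidHom) ≠ 0 := fun h => hx'
    ((LinearMap.congr_fun hqi x').symm.trans (DFunLike.congr_fun h (show S.rep from i' x')))
  obtain ⟨g, a, hga⟩ := exists_single_smul_ne_zero (A := A) (G := G) hq hix
  refine ⟨g, ?_⟩
  obtain ⟨e⟩ := Sim.rep_of (twist g L.rep) (isSimpleModule_twist g L.rep inferInstance)
  refine (Sim.eq_of_ne_zero (L := L.twist g) (twistMap i q g ∘ₗ e.toLinearMap) fun h0 => hga ?_).symm
  -- The vector (g⁻¹ a) x is chosen because (1 ⊗ g)(g⁻¹(a) ⊗ 1) = a ⊗ g.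
  have h1 := LinearMap.congr_fun h0 (e.symm (show twist g L.rep from (g⁻¹ • a) • x))
  have h2 : twistMap i q g (show twist g L.rep from (g⁻¹ • a) • x) = 0 := by
    rw [← e.apply_symm_apply (show twist g L.rep from (g⁻¹ • a) • x)]
    exact h1
  refine Eq.trans (congrArg q ?_) h2
  refine Eq.trans ?_ (congrArg (fun n : S.rep => SkewMonoidAlgebra.single g (1 : A) • n)
      (i.map_smul (g⁻¹ • a) x)).symm
  change SkewMonoidAlgebra.single g a • (show S.rep from i x) = SkewMonoidAlgebra.single g (1 : A) •
    SkewMonoidAlgebra.single (1 : G) (g⁻¹ • a) • (show S.rep from i x)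
  rw [smul_smul, SkewMonoidAlgebra.single_mul_single]
  simp

variable [Algebra k A] [FiniteDimensional k A] [Fintype G] [SMulCommClass G k A]

omit [FiniteDimensional k A] in
theorem rel_iff_isSummand [IsArtinianRing A] [IsArtinianRing (SkewMonoidAlgebra A G)]
    (hG : (Nat.card G : k) ≠ 0) (S : Sim (SkewMonoidAlgebra A G)) (L : Sim A) :
    (skewExt k A G hG).frobPair.Rel S L ↔ IsSummand (R := A) (restrict S.rep) L.rep :=
  (isSummand_iff_exists_ne_zero (restrict S.rep)
    ((skewExt k A G hG).isSemisimpleModule_res S.rep inferInstance) L).symm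

/-- The induced order compares all summands, but these are twists of any one of them, so
equivariance reduces the comparison to a single pair. -/
theorem orderCompat_inducedOrder [IsArtinianRing A] [IsArtinianRing (SkewMonoidAlgebra A G)]
    (hG : (Nat.card G : k) ≠ 0) {le : PartialOrder (Sim A)} (hle : IsEquivariantOrder G le) :
    (skewExt k A G hG).frobPair.OrderCompat (inducedOrder k le) le := by
  intro S L S' L' h h'
  rw [rel_iff_isSummand] at h h'
  refine ⟨fun H => H L L' h h', fun H L₁ L₁' h₁ h₁' => ?_⟩
  obtain ⟨g, rfl⟩ := eq_twist_of_isSummand h h₁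
  obtain ⟨g', rfl⟩ := eq_twist_of_isSummand h' h₁'
  exact (hle L L').1 H g g'

end InducedOrder

/-! ### The dual of the regular module -/

section CoReg

variable (k R : Type u) [Field k] [Ring R] [Algebra k R]

/-- The `k`-dual of the regular right `R`-module. -/
def CoReg : Type u := R →ₗ[k] k

noncomputable instance : AddCommGroup (CoReg k R) := inferInstanceAs (AddCommGroup (R →ₗ[k] k))

variable {k R}

/-- A linear form on `R` as an element of the dual module. -/
noncomputable def CoReg.of : (R →ₗ[k] k) ≃+ CoReg k R := AddEquiv.refl _

/-- An element of the dual module as a linear form. -/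
noncomputable def CoReg.form : CoReg k R ≃+ (R →ₗ[k] k) := AddEquiv.refl _

noncomputable instance : Module R (CoReg k R) where
  smul r f := CoReg.of (f.form ∘ₗ LinearMap.mulRight k r)
  one_smul f := LinearMap.ext fun x => congrArg f.form (mul_one x)
  mul_smul r s f := LinearMap.ext fun x => congrArg f.form (mul_assoc x r s).symm
  smul_zero _ := rfl
  smul_add _ _ _ := rfl
  add_smul r s f := LinearMap.ext fun x =>
    (congrArg f.form (mul_add x r s)).trans (map_add f.form _ _)
  zero_smul f := LinearMap.ext fun x => (congrArg f.form (mul_zero x)).trans (map_zero f.form)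

theorem CoReg.form_smul (r : R) (f : CoReg k R) (x : R) : (r • f).form x = f.form (x * r) := rfl

theorem CoReg.form_algebraMap_smul (c : k) (f : CoReg k R) :
    (algebraMap k R c • f).form = c • f.form := by
  ext x
  rw [form_smul, ← Algebra.commutes, ← Algebra.smul_def, map_smul, LinearMap.smul_apply]

variable {M N : Type u} [AddCommGroup M] [Module R M] [AddCommGroup N] [Module R N]

/-- The homomorphism to the dual module given by a linear form. -/
noncomputable def CoReg.lift (l : N →+ k) (hl : ∀ (c : k) (n : N), l (algebraMap k R c • n) = c * l n) :
    N →ₗ[R] CoReg k R where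
  toFun n := CoReg.of
    { toFun := fun r => l (r • n)
      map_add' := fun r s => by rw [add_smul, map_add]
      map_smul' := fun c r => by
        rw [Algebra.smul_def, mul_smul, hl]
        rfl }
  map_add' m n := LinearMap.ext fun r => by
    change l (r • (m + n)) = l (r • m) + l (r • n)
    rw [smul_add, map_add]
  map_smul' s n := LinearMap.ext fun r => by
    change l (r • s • n) = l ((r * s) • n)
    rw [smul_smul]

/-- Maps to the dual of the regular module correspond to linear forms by evaluation at 1, so
extending them is linear algebra over k. -/
theorem CoReg.form_map_one (f : N →ₗ[R] CoReg k R) (n : N) (r : R) :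
    (f n).form r = (f (r • n)).form 1 := by
  rw [map_smul, CoReg.form_smul, one_mul]

/-- The dual module is injective. -/
theorem CoReg.exists_extend {i : M →ₗ[R] N} (hi : Function.Injective i) (f : M →ₗ[R] CoReg k R) :
    ∃ g : N →ₗ[R] CoReg k R, g ∘ₗ i = f := by
  let _ : Module k M := Module.compHom M (algebraMap k R)
  let _ : Module k N := Module.compHom N (algebraMap k R)
  let i' : M →ₗ[k] N :=
    { toFun := i
      map_add' := map_add i
      map_smul' := fun c m => map_smul i (algebraMap k R c) m }
  let f' : M →ₗ[k] k :=
    { toFun := fun m => (f m).form 1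
      map_add' := fun m m' => by rw [map_add, map_add]; rfl
      map_smul' := fun c m => by
        change (f (algebraMap k R c • m)).form 1 = c * (f m).form 1
        rw [map_smul, CoReg.form_algebraMap_smul]
        rfl }
  obtain ⟨r, hr⟩ := i'.exists_leftInverse_of_injective (LinearMap.ker_eq_bot.2 hi)
  refine ⟨CoReg.lift (f' ∘ₗ r).toAddMonoidHom fun c n => map_smul (f' ∘ₗ r) c n,
    LinearMap.ext fun m => LinearMap.ext fun x => ?_⟩
  change f' (r (x • i m)) = (f m).form x
  rw [← map_smul, CoReg.form_map_one]
  exact congrArg f' (LinearMap.congr_fun hr (x • m))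

theorem CoReg.exists_ne_zero [Nontrivial M] : ∃ f : M →ₗ[R] CoReg k R, f ≠ 0 := by
  let _ : Module k M := Module.compHom M (algebraMap k R)
  obtain ⟨m, hm⟩ := exists_ne (0 : M)
  obtain ⟨l, hl⟩ := Module.Projective.exists_dual_ne_zero k hm
  refine ⟨CoReg.lift l.toAddMonoidHom fun c n => map_smul l c n, fun h => hl ?_⟩
  have h1 : (CoReg.lift (R := R) l.toAddMonoidHom (fun c n => map_smul l c n) m).form 1 = 0 := by
    rw [h]
    rfl
  rw [← one_smul R m]
  exact h1

instance [FiniteDimensional k R] : IsNoetherian R (CoReg k R) := by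
  let _ : Module k (CoReg k R) := inferInstanceAs (Module k (R →ₗ[k] k))
  have : IsScalarTower k R (CoReg k R) := ⟨fun c r f => LinearMap.ext fun x => by
    change f.form (x * c • r) = c • f.form (x * r)
    rw [mul_smul_comm, map_smul]⟩
  have : FiniteDimensional k (CoReg k R) := inferInstanceAs (FiniteDimensional k (R →ₗ[k] k))
  exact isNoetherian_of_tower k inferInstance

end CoReg

/-! ### Extending maps by means of pushouts -/

section Pushout

variable {R : Type u} [Ring R] {W Z N D : Type u} [AddCommGroup W] [Module R W] [AddCommGroup Z]
  [Module R Z] [AddCommGroup N] [Module R N] [AddCommGroup D] [Module R D]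

/-- If every finitely generated extension of `D` by `N` splits, then maps to `N` extend along
monomorphisms with cokernel `D`. -/
theorem exists_extend_of_split [Module.Finite R Z] [Module.Finite R N]
    (h : ∀ (P : ModuleCat.{u} R) (j : N →ₗ[R] P) (q : P →ₗ[R] D), Module.Finite R P →
      Function.Injective j → Function.Surjective q → LinearMap.ker q = LinearMap.range j →
      ∃ r : P →ₗ[R] N, r ∘ₗ j = LinearMap.id)
    {i : W →ₗ[R] Z} (hi : Function.Injective i) {p : Z →ₗ[R] D} (hp : Function.Surjective p)
    (hip : LinearMap.ker p = LinearMap.range i) (g : W →ₗ[R] N) :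
    ∃ g' : Z →ₗ[R] N, g' ∘ₗ i = g := by
  let K : Submodule R (Z × N) := LinearMap.range (i.prod (-g))
  have hpi (w : W) : p (i w) = 0 := by
    have : i w ∈ LinearMap.ker p := hip ▸ LinearMap.mem_range_self i w
    exact this
  let j : N →ₗ[R] ((Z × N) ⧸ K) := K.mkQ ∘ₗ LinearMap.inr R Z N
  let q : ((Z × N) ⧸ K) →ₗ[R] D := K.liftQ (p ∘ₗ LinearMap.fst R Z N) (by
    rintro _ ⟨w, rfl⟩
    exact hpi w)
  obtain ⟨r, hr⟩ := h (ModuleCat.of R ((Z × N) ⧸ K)) j q inferInstance (by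
    rw [injective_iff_map_eq_zero]
    intro n hn
    obtain ⟨w, hw⟩ := (Submodule.Quotient.mk_eq_zero K).1 hn
    have h1 : i w = 0 := congrArg Prod.fst hw
    have h2 : -g w = n := congrArg Prod.snd hw
    rw [(map_eq_zero_iff i hi).1 h1] at h2
    rw [← h2, map_zero, neg_zero]) (fun d => by
    obtain ⟨z, rfl⟩ := hp d
    exact ⟨K.mkQ (z, 0), rfl⟩) (by
    refine le_antisymm (fun x hx => ?_) ?_
    · obtain ⟨⟨z, n⟩, rfl⟩ := K.mkQ_surjective x
      obtain ⟨w, rfl⟩ : z ∈ LinearMap.range i := hip ▸ hx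
      refine ⟨n + g w, ?_⟩
      refine (Submodule.Quotient.eq K).2 ⟨-w, ?_⟩
      ext
      · simp
      · simp
    · rintro _ ⟨n, rfl⟩
      exact map_zero p)
  refine ⟨r ∘ₗ K.mkQ ∘ₗ LinearMap.inl R Z N, LinearMap.ext fun w => ?_⟩
  have h1 : K.mkQ (i w, 0) = j (g w) := (Submodule.Quotient.eq K).2 ⟨w, by ext <;> simp⟩
  exact (congrArg r h1).trans (LinearMap.congr_fun hr (g w))

theorem exists_retraction_of_section {j : N →ₗ[R] Z} {q : Z →ₗ[R] D} {s : D →ₗ[R] Z}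
    (hj : Function.Injective j) (hjq : LinearMap.ker q = LinearMap.range j)
    (hs : q ∘ₗ s = LinearMap.id) : ∃ r : Z →ₗ[R] N, r ∘ₗ j = LinearMap.id := by
  have hex : Function.Exact j q := LinearMap.exact_iff.2 hjq
  have h := (Function.Exact.split_tfae' hex).out 0 1
  exact (h.1 ⟨hj, s, hs⟩).2

end Pushout

/-! ### Costandard modules -/

section Costandard

variable (k : Type u) {R : Type u} [Field k] [Ring R] [Algebra k R] [FiniteDimensional k R]
  [IsArtinianRing R]

include k in
/-- There is a maximal essential extension of `M` among the modules without composition factors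
in `X`. -/
theorem exists_maximal_essential {X : Set (Sim R)} {M : Sim R} (hM : M ∉ X) :
    ∃ (N : ModuleCat.{u} R) (μ : M.rep →ₗ[R] N), Module.Finite R N ∧ Function.Injective μ ∧
      (∀ Y : Submodule R N, Y ≠ ⊥ → LinearMap.range μ ≤ Y) ∧ NoFactor X N ∧
      ∀ (P : ModuleCat.{u} R) (j : N →ₗ[R] P), Function.Injective j → NoFactor X P →
        (∀ Y : Submodule R P, Y ≠ ⊥ → LinearMap.range (j ∘ₗ μ) ≤ Y) → Function.Surjective j := by
  have : Nontrivial M.rep := IsSimpleModule.nontrivial R M.rep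
  obtain ⟨μ₀, hμ₀⟩ := CoReg.exists_ne_zero (k := k) (R := R) (M := M.rep)
  have hinj := LinearMap.injective_of_ne_zero hμ₀
  have hsimple : IsSimpleModule R (LinearMap.range μ₀) :=
    IsSimpleModule.congr (LinearEquiv.ofInjective μ₀ hinj).symm
  have hatom : IsAtom (LinearMap.range μ₀) := isSimpleModule_iff_isAtom.1 hsimple
  -- The search takes place inside the dual of the regular module. That module is injective and
  -- Noetherian, so a maximal essential extension of M exists there, and every larger one embeds by
  -- extending the inclusion.
  obtain ⟨N, ⟨hN1, hN2, hN3⟩, hmax⟩ := wellFounded_gt.has_min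
    {N : Submodule R (CoReg k R) | LinearMap.range μ₀ ≤ N ∧
      (∀ Y ≤ N, Y ≠ ⊥ → LinearMap.range μ₀ ≤ Y) ∧ NoFactor X N}
    ⟨LinearMap.range μ₀, le_rfl, fun Y hY hY0 => ((hatom.le_iff.1 hY).resolve_left hY0).ge,
      (noFactor_rep hM).of_equiv (LinearEquiv.ofInjective μ₀ hinj).symm⟩
  let μ : M.rep →ₗ[R] N := μ₀.codRestrict N fun m => hN1 ⟨m, rfl⟩
  have hμ : N.subtype ∘ₗ μ = μ₀ := rfl
  refine ⟨ModuleCat.of R N, μ, inferInstance, fun x y hxy => hinj (congrArg Subtype.val hxy),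
    fun Y hY => ?_, hN3, fun P j hj hP hY => ?_⟩
  · have := hN2 (Y.map N.subtype) (Submodule.map_subtype_le N Y) fun h => hY
      (Submodule.map_injective_of_injective N.injective_subtype (h.trans (Submodule.map_bot _).symm))
    rw [← hμ, LinearMap.range_comp] at this
    exact (Submodule.map_le_map_iff_of_injective N.injective_subtype _ _).1 this
  · obtain ⟨h, hh⟩ := CoReg.exists_extend hj N.subtype
    have hh' (n : N) : h (j n) = n := LinearMap.congr_fun hh n
    have hhμ : h ∘ₗ j ∘ₗ μ = μ₀ := by rw [← LinearMap.comp_assoc, hh, hμ]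
    have hhinj : Function.Injective h := by
      rw [← LinearMap.ker_eq_bot]
      by_contra hne
      have h1 := hY _ hne
      rw [LinearMap.range_le_ker_iff, hhμ] at h1
      exact hμ₀ h1
    have hle : N ≤ LinearMap.range h := fun n hn => ⟨j ⟨n, hn⟩, hh' ⟨n, hn⟩⟩
    have heq : LinearMap.range h = N := by
      by_contra hne
      refine hmax (LinearMap.range h) ⟨hN1.trans hle, fun Y hYh hY0 => ?_,
        hP.of_surjective h.surjective_rangeRestrict⟩ (lt_of_le_of_ne hle (Ne.symm hne))
      have h1 := hY (Y.comap h) fun h0 => hY0 (by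
        rw [← Submodule.map_comap_eq_of_le hYh, h0, Submodule.map_bot])
      rw [← Submodule.map_le_iff_le_comap, ← LinearMap.range_comp, hhμ] at h1
      exact h1
    intro p
    have hp : h p ∈ N := heq ▸ LinearMap.mem_range_self h p
    exact ⟨⟨h p, hp⟩, hhinj (hh' ⟨h p, hp⟩)⟩

include k in
/-- The costandard module with socle `M`, and its orthogonality to standard modules. -/
theorem IsAdapted.exists_costandard {le : PartialOrder (Sim R)} (hle : IsAdapted le) (M : Sim R) :
    ∃ (N : ModuleCat.{u} R) (μ : M.rep →ₗ[R] N), Module.Finite R N ∧ Function.Injective μ ∧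
      (∀ Y : Submodule R N, Y ≠ ⊥ → LinearMap.range μ ≤ Y) ∧ NoFactor {L | ¬ le.le L M} N ∧
      ∀ (M' : Sim R) (D W Z : ModuleCat.{u} R), IsStandard le M' D → Module.Finite R Z →
        ∀ (i : W →ₗ[R] Z) (p : Z →ₗ[R] D), Function.Injective i → Function.Surjective p →
          LinearMap.ker p = LinearMap.range i → ∀ g : W →ₗ[R] N,
            ∃ g' : Z →ₗ[R] N, g' ∘ₗ i = g := by
  obtain ⟨N, μ, hfin, hμ, hess, hN, hmax⟩ := exists_maximal_essential k
    (X := {L | ¬ le.le L M}) (M := M) fun h => h (le.le_refl M)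
  refine ⟨N, μ, hfin, hμ, hess, hN, fun M' D W Z hD hZ i p hi hp hip g =>
    exists_extend_of_split (fun P j q hP hj hq hjq => ?_) hi hp hip g⟩
  -- Case M' ≤ M: all factors of P are ≤ M. For X maximal with X ∩ N = 0, the quotient P / X is an
  -- essential extension of N, hence equals N by maximality, and P → P / X is the retraction.
  by_cases hM' : le.le M' M
  · have hD' : NoFactor {L | ¬ le.le L M} D :=
      (QHSkew.isStandard_iff.1 hD).2.1.mono fun L hL h => hL (le.le_trans _ _ _ h hM')
    have hPX : NoFactor {L | ¬ le.le L M} P := NoFactor.of_exact hjq.le hN hD'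
    have := isNoetherian_of_isNoetherianRing_of_finite R P
    obtain ⟨X, hX, hXmax⟩ := wellFounded_gt.has_min
      {X : Submodule R P | X ⊓ LinearMap.range j = ⊥} ⟨⊥, bot_inf_eq _⟩
    let j' : N →ₗ[R] (P ⧸ X) := X.mkQ ∘ₗ j
    have hj' : Function.Injective j' := by
      rw [injective_iff_map_eq_zero]
      intro n hn
      have h1 : j n ∈ X ⊓ LinearMap.range j := ⟨(Submodule.Quotient.mk_eq_zero X).1 hn, n, rfl⟩
      rw [hX] at h1
      exact (map_eq_zero_iff j hj).1 h1
    have hs : Function.Surjective j' := by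
      refine hmax (ModuleCat.of R (P ⧸ X)) j' hj' (hPX.of_surjective X.mkQ_surjective)
        fun Y hY => ?_
      have hlt : X < Y.comap X.mkQ := by
        refine lt_of_le_of_ne (fun x hx => ?_) fun he => hY ?_
        · change X.mkQ x ∈ Y
          exact (congrArg (· ∈ Y) ((Submodule.Quotient.mk_eq_zero X).2 hx)).mpr Y.zero_mem
        · rw [← Submodule.map_comap_eq_of_surjective X.mkQ_surjective Y, ← he,
            Submodule.mkQ_map_self]
      have hne : Y.comap X.mkQ ⊓ LinearMap.range j ≠ ⊥ := fun h => hXmax _ h hlt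
      have h2 := hess (Y.comap j') fun h0 => hne (by
        refine (Submodule.eq_bot_iff _).2 ?_
        rintro _ ⟨hy, n, rfl⟩
        have : n ∈ Y.comap j' := hy
        rw [h0, Submodule.mem_bot] at this
        rw [this, map_zero])
      rwa [← Submodule.map_le_iff_le_comap, ← LinearMap.range_comp] at h2
    let e := LinearEquiv.ofBijective j' ⟨hj', hs⟩
    exact ⟨e.symm.toLinearMap ∘ₗ X.mkQ, LinearMap.ext fun n => e.symm_apply_apply n⟩
  -- Case M' ≰ M: a factor of N above M' would be ≤ M and force M' ≤ M. So N and D have no factors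
  -- above M', and relative projectivity of D splits q.
  · obtain ⟨-, hD1, hD2⟩ := hle.isStandard_iff.1 hD
    have hN' : NoFactor {L | le.lt M' L} N := hN.mono fun L hL h =>
      hM' (le.le_trans _ _ _ (le_of_lt hL) h)
    obtain ⟨s, hs⟩ := hD2.lift hq (NoFactor.of_exact hjq.le hN' hD1) LinearMap.id
    exact exists_retraction_of_section hj hjq hs

end Costandard

/-! ### Exact Borel subalgebras are normal -/

theorem exists_factor {R : Type u} [Ring R] {M N K : Type u} [AddCommGroup M] [Module R M]
    [AddCommGroup N] [Module R N] [AddCommGroup K] [Module R K] {q : M →ₗ[R] N}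
    (hq : Function.Surjective q) {f : M →ₗ[R] K} (h : LinearMap.ker q ≤ LinearMap.ker f) :
    ∃ t : N →ₗ[R] K, ∀ m, t (q m) = f m := by
  refine ⟨(LinearMap.ker q).liftQ f h ∘ₗ (q.quotKerEquivOfSurjective hq).symm.toLinearMap,
    fun m => ?_⟩
  have : (q.quotKerEquivOfSurjective hq).symm (q m) = Submodule.Quotient.mk m :=
    (LinearEquiv.symm_apply_eq _).2 rfl
  rw [LinearMap.comp_apply, LinearEquiv.coe_coe, this]
  exact Submodule.liftQ_apply _ f m

section Restriction

variable {S R : Type u} [Ring S] [Ring R] (φ : S →+* R)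

/-- Maps to the restriction of `N` extend along monomorphisms with simple cokernel. -/
def IsResInjective (N : ModuleCat.{u} R) : Prop :=
  ∀ (Z : ModuleCat.{u} S), Module.Finite S Z → ∀ (L : Sim S) (q : Z →ₗ[S] L.rep),
    Function.Surjective q → ∀ g : LinearMap.ker q →ₗ[S] (ModuleCat.restrictScalars.{u} φ).obj N,
      ∃ g' : Z →ₗ[S] (ModuleCat.restrictScalars.{u} φ).obj N,
        g' ∘ₗ (LinearMap.ker q).subtype = g

theorem IsResInjective.prod {N N' : ModuleCat.{u} R} (h : IsResInjective φ N)
    (h' : IsResInjective φ N') : IsResInjective φ (ModuleCat.of R (N × N')) := by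
  intro Z hZ L q hq g
  let g₁ : LinearMap.ker q →ₗ[S] (ModuleCat.restrictScalars.{u} φ).obj N :=
    { toFun := fun z => (show N × N' from g z).1
      map_add' := fun x y => congrArg Prod.fst (g.map_add x y)
      map_smul' := fun s x => congrArg Prod.fst (g.map_smul s x) }
  let g₂ : LinearMap.ker q →ₗ[S] (ModuleCat.restrictScalars.{u} φ).obj N' :=
    { toFun := fun z => (show N × N' from g z).2
      map_add' := fun x y => congrArg Prod.snd (g.map_add x y)
      map_smul' := fun s x => congrArg Prod.snd (g.map_smul s x) }
  obtain ⟨f₁, hf₁⟩ := h Z hZ L q hq g₁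
  obtain ⟨f₂, hf₂⟩ := h' Z hZ L q hq g₂
  refine ⟨{ toFun := fun z => (show N × N' from (f₁ z, f₂ z))
            map_add' := fun x y => Prod.ext (f₁.map_add x y) (f₂.map_add x y)
            map_smul' := fun s x => Prod.ext (f₁.map_smul s x) (f₂.map_smul s x) }, ?_⟩
  exact LinearMap.ext fun z => Prod.ext (LinearMap.congr_fun hf₁ z) (LinearMap.congr_fun hf₂ z)

theorem IsRightProjective.ker_tensorMap {φ : S →+* R} (hφ : IsRightProjective φ) {Z Y : ModuleCat.{u} S}
    {q : Z →ₗ[S] Y} (hq : Function.Surjective q) :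
    Function.Injective (tensorMap (f := φ) (LinearMap.ker q).subtype) ∧
    Function.Surjective (tensorMap (f := φ) q) ∧
    LinearMap.ker (tensorMap (f := φ) q) =
      LinearMap.range (tensorMap (f := φ) (LinearMap.ker q).subtype) := by
  have := (induction_exact hφ).1
  have := (induction_exact hφ).2
  have hS := (LinearMap.shortExact_shortComplexKer hq).map_of_exact (induction φ)
  refine ⟨tensorMap_injective hφ _ (Submodule.injective_subtype _), ?_,
    LinearMap.exact_iff.1 ((ShortComplex.ShortExact.moduleCat_exact_iff_function_exact _).1 hS.exact)⟩
  exact hS.moduleCat_surjective_g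

variable {k : Type u} [Field k] [Algebra k R] [FiniteDimensional k R] [IsArtinianRing R]
  [IsArtinianRing S] [IsAlgClosed k] [Algebra k S]

/-- N is the costandard module with socle i(L). Extending maps into its restriction is, by
adjunction, extending maps into N along a monomorphism whose cokernel is standard. Essentiality of L
uses that End(Δ) = k. -/
theorem IsQuasiHereditary.exists_resInjective {le : PartialOrder (Sim R)}
    (hR : IsQuasiHereditary k le) (hk : ∀ c, φ (algebraMap k S c) = algebraMap k R c)
    (hφ : IsRightProjective φ) (i : Sim S ≃ Sim R)
    (hi : ∀ L : Sim S, IsStandard le (i L) ((induction φ).obj L.rep)) (L : Sim S) :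
    ∃ (N : ModuleCat.{u} R) (ι : L.rep →ₗ[S] (ModuleCat.restrictScalars.{u} φ).obj N),
      Function.Injective ι ∧ IsResInjective φ N ∧
      ∀ X : Submodule S ((ModuleCat.restrictScalars.{u} φ).obj N), X ≠ ⊥ →
        LinearMap.range ι ≤ X := by
  obtain ⟨N, μ, hfin, hμ, hess, hN, hext⟩ := hR.adapted.exists_costandard (k := k) (i L)
  obtain ⟨⟨τ, hτ⟩, hX, -⟩ := hR.adapted.isStandard_iff.1 (hi L)
  have : Nontrivial (i L).rep := IsSimpleModule.nontrivial R _
  have hμτ : μ ∘ₗ τ ≠ 0 := fun h => by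
    obtain ⟨x, hx⟩ := exists_ne (0 : (i L).rep)
    obtain ⟨y, rfl⟩ := hτ.surjective x
    exact hx (hμ ((LinearMap.congr_fun h y).trans (map_zero μ).symm))
  let ι := tensorUnlift φ (M := L.rep) (N := N) (μ ∘ₗ τ)
  have hι0 : ι ≠ 0 := fun h => hμτ (tensorOver_linearMap_ext fun m => LinearMap.congr_fun h m)
  refine ⟨N, ι, LinearMap.injective_of_ne_zero hι0, fun Z hZ L' q hq g => ?_, fun X hX0 => ?_⟩
  · obtain ⟨h1, h2, h3⟩ := hφ.ker_tensorMap hq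
    have := finite_tensorOver φ Z
    obtain ⟨g', hg'⟩ := hext (i L') ((induction φ).obj L'.rep)
      ((induction φ).obj (ModuleCat.of S (LinearMap.ker q))) ((induction φ).obj Z) (hi L') this
      (tensorMap (LinearMap.ker q).subtype) (tensorMap q) h1 h2 h3
      (tensorExtend φ (M := ModuleCat.of S (LinearMap.ker q)) (N := N) g)
    refine ⟨tensorUnlift φ (M := Z) (N := N) g', LinearMap.ext fun z => ?_⟩
    have h4 := LinearMap.congr_fun hg' (tensorMk φ 1 z)
    refine Eq.trans (congrArg g' (tensorMap_mk (LinearMap.ker q).subtype 1 z).symm) (h4.trans ?_)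
    exact tensorExtend_mk φ (M := ModuleCat.of S (LinearMap.ker q)) (N := N) g z
  -- A simple L' in X gives a nonzero map F from the standard module at i(L') to N. Its image has
  -- top i(L') and contains the socle i(L), so each is ≤ the other and L' = L. As i(L) occurs only
  -- once, the image of F is the socle itself; by Schur's lemma the embedding of L' is a scalar
  -- multiple of ι.
  · have : Nontrivial X := Submodule.nontrivial_iff_ne_bot.2 hX0
    obtain ⟨L', j, hj⟩ := exists_isSub (R := S) (M := X)
    let f : L'.rep →ₗ[S] (ModuleCat.restrictScalars.{u} φ).obj N := X.subtype ∘ₗ j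
    have hfX : LinearMap.range f ≤ X := by
      rintro _ ⟨x, rfl⟩
      exact (j x).2
    let F : TensorOver φ L'.rep →ₗ[R] N := tensorExtend φ (M := L'.rep) (N := N) f
    have hF (x : L'.rep) : F (tensorMk φ 1 x) = f x := tensorExtend_mk φ f x
    have hF0 : F ≠ 0 := fun h => by
      have : Nontrivial L'.rep := IsSimpleModule.nontrivial S _
      obtain ⟨x, hx⟩ := exists_ne (0 : L'.rep)
      refine hx (hj (Subtype.ext ?_))
      refine (hF x).symm.trans ?_
      rw [h, map_zero]
      rfl
    have hFr : LinearMap.range F ≠ ⊥ := fun h => hF0 (LinearMap.range_eq_bot.1 h)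
    have hμF := hess _ hFr
    have : Nontrivial (LinearMap.range F) := Submodule.nontrivial_iff_ne_bot.2 hFr
    obtain ⟨hT', hX', -⟩ := hR.adapted.isStandard_iff.1 (hi L')
    have hTF : HasTop (LinearMap.range F) (i L') := hT'.of_surjective F.surjective_rangeRestrict
    have hle1 : le.le (i L') (i L) := by
      by_contra h
      exact hN (i L') h (cf_of_injective (LinearMap.range F).injective_subtype
        (cf_of_isQuot hTF.isQuot))
    let μ' : (i L).rep →ₗ[R] LinearMap.range F :=
      μ.codRestrict (LinearMap.range F) fun x => hμF ⟨x, rfl⟩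
    have hμ' : Function.Injective μ' := fun x y hxy => hμ (congrArg Subtype.val hxy)
    have hcf : IsCompositionFactor (R := R) (TensorOver φ L'.rep) (i L) :=
      cf_of_surjective F.surjective_rangeRestrict (cf_of_injective hμ'
        (cf_of_isQuot ⟨LinearMap.id, fun h => by
          obtain ⟨x, hx⟩ := exists_ne (0 : (i L).rep)
          exact hx (LinearMap.congr_fun h x)⟩))
    have hle2 : le.le (i L) (i L') := hR.adapted.le_of_cf hT' hX' hcf
    obtain rfl : L' = L := i.injective (le.le_antisymm _ _ hle1 hle2)
    have htop : LinearMap.range μ' = ⊤ := by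
      refine hR.eq_top_of_ne_zero hTF (hX'.of_surjective F.surjective_rangeRestrict)
        (q := (LinearEquiv.ofInjective μ' hμ').symm.toLinearMap) fun h => ?_
      obtain ⟨x, hx⟩ := exists_ne (0 : (i L').rep)
      refine hx ?_
      have := LinearMap.congr_fun h (LinearEquiv.ofInjective μ' hμ' x)
      simpa using this
    have hbij : Function.Bijective μ' := ⟨hμ', LinearMap.range_eq_top.1 htop⟩
    let e := LinearEquiv.ofBijective μ' hbij
    let σ : TensorOver φ L'.rep →ₗ[R] (i L').rep := e.symm.toLinearMap ∘ₗ F.rangeRestrict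
    have hσ (x) : μ (σ x) = F x :=
      congrArg Subtype.val (e.apply_symm_apply (F.rangeRestrict x))
    obtain ⟨θ, hθ⟩ := exists_factor hτ.surjective (HasTop.ker_le_of_isSemisimple hτ σ)
    obtain ⟨c, hc⟩ := exists_algebraMap_smul (k := k) θ
    have hfι (x : L'.rep) : f x = ι (algebraMap k S c • x) := by
      have h1 : μ (σ (tensorMk φ 1 x)) = algebraMap k R c • μ (τ (tensorMk φ 1 x)) :=
        (congrArg μ ((hθ _).symm.trans (hc _))).trans (map_smul μ _ _)
      refine (hF x).symm.trans ((hσ _).symm.trans (h1.trans (Eq.trans ?_ (ι.map_smul _ x).symm)))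
      exact (congrArg (· • μ (τ (tensorMk φ 1 x))) (hk c)).symm
    have hc0 : c ≠ 0 := by
      rintro rfl
      refine hF0 (tensorOver_linearMap_ext fun x => (hF x).trans ((hfι x).trans ?_))
      rw [map_zero, zero_smul, map_zero]
      rfl
    refine le_trans ?_ hfX
    rintro _ ⟨x, rfl⟩
    refine ⟨algebraMap k S c⁻¹ • x, ?_⟩
    rw [hfι, smul_smul, ← map_mul, mul_inv_cancel₀ hc0, map_one, one_smul]

variable {φ}

/-- There is an `R`-module whose restriction to `S` is the dual of the regular module. -/
theorem IsQuasiHereditary.exists_equiv_coReg [FiniteDimensional k S] {le : PartialOrder (Sim R)}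
    (hR : IsQuasiHereditary k le) (hk : ∀ c, φ (algebraMap k S c) = algebraMap k R c)
    (hφ : IsRightProjective φ) (i : Sim S ≃ Sim R)
    (hi : ∀ L : Sim S, IsStandard le (i L) ((induction φ).obj L.rep)) :
    ∃ N : ModuleCat.{u} R,
      Nonempty ((ModuleCat.restrictScalars.{u} φ).obj N ≃ₗ[S] CoReg k S) := by
  -- Take a maximal submodule of the dual among those realised as restrictions of R-modules with the
  -- extension property. If it were proper, a further restricted costandard module could be added as
  -- a direct summand.
  obtain ⟨E, ⟨N, Φ, hΦ, rfl, hN⟩, hmax⟩ := wellFounded_gt.has_min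
    {E : Submodule S (CoReg k S) | ∃ (N : ModuleCat.{u} R)
      (Φ : (ModuleCat.restrictScalars.{u} φ).obj N →ₗ[S] CoReg k S), Function.Injective Φ ∧
        LinearMap.range Φ = E ∧ IsResInjective φ N}
    ⟨⊥, ModuleCat.of R PUnit, 0, fun _ _ _ => rfl, LinearMap.range_zero,
      fun Z hZ L q hq g => ⟨0, LinearMap.ext fun _ => rfl⟩⟩
  refine ⟨N, ⟨LinearEquiv.ofBijective Φ ⟨hΦ, LinearMap.range_eq_top.1 ?_⟩⟩⟩
  by_contra hne
  set E := LinearMap.range Φ with hE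
  have : Nontrivial (CoReg k S ⧸ E) := Submodule.Quotient.nontrivial_iff.2 hne
  obtain ⟨L, s, hs⟩ := exists_isSub (R := S) (M := CoReg k S ⧸ E)
  have : Nontrivial L.rep := IsSimpleModule.nontrivial S _
  let Y : Submodule S (CoReg k S) := (LinearMap.range s).comap E.mkQ
  let es := LinearEquiv.ofInjective s hs
  let q : Y →ₗ[S] L.rep := es.symm.toLinearMap ∘ₗ E.mkQ.restrict (p := Y) (q := LinearMap.range s)
    fun x hx => hx
  have hsq (y : Y) : s (q y) = E.mkQ y :=
    congrArg Subtype.val (es.apply_symm_apply ⟨E.mkQ y, y.2⟩)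
  have hq : Function.Surjective q := fun l => by
    obtain ⟨y, hy⟩ := E.mkQ_surjective (s l)
    refine ⟨⟨y, l, hy.symm⟩, hs ?_⟩
    rw [hsq, hy]
  have hq0 (y : Y) : q y = 0 ↔ (y : CoReg k S) ∈ E := by
    rw [← map_eq_zero_iff s hs, hsq, Submodule.mkQ_apply, Submodule.Quotient.mk_eq_zero]
  let eΦ := LinearEquiv.ofInjective Φ hΦ
  let g : LinearMap.ker q →ₗ[S] (ModuleCat.restrictScalars.{u} φ).obj N :=
    eΦ.symm.toLinearMap ∘ₗ (Y.subtype.restrict (p := LinearMap.ker q) (q := E)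
      fun y hy => (hq0 y).1 hy)
  have hg (y : LinearMap.ker q) : Φ (g y) = (y : Y) :=
    congrArg Subtype.val (eΦ.apply_symm_apply ⟨((y : Y) : CoReg k S), (hq0 y).1 y.2⟩)
  obtain ⟨g', hg'⟩ := hN (ModuleCat.of S Y) inferInstance L q hq g
  -- Y is an extension of L by E. Extending the identity of E to Y splits it, and the difference
  -- with the inclusion descends to an embedding t of L which meets E in zero.
  obtain ⟨t, ht⟩ := exists_factor hq (f := Y.subtype - Φ ∘ₗ g') fun y hy => by
    have h1 : g' y = g ⟨y, hy⟩ := LinearMap.congr_fun hg' ⟨y, hy⟩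
    rw [LinearMap.mem_ker, LinearMap.sub_apply, LinearMap.comp_apply, h1, hg]
    exact sub_self _
  have htE (l : L.rep) (hl : t l ∈ E) : l = 0 := by
    obtain ⟨y, rfl⟩ := hq l
    rw [ht] at hl
    refine (hq0 y).2 ?_
    have := E.add_mem hl (LinearMap.mem_range_self Φ (g' y))
    rwa [LinearMap.sub_apply, LinearMap.comp_apply, sub_add_cancel] at this
  obtain ⟨N', ι, hι, hN', hess⟩ := hR.exists_resInjective φ hk hφ i hi L
  obtain ⟨h, hh⟩ := CoReg.exists_extend hι t
  -- A nonzero preimage of E would contain ι(L) by essentiality, contradicting t(L) ∩ E = 0. So N ×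
  -- N' embeds as a strictly larger submodule.
  have hhE : E.comap h = ⊥ := by
    by_contra hne
    obtain ⟨l, hl⟩ := exists_ne (0 : L.rep)
    refine hl (htE l ?_)
    rw [← hh]
    exact hess _ hne ⟨l, rfl⟩
  let Ψ : (ModuleCat.restrictScalars.{u} φ).obj (ModuleCat.of R (N × N')) →ₗ[S] CoReg k S :=
    { toFun := fun x => Φ (show N × N' from x).1 + h (show N × N' from x).2
      map_add' := fun x y => by
        refine (congrArg₂ (· + ·) (Φ.map_add (show N × N' from x).1 (show N × N' from y).1)
          (h.map_add (show N × N' from x).2 (show N × N' from y).2)).trans ?_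
        exact add_add_add_comm _ _ _ _
      map_smul' := fun s x => by
        refine (congrArg₂ (· + ·) (Φ.map_smul s (show N × N' from x).1)
          (h.map_smul s (show N × N' from x).2)).trans ?_
        exact (smul_add s _ _).symm }
  have hΨ (x : N) (y : N') : Ψ (show N × N' from (x, y)) = Φ x + h y := rfl
  have hΨinj : Function.Injective Ψ := by
    rw [injective_iff_map_eq_zero]
    rintro ⟨x, y⟩ hxy
    have hxy' : Φ x + h y = 0 := hxy
    have hy : y ∈ E.comap h := by
      change h y ∈ E
      rw [eq_neg_of_add_eq_zero_right hxy']
      exact E.neg_mem ⟨x, rfl⟩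
    obtain rfl : y = 0 := (congrArg (y ∈ ·) hhE).mp hy
    have hx : Φ x = 0 := (add_zero _).symm.trans
      ((congrArg (Φ x + ·) (map_zero h)).symm.trans hxy')
    obtain rfl : x = 0 := (map_eq_zero_iff Φ hΦ).1 hx
    rfl
  refine hmax (LinearMap.range Ψ) ⟨_, Ψ, hΨinj, rfl, hN.prod φ hN'⟩ (lt_of_le_of_ne ?_ ?_)
  · rintro _ ⟨x, rfl⟩
    refine ⟨(show N × N' from (x, 0)), ?_⟩
    refine (hΨ _ _).trans ?_
    exact (congrArg (Φ x + ·) (map_zero h)).trans (add_zero _)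
  · intro heq
    obtain ⟨l, hl⟩ := exists_ne (0 : L.rep)
    refine hl (htE l ?_)
    rw [heq, ← hh]
    refine ⟨(show N × N' from (0, ι l)), ?_⟩
    refine (hΨ _ _).trans ?_
    exact (congrArg (· + h (ι l)) (map_zero Φ)).trans (zero_add _)

end Restriction

/-- Exact Borel subalgebras are normal. -/
theorem IsExactBorel.exists_splitting {k A : Type u} [Field k] [IsAlgClosed k] [Ring A]
    [Algebra k A] [FiniteDimensional k A] {leA : PartialOrder (Sim A)} {B : Subalgebra k A}
    {leB : PartialOrder (Sim B)} (h : IsExactBorel leA B leB) :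
    ∃ π : A →+ B, (∀ b : B, π b = b) ∧ (∀ (a : A) (b : B), π (a * b) = π a * b) ∧
      ∀ a x : A, π a = 0 → π (a * x) = 0 := by
  have : IsArtinianRing A := IsArtinianRing.of_finite k A
  have : IsArtinianRing B := IsArtinianRing.of_finite k B
  obtain ⟨i, -, hi⟩ := h.standard
  obtain ⟨N, ⟨Φ⟩⟩ := h.quasiHereditary.exists_equiv_coReg (S := B) (φ := incl B) (fun _ => rfl)
    h.projective i hi
  -- The action of A on the dual of B, transported from N; it extends the given action of B.
  let P (a : A) (f : CoReg k B) : CoReg k B :=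
    Φ (show N from a • (show N from Φ.symm f))
  have P_add (a : A) (f g : CoReg k B) : P a (f + g) = P a f + P a g := by
    refine Eq.trans (congrArg (fun n : N => Φ (a • n)) (map_add Φ.symm f g)) ?_
    exact (congrArg Φ (smul_add a (show N from Φ.symm f) (show N from Φ.symm g))).trans
      (map_add Φ _ _)
  have add_P (a a' : A) (f : CoReg k B) : P (a + a') f = P a f + P a' f :=
    (congrArg Φ (add_smul a a' (show N from Φ.symm f))).trans (map_add Φ _ _)
  have P_coe (b : B) (f : CoReg k B) : P b f = b • f :=
    (map_smul Φ b (Φ.symm f)).trans (congrArg (b • ·) (Φ.apply_symm_apply f))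
  have P_mul (a a' : A) (f : CoReg k B) : P (a * a') f = P a (P a' f) := by
    refine (congrArg Φ (mul_smul a a' (show N from Φ.symm f))).trans ?_
    exact (congrArg (fun n : N => Φ (a • n))
      (Φ.symm_apply_apply (a' • (show N from Φ.symm f) : N))).symm
  have P_smul (a : A) (c : k) (f : CoReg k B) :
      P a (algebraMap k B c • f) = algebraMap k B c • P a f := by
    rw [← P_coe, ← P_coe, ← P_mul, ← P_mul]
    exact congrArg (P · f) (Algebra.commutes c a).symm
  -- The element π a is determined, via the double dual, by f(π a) = (a f)(1) for all linear forms
  -- f. Right B-linearity and the right ideal condition follow from P (a * x) f = P a (P x f).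
  let T (a : A) : Module.Dual k (Module.Dual k B) :=
    { toFun := fun f => (P a (CoReg.of f)).form 1
      map_add' := fun f g => by
        rw [map_add CoReg.of, P_add, map_add, LinearMap.add_apply]
      map_smul' := fun c f => by
        have : CoReg.of (c • f) = algebraMap k B c • CoReg.of f :=
          (CoReg.form_algebraMap_smul c (CoReg.of f)).symm
        rw [this, P_smul, CoReg.form_algebraMap_smul]
        rfl }
  let π (a : A) : B := (Module.evalEquiv k B).symm (T a)
  have hπ (a : A) (f : Module.Dual k B) : f (π a) = (P a (CoReg.of f)).form 1 :=
    Module.apply_evalEquiv_symm_apply k B f (T a)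
  have ext {b b' : B} (h : ∀ f : Module.Dual k B, f b = f b') : b = b' := by
    rw [← sub_eq_zero, ← Module.forall_dual_apply_eq_zero_iff k]
    intro f
    rw [map_sub, h, sub_self]
  refine ⟨AddMonoidHom.mk' π fun a a' => ext fun f => ?_, fun b => ext fun f => ?_,
    fun a b => ext fun f => ?_, fun a x ha => ext fun f => ?_⟩
  · rw [hπ, add_P, map_add, map_add, hπ, hπ, LinearMap.add_apply]
  · change f (π b) = f b
    rw [hπ, P_coe, CoReg.form_smul, one_mul]
    rfl
  · change f (π (a * b)) = f (π a * b)
    rw [hπ, P_mul, P_coe]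
    exact (hπ a (CoReg.form (b • CoReg.of f))).symm
  · change f (π (a * x)) = f 0
    have ha' : π a = 0 := ha
    rw [hπ, P_mul, ← ha']
    exact (hπ a (CoReg.form (P x (CoReg.of f)))).symm.trans (by rw [ha', map_zero, map_zero])

/-! ### Lifting of separable subalgebras -/

section Separable

variable (k : Type*) [Field k]

/-- A separability element of an algebra `Q`, written as `∑ x i ⊗ y i`. -/
structure SepElement (Q : Type*) [Ring Q] [Algebra k Q] (ι : Type*) [Fintype ι] where
  x : ι → Q
  y : ι → Q
  sum_mul : ∑ i, x i * y i = 1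
  casimir : ∀ z, ∑ i, (z * x i) ⊗ₜ[k] y i = ∑ i, x i ⊗ₜ[k] (y i * z)

variable {k}

theorem SepElement.sum_eq {Q : Type*} [Ring Q] [Algebra k Q] {ι : Type*} [Fintype ι]
    (σ : SepElement k Q ι) {M : Type*} [AddCommGroup M] [Module k M] (F : Q →ₗ[k] Q →ₗ[k] M)
    (z : Q) : ∑ i, F (z * σ.x i) (σ.y i) = ∑ i, F (σ.x i) (σ.y i * z) := by
  simpa using congrArg (TensorProduct.lift F) (σ.casimir z)

/-- Transport of a separability element along an isomorphism. -/
def SepElement.map {Q Q' : Type*} [Ring Q] [Algebra k Q] [Ring Q'] [Algebra k Q'] {ι : Type*}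
    [Fintype ι] (σ : SepElement k Q ι) (e : Q ≃ₐ[k] Q') : SepElement k Q' ι where
  x i := e (σ.x i)
  y i := e (σ.y i)
  sum_mul := by simp only [← map_mul, ← map_sum, σ.sum_mul, map_one]
  casimir z := by
    have := congrArg (TensorProduct.map e.toLinearMap e.toLinearMap) (σ.casimir (e.symm z))
    simpa using this

theorem sum_pi_single {I β : Type*} [DecidableEq I] [Fintype β] {N : I → Type*}
    [∀ i, AddCommMonoid (N i)] (i : I) (f : β → N i) :
    ∑ b, Pi.single i (f b) = Pi.single i (∑ b, f b) :=
  (map_sum (AddMonoidHom.single N i) f Finset.univ).symm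

open Matrix in
/-- A product of matrix algebras has a separability element. -/
def sepElementPiMatrix {n : ℕ} (d : Fin n → ℕ) [∀ i, NeZero (d i)] :
    SepElement k (∀ i, Matrix (Fin (d i)) (Fin (d i)) k) (Σ i, Fin (d i)) where
  x i := Pi.single i.1 (single i.2 0 1)
  y i := Pi.single i.1 (single 0 i.2 1)
  sum_mul := by
    rw [Fintype.sum_sigma]
    simp only [← Pi.single_mul, single_mul_single_same, mul_one, sum_pi_single]
    refine (Finset.sum_congr rfl fun i _ => congrArg (Pi.single i) sum_single_one).trans ?_
    exact Finset.univ_sum_single (1 : ∀ i, Matrix (Fin (d i)) (Fin (d i)) k)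
  casimir z := by
    have h1 (i : Fin n) (a : Fin (d i)) : z * Pi.single i (single a 0 1) =
        ∑ b, z i b a • (Pi.single i (single b 0 1) : ∀ i, Matrix (Fin (d i)) (Fin (d i)) k) := by
      rw [← Pi.single_mul_right]
      simp only [← Pi.single_smul, sum_pi_single]
      refine congrArg (Pi.single i) (Matrix.ext fun b c => ?_)
      by_cases hc : c = 0
      · subst hc
        simp [Matrix.sum_apply, single_apply]
      · simp [Matrix.sum_apply, hc, Ne.symm hc]
    have h2 (i : Fin n) (a : Fin (d i)) : Pi.single i (single 0 a 1) * z =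
        ∑ b, z i a b • (Pi.single i (single 0 b 1) : ∀ i, Matrix (Fin (d i)) (Fin (d i)) k) := by
      rw [← Pi.single_mul_left]
      simp only [← Pi.single_smul, sum_pi_single]
      refine congrArg (Pi.single i) (Matrix.ext fun b c => ?_)
      by_cases hc : b = 0
      · subst hc
        simp [Matrix.sum_apply, single_apply]
      · simp [Matrix.sum_apply, hc, Ne.symm hc]
    rw [Fintype.sum_sigma, Fintype.sum_sigma]
    refine Finset.sum_congr rfl fun i _ => ?_
    simp only [h1, h2, TensorProduct.sum_tmul, TensorProduct.tmul_sum, TensorProduct.smul_tmul,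
      TensorProduct.tmul_smul]
    exact Finset.sum_comm

/-- A finite-dimensional semisimple algebra over an algebraically closed field is separable. -/
theorem exists_sepElement [IsAlgClosed k] (Q : Type*) [Ring Q] [Algebra k Q]
    [FiniteDimensional k Q] [IsSemisimpleRing Q] :
    ∃ (ι : Type) (_ : Fintype ι), Nonempty (SepElement k Q ι) := by
  obtain ⟨n, d, hd, ⟨e⟩⟩ := IsSemisimpleRing.exists_algEquiv_pi_matrix_of_isAlgClosed k Q
  exact ⟨_, _, ⟨(sepElementPiMatrix d).map e.symm⟩⟩

variable {D Q : Type*} [Ring D] [Algebra k D] [Ring Q] [Algebra k Q] {ι : Type*} [Fintype ι]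

theorem isNilpotent_of_mem {I : Ideal D} (hI : IsNilpotent I) {a : D} (ha : a ∈ I) :
    IsNilpotent a := by
  obtain ⟨n, hn⟩ := hI
  exact ⟨n, by simpa [hn] using Ideal.pow_mem_pow ha n⟩

theorem eq_zero_of_isIdempotentElem_of_isNilpotent {a : D} (h : IsIdempotentElem a)
    (ha : IsNilpotent a) : a = 0 := by
  obtain ⟨n, hn⟩ := ha
  rw [← h.pow_succ_eq n, pow_succ, hn, zero_mul]

theorem pow_comap_le {D' : Type*} [Ring D'] (f : D' →+* D) (I : Ideal D) (n : ℕ) :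
    (I.comap f) ^ n ≤ (I ^ n).comap f := by
  induction n with
  | zero => rw [Submodule.pow_zero, Submodule.pow_zero, Ideal.one_eq_top, Ideal.one_eq_top, Ideal.comap_top]
  | succ n ih =>
    rw [Submodule.pow_succ, Ideal.mul_le]
    intro r hr s hs
    rw [Ideal.mem_comap, map_mul, Submodule.pow_succ]
    exact Ideal.mul_mem_mul (ih hr) hs

theorem isNilpotent_comap {D' : Type*} [Ring D'] (f : D' →+* D) (hf : Function.Injective f)
    {I : Ideal D} (hI : IsNilpotent I) : IsNilpotent (I.comap f) := by
  obtain ⟨n, hn⟩ := hI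
  refine ⟨n, ?_⟩
  change _ = ⊥
  refine eq_bot_iff.2 ((pow_comap_le f I n).trans ?_)
  rw [hn]
  intro x hx
  exact hf ((show f x = 0 from hx).trans (map_zero f).symm)

/-- One step of the lifting of an algebra homomorphism modulo a nilpotent ideal. -/
theorem SepElement.exists_section_step (σ : SepElement k Q ι) (p : D →ₐ[k] Q) (s : Q →ₗ[k] D)
    (hs : ∀ a, p (s a) = a) (n : ℕ) (hn : ∀ a b, s a * s b - s (a * b) ∈ RingHom.ker p ^ n) :
    ∃ s' : Q →ₗ[k] D, (∀ a, p (s' a) = a) ∧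
      ∀ a b, s' a * s' b - s' (a * b) ∈ RingHom.ker p ^ (n + 1) := by
  let f : Q →ₗ[k] Q →ₗ[k] D := (LinearMap.mul k D).compl₁₂ s s - (LinearMap.mul k Q).compr₂ s
  have hf (a b : Q) : f a b = s a * s b - s (a * b) := rfl
  have hfI (a b : Q) : f a b ∈ RingHom.ker p := by
    rw [RingHom.mem_ker, hf, map_sub, map_mul, hs, hs, hs, sub_self]
  have hfn (a b : Q) : f a b ∈ RingHom.ker p ^ n := hn a b
  -- The failure f of multiplicativity is a Hochschild 2-cocycle to leading order. Contracting it
  -- with the separability element gives a cochain h whose coboundary is f modulo the next power, so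
  -- s - h is the improved section.
  let h : Q →ₗ[k] D := ∑ i, LinearMap.mulLeft k (s (σ.x i)) ∘ₗ f (σ.y i)
  have hh (a : Q) : h a = ∑ i, s (σ.x i) * f (σ.y i) a := by
    simp [h]
  have hhI (a : Q) : h a ∈ RingHom.ker p := by
    rw [hh]
    exact sum_mem fun i _ => Ideal.mul_mem_left _ _ (hfI _ _)
  have hhn (a : Q) : h a ∈ RingHom.ker p ^ n := by
    rw [hh]
    exact sum_mem fun i _ => Ideal.mul_mem_left _ _ (hfn _ _)
  have e1 (a b : Q) : ∑ i, s (σ.x i) * f (σ.y i * a) b = ∑ i, s (a * σ.x i) * f (σ.y i) b :=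
    (σ.sum_eq (((LinearMap.mul k D).compl₁₂ s (f.flip b)) : Q →ₗ[k] Q →ₗ[k] D) a).symm
  have e2 (a b : Q) : h a * s b = s 1 * f a b + (∑ i, f (σ.x i) (σ.y i)) * f a b - s a * h b +
      ∑ i, f a (σ.x i) * f (σ.y i) b + h (a * b) := by
    have h1 (i : ι) : s (σ.x i) * f (σ.y i) a * s b = s (σ.x i * σ.y i) * f a b +
        f (σ.x i) (σ.y i) * f a b - s (σ.x i) * f (σ.y i * a) b +
        s (σ.x i) * f (σ.y i) (a * b) := by
      simp only [hf, mul_assoc, mul_sub, sub_mul]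
      abel
    have h2 (i : ι) : s (a * σ.x i) * f (σ.y i) b =
        s a * (s (σ.x i) * f (σ.y i) b) - f a (σ.x i) * f (σ.y i) b := by
      rw [hf a]
      simp only [sub_mul, mul_assoc]
      abel
    rw [hh a, Finset.sum_mul, Finset.sum_congr rfl fun i _ => h1 i]
    simp only [Finset.sum_add_distrib, Finset.sum_sub_distrib]
    rw [e1, ← Finset.sum_mul, ← map_sum, σ.sum_mul, Finset.sum_congr rfl fun i _ => h2 i,
      Finset.sum_sub_distrib, ← Finset.mul_sum, ← hh, ← hh, Finset.sum_mul]
    abel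
  refine ⟨s - h, fun a => ?_, fun a b => ?_⟩
  · rw [LinearMap.sub_apply, map_sub, hs, (RingHom.mem_ker).1 (hhI a), sub_zero]
  · have h1 : p (s 1 - 1) = 0 := by rw [map_sub, hs, map_one, sub_self]
    have e3 : (s - h) a * (s - h) b - (s - h) (a * b) =
        -((s 1 - 1) * f a b) - (∑ i, f (σ.x i) (σ.y i)) * f a b -
          ∑ i, f a (σ.x i) * f (σ.y i) b + h a * h b := by
      simp only [LinearMap.sub_apply]
      have h3 : (s a - h a) * (s b - h b) = f a b + s (a * b) - s a * h b - h a * s b +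
          h a * h b := by
        rw [hf]
        noncomm_ring
      rw [h3, e2]
      noncomm_ring
    have hmul {c d : D} (hc : c ∈ RingHom.ker p) (hd : d ∈ RingHom.ker p ^ n) :
        c * d ∈ RingHom.ker p ^ (n + 1) := by
      rw [Ideal.IsTwoSided.pow_succ]
      exact Ideal.mul_mem_mul hc hd
    rw [e3]
    exact add_mem (sub_mem (sub_mem (neg_mem (hmul h1 (hfn _ _)))
      (hmul (sum_mem fun i _ => hfI _ _) (hfn _ _)))
      (sum_mem fun i _ => hmul (hfI _ _) (hfn _ _))) (hmul (hhI _) (hhn _))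

/-- The Wedderburn principal theorem. -/
theorem SepElement.exists_section (σ : SepElement k Q ι) (p : D →ₐ[k] Q)
    (hp : Function.Surjective p) (hI : IsNilpotent (RingHom.ker p)) :
    ∃ s : Q →ₐ[k] D, ∀ a, p (s a) = a := by
  have step (n : ℕ) : ∃ s : Q →ₗ[k] D, (∀ a, p (s a) = a) ∧
      ∀ a b, s a * s b - s (a * b) ∈ RingHom.ker p ^ n := by
    induction n with
    | zero =>
      obtain ⟨s, hs⟩ := LinearMap.exists_rightInverse_of_surjective p.toLinearMap
        (LinearMap.range_eq_top.2 hp)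
      exact ⟨s, fun a => LinearMap.congr_fun hs a, fun a b => by
        rw [Submodule.pow_zero, Ideal.one_eq_top]
        exact Submodule.mem_top⟩
    | succ n ih =>
      obtain ⟨s, hs, hn⟩ := ih
      exact σ.exists_section_step p s hs n hn
  obtain ⟨n, hn⟩ := id hI
  obtain ⟨s, hs, hmul⟩ := step n
  have hmul' (a b : Q) : s (a * b) = s a * s b := by
    have := hmul a b
    rw [hn] at this
    exact (sub_eq_zero.1 this).symm
  -- 1 - s 1 is idempotent and lies in the nilpotent kernel, hence vanishes.
  have hone : s 1 = 1 := by
    have h1 : IsIdempotentElem (s 1) := by rw [IsIdempotentElem, ← hmul', one_mul]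
    have h2 : (1 - s 1) ∈ RingHom.ker p := by
      rw [RingHom.mem_ker, map_sub, map_one, hs, sub_self]
    exact (sub_eq_zero.1 (eq_zero_of_isIdempotentElem_of_isNilpotent h1.one_sub
      (isNilpotent_of_mem hI h2))).symm
  exact ⟨AlgHom.ofLinearMap s hone hmul', hs⟩

/-- Two homomorphisms from a separable algebra which agree modulo a nilpotent ideal are
conjugate. -/
theorem SepElement.exists_conj (σ : SepElement k Q ι) {I : Ideal D} [I.IsTwoSided]
    (hI : IsNilpotent I) (s t : Q →ₐ[k] D) (hst : ∀ a, s a - t a ∈ I) :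
    ∃ u : Dˣ, ∀ a, s a * u = u * t a := by
  -- The conjugating element is ∑ s(xᵢ) t(yᵢ). It intertwines s and t by the Casimir property, and
  -- it is 1 plus an element of the nilpotent ideal, hence a unit.
  have h1 : (∑ i, s (σ.x i) * t (σ.y i)) = 1 + ∑ i, s (σ.x i) * (t (σ.y i) - s (σ.y i)) := by
    simp only [mul_sub, Finset.sum_sub_distrib, ← map_mul]
    rw [← map_sum s, σ.sum_mul, map_one]
    abel
  have h2 : IsUnit (∑ i, s (σ.x i) * t (σ.y i)) := by
    rw [h1]
    refine (isNilpotent_of_mem hI (sum_mem fun i _ => I.mul_mem_left _ ?_)).isUnit_one_add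
    rw [← neg_sub]
    exact neg_mem (hst _)
  obtain ⟨u, hu⟩ := h2
  refine ⟨u, fun a => ?_⟩
  rw [hu]
  have := σ.sum_eq ((LinearMap.mul k D).compl₁₂ s.toLinearMap t.toLinearMap) a
  simpa [Finset.mul_sum, Finset.sum_mul, mul_assoc] using this

end Separable

/-- A subalgebra contains a maximal semisimple subalgebra if and only if it is dense modulo the
radical. -/
theorem exists_maximal_semisimple_iff {k A : Type u} [Field k] [IsAlgClosed k] [Ring A] [Algebra k A]
    [FiniteDimensional k A] (B : Subalgebra k A) :
    (∃ C : Subalgebra k A, Maximal (fun C : Subalgebra k A => IsSemisimpleRing C) C ∧ C ≤ B) ↔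
      ∀ a : A, ∃ b ∈ B, a - b ∈ Ring.jacobson A := by
  have : IsArtinianRing A := IsArtinianRing.of_finite k A
  have hI : IsNilpotent (Ring.jacobson A) := IsSemiprimaryRing.isNilpotent
  let p : A →ₐ[k] A ⧸ Ring.jacobson A := Ideal.Quotient.mkₐ k (Ring.jacobson A)
  have hp : Function.Surjective p := Ideal.Quotient.mkₐ_surjective k _
  have hpk (a : A) : p a = 0 ↔ a ∈ Ring.jacobson A := Ideal.Quotient.eq_zero_iff_mem
  have hker : RingHom.ker p = Ring.jacobson A := Ideal.ext hpk
  have : FiniteDimensional k (A ⧸ Ring.jacobson A) := Module.Finite.of_surjective p.toLinearMap hp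
  have : IsSemisimpleRing (A ⧸ Ring.jacobson A) := IsSemiprimaryRing.isSemisimpleRing
  obtain ⟨ι, _, ⟨σ⟩⟩ := exists_sepElement (k := k) (A ⧸ Ring.jacobson A)
  have hrange {E : Type u} [Ring E] [Algebra k E] (s : (A ⧸ Ring.jacobson A) →ₐ[k] E) :
      IsSemisimpleRing s.range :=
    RingHom.isSemisimpleRing_of_surjective s.rangeRestrict.toRingHom s.rangeRestrict_surjective
  constructor
  · rintro ⟨C, hC, hCB⟩ a
    obtain ⟨s, hs⟩ := σ.exists_section p hp (by rwa [hker])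
    have := hC.prop
    obtain ⟨ι', _, ⟨σ'⟩⟩ := exists_sepElement (k := k) C
    -- The inclusion of C and c ↦ s(p c) agree modulo the radical, so they are conjugate by some u.
    -- Thus C lies in the semisimple conjugate u⁻¹ s(A / rad A) u, equals it by maximality, and is
    -- dense.
    obtain ⟨u, hu⟩ := σ'.exists_conj hI ((s.comp p).comp C.val) C.val fun c => by
      rw [← hpk, map_sub]
      exact sub_eq_zero.2 (hs _)
    let t : (A ⧸ Ring.jacobson A) →ₐ[k] A := AlgHom.ofLinearMap
      (LinearMap.mulLeft k (↑u⁻¹ : A) ∘ₗ LinearMap.mulRight k (u : A) ∘ₗ s.toLinearMap)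
      (by simp) (fun x y => by simp [mul_assoc])
    have ht (x : A ⧸ Ring.jacobson A) : t x = ↑u⁻¹ * (s x * u) := rfl
    have hCt : C ≤ t.range := fun c hc => ⟨p c, by
      refine (ht _).trans ?_
      rw [Units.inv_mul_eq_iff_eq_mul]
      exact hu ⟨c, hc⟩⟩
    have htC : t.range ≤ C := hC.le_of_ge (hrange t) hCt
    refine ⟨t (p (u * a * ↑u⁻¹)), hCB (htC ⟨p (u * a * ↑u⁻¹), rfl⟩), ?_⟩
    rw [← hpk, map_sub, ht, map_mul, map_mul, hs, ← map_mul, ← map_mul]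
    simp [mul_assoc]
  · intro h
    have : FiniteDimensional k B := inferInstance
    obtain ⟨s, hs⟩ := σ.exists_section (p.comp B.val) (fun x => by
      obtain ⟨a, rfl⟩ := hp x
      obtain ⟨b, hb, hab⟩ := h a
      rw [← hpk, map_sub, sub_eq_zero] at hab
      exact ⟨⟨b, hb⟩, hab.symm⟩) (by
      have : RingHom.ker (p.comp B.val) = (Ring.jacobson A).comap (incl B) :=
        Ideal.ext fun b => hpk b
      rw [this]
      exact isNilpotent_comap _ Subtype.val_injective hI)
    refine ⟨(B.val.comp s).range, ⟨hrange _, ?_⟩, ?_⟩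
    · intro D hD hCD d hd
      have := hD
      let d' : A := B.val (s (p d))
      have hd' : d' ∈ (B.val.comp s).range := ⟨p d, rfl⟩
      -- A semisimple subalgebra D meets the radical of A in zero: the intersection is generated by
      -- an idempotent, and that idempotent is nilpotent. So an element of D containing the section
      -- is fixed by d ↦ s(p d).
      obtain ⟨e, he, heI⟩ := IsSemisimpleRing.ideal_eq_span_idempotent
        ((Ring.jacobson A).comap (incl D))
      have he0 : e = 0 := by
        refine eq_zero_of_isIdempotentElem_of_isNilpotent he (isNilpotent_of_mem
          (isNilpotent_comap (incl D) Subtype.val_injective hI) ?_)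
        rw [heI]
        exact Ideal.mem_span_singleton_self e
      have hmem : (⟨d, hd⟩ - ⟨d', hCD hd'⟩ : D) ∈ (Ring.jacobson A).comap (incl D) := by
        change d - d' ∈ Ring.jacobson A
        rw [← hpk, map_sub]
        exact sub_eq_zero.2 (hs (p d)).symm
      rw [heI, he0, Ideal.span_singleton_eq_bot.2 rfl] at hmem
      have : d = d' := congrArg Subtype.val (sub_eq_zero.1 hmem)
      rw [this]
      exact hd'
    · rintro _ ⟨x, rfl⟩
      exact (s x).2

/-! ### The radical of a Frobenius extension -/

namespace FrobExt

variable {R T : Type u} [Ring R] [Ring T] {ι : Type*} [Fintype ι] (E : FrobExt R T ι)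

/-- T / rad T stays semisimple on restriction to R, so rad R annihilates the class of 1. -/
theorem j_mem_jacobson [IsArtinianRing R] [IsArtinianRing T] {r : R} (hr : r ∈ Ring.jacobson R) :
    E.j r ∈ Ring.jacobson T := by
  have : IsSemisimpleRing (T ⧸ Ring.jacobson T) := IsSemiprimaryRing.isSemisimpleRing
  have hss : IsSemisimpleModule T (ModuleCat.of T (T ⧸ Ring.jacobson T)) := by
    refine isSemisimpleModule_of_jacobson_smul fun t ht m => ?_
    obtain ⟨m, rfl⟩ := Ideal.Quotient.mk_surjective m
    exact Ideal.Quotient.eq_zero_iff_mem.2 (Ideal.mul_mem_right _ _ ht)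
  have h2 : IsSemisimpleModule R (E.res.obj (ModuleCat.of T (T ⧸ Ring.jacobson T))) :=
    E.isSemisimpleModule_res _ hss
  have h3 := jacobson_smul_eq_zero (M := E.res.obj (ModuleCat.of T (T ⧸ Ring.jacobson T))) hr
    (Ideal.Quotient.mk _ 1)
  have h4 : (Ideal.Quotient.mk (Ring.jacobson T) (E.j r * 1)) = 0 := h3
  rwa [mul_one, Ideal.Quotient.eq_zero_iff_mem] at h4

/-- Induction keeps R / rad R semisimple, so t kills 1 ⊗ 1; the coefficient map then reads off that
c t vanishes modulo rad R. -/
theorem c_mem_jacobson [IsArtinianRing R] [IsArtinianRing T] {t : T} (ht : t ∈ Ring.jacobson T) :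
    E.c t ∈ Ring.jacobson R := by
  have hss : IsSemisimpleModule R (ModuleCat.of R (R ⧸ Ring.jacobson R)) := by
    refine isSemisimpleModule_of_jacobson_smul fun t ht m => ?_
    obtain ⟨m, rfl⟩ := Ideal.Quotient.mk_surjective m
    exact Ideal.Quotient.eq_zero_iff_mem.2 (Ideal.mul_mem_right _ _ ht)
  have h2 := E.isSemisimpleModule_induction _ hss
  have h3 := jacobson_smul_eq_zero
    (M := (induction E.j).obj (ModuleCat.of R (R ⧸ Ring.jacobson R))) ht
    (tensorMk E.j 1 (Ideal.Quotient.mk (Ring.jacobson R) 1))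
  have h4 := congrArg (E.coeffMap (ModuleCat.of R (R ⧸ Ring.jacobson R))) h3
  replace h4 : E.coeffMap (ModuleCat.of R (R ⧸ Ring.jacobson R))
      (tensorMk E.j (t * 1) (Ideal.Quotient.mk (Ring.jacobson R) 1)) = 0 := h4.trans (map_zero _)
  rw [mul_one, coeffMap_mk] at h4
  have h5 : (Ideal.Quotient.mk (Ring.jacobson R) (E.c t * 1)) = 0 := h4
  rwa [mul_one, Ideal.Quotient.eq_zero_iff_mem] at h5

/-- Density modulo the radical is compatible with Frobenius extensions. -/
theorem Hom.dense_iff {S U : Type u} [Ring S] [Ring U] {E : FrobExt S U ι} {E' : FrobExt R T ι}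
    {φ : S →+* R} {ψ : U →+* T} (h : E.Hom E' φ ψ) [IsArtinianRing R] [IsArtinianRing T] :
    (∀ a, ∃ b, a - φ b ∈ Ring.jacobson R) ↔ ∀ t, ∃ d, t - ψ d ∈ Ring.jacobson T := by
  constructor
  · intro H t
    choose b hb using fun g => H (E'.c (E'.v g * t))
    refine ⟨∑ g, E.u g * E.j (b g), ?_⟩
    have : t - ψ (∑ g, E.u g * E.j (b g)) =
        ∑ g, E'.u g * E'.j (E'.c (E'.v g * t) - φ (b g)) := by
      conv_lhs => rw [← E'.sum_left t]
      rw [map_sum, ← Finset.sum_sub_distrib]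
      refine Finset.sum_congr rfl fun g _ => ?_
      rw [map_mul ψ, h.map_u, h.map_j, map_sub, mul_sub]
    rw [this]
    exact sum_mem fun g _ => Ideal.mul_mem_left _ _ (E'.j_mem_jacobson (hb g))
  · intro H a
    obtain ⟨d, hd⟩ := H (E'.j a)
    refine ⟨E.c d, ?_⟩
    have := E'.c_mem_jacobson hd
    rwa [map_sub, c_j, ← h.map_c] at this

end FrobExt

/-! ### Transfer of exact Borel subalgebras -/

section Transfer

variable {C D R T : Type u} [Ring C] [Ring D] [Ring R] [Ring T] [IsArtinianRing C]
  {P : FrobPair C D}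
  {P' : FrobPair R T} {F : ModuleCat.{u} C ⥤ ModuleCat.{u} R}
  {F' : ModuleCat.{u} D ⥤ ModuleCat.{u} T}

theorem FrobSquare.surjective_mapExt_simple (sq : FrobSquare P P' F F') [F.Additive]
    [Limits.PreservesFiniteLimits F] [Limits.PreservesFiniteColimits F] [F'.Additive]
    [Limits.PreservesFiniteLimits F'] [Limits.PreservesFiniteColimits F'] {n : ℕ}
    (h : ∀ L L' : Sim C, Function.Surjective (F.mapExtAddHom L.rep L'.rep n :
      Abelian.Ext.{u} L.rep L'.rep n → Abelian.Ext.{u} _ _ n)) (S S' : Sim D) :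
    Function.Surjective (F'.mapExtAddHom S.rep S'.rep n :
      Abelian.Ext.{u} S.rep S'.rep n → Abelian.Ext.{u} _ _ n) :=
  sq.surjective_mapExt (surjective_mapExt_of_simple F h (P.finU _ inferInstance)
    (P.ssU _ inferInstance) (P.finU _ inferInstance) (P.ssU _ inferInstance))

theorem FrobSquare.injective_mapExt_simple (sq : FrobSquare P P' F F') [F.Additive]
    [Limits.PreservesFiniteLimits F] [Limits.PreservesFiniteColimits F] [F'.Additive]
    [Limits.PreservesFiniteLimits F'] [Limits.PreservesFiniteColimits F'] {n : ℕ}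
    (h : ∀ L L' : Sim C, Function.Injective (F.mapExtAddHom L.rep L'.rep n :
      Abelian.Ext.{u} L.rep L'.rep n → Abelian.Ext.{u} _ _ n)) (S S' : Sim D) :
    Function.Injective (F'.mapExtAddHom S.rep S'.rep n :
      Abelian.Ext.{u} S.rep S'.rep n → Abelian.Ext.{u} _ _ n) :=
  sq.injective_mapExt (injective_mapExt_of_simple F h (P.finU _ inferInstance)
    (P.ssU _ inferInstance) (P.finU _ inferInstance) (P.ssU _ inferInstance))

end Transfer

section ExtTransfer

variable {C D R T : Type u} [Ring C] [Ring D] [Ring R] [Ring T] [IsArtinianRing C]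
  {P : FrobPair C D}
  {P' : FrobPair R T} {φ : C →+* R} {ψ : D →+* T}

theorem FrobSquare.surjective_inductionExtMap
    (sq : FrobSquare P P' (induction φ) (induction ψ)) (hφ : IsRightProjective φ)
    (hψ : IsRightProjective ψ) {n : ℕ}
    (h : ∀ L L' : Sim C, Function.Surjective (inductionExtMap hφ L.rep L'.rep n)) (S S' : Sim D) :
    Function.Surjective (inductionExtMap hψ S.rep S'.rep n) := by
  have := (induction_exact hφ).1
  have := (induction_exact hφ).2
  have := (induction_exact hψ).1
  have := (induction_exact hψ).2
  exact sq.surjective_mapExt_simple h S S'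

theorem FrobSquare.injective_inductionExtMap
    (sq : FrobSquare P P' (induction φ) (induction ψ)) (hφ : IsRightProjective φ)
    (hψ : IsRightProjective ψ) {n : ℕ}
    (h : ∀ L L' : Sim C, Function.Injective (inductionExtMap hφ L.rep L'.rep n)) (S S' : Sim D) :
    Function.Injective (inductionExtMap hψ S.rep S'.rep n) := by
  have := (induction_exact hφ).1
  have := (induction_exact hφ).2
  have := (induction_exact hψ).1
  have := (induction_exact hψ).2
  exact sq.injective_mapExt_simple h S S'

theorem FrobSquare.surjective_inductionExtMap_iff [IsArtinianRing D]
    (sq : FrobSquare P P' (induction φ) (induction ψ)) (hφ : IsRightProjective φ)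
    (hψ : IsRightProjective ψ) {n : ℕ} :
    (∀ L L' : Sim C, Function.Surjective (inductionExtMap hφ L.rep L'.rep n)) ↔
      ∀ S S' : Sim D, Function.Surjective (inductionExtMap hψ S.rep S'.rep n) :=
  ⟨sq.surjective_inductionExtMap hφ hψ, sq.swap.surjective_inductionExtMap hψ hφ⟩

theorem FrobSquare.bijective_inductionExtMap_iff [IsArtinianRing D]
    (sq : FrobSquare P P' (induction φ) (induction ψ)) (hφ : IsRightProjective φ)
    (hψ : IsRightProjective ψ) {n : ℕ} :
    (∀ L L' : Sim C, Function.Bijective (inductionExtMap hφ L.rep L'.rep n)) ↔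
      ∀ S S' : Sim D, Function.Bijective (inductionExtMap hψ S.rep S'.rep n) :=
  ⟨fun h S S' => ⟨sq.injective_inductionExtMap hφ hψ (fun L L' => (h L L').1) S S',
    sq.surjective_inductionExtMap hφ hψ (fun L L' => (h L L').2) S S'⟩,
   fun h L L' => ⟨sq.swap.injective_inductionExtMap hψ hφ (fun S S' => (h S S').1) L L',
    sq.swap.surjective_inductionExtMap hψ hφ (fun S S' => (h S S').2) L L'⟩⟩

end ExtTransfer

/-! ### Borel conditions with the order on the subalgebra eliminated -/

section Criterion

variable {k A : Type u} [Field k] [IsAlgClosed k] [Ring A] [Algebra k A] [FiniteDimensional k A]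

/-- The order on the simple B-modules is pulled back along Y ↦ top of A ⊗_B Y, so it need not be
given in advance. -/
theorem exists_isExactBorel_iff {leA : PartialOrder (Sim A)} (hA : IsQuasiHereditary k leA)
    (B : Subalgebra k A) : (∃ leB, IsExactBorel leA B leB) ↔
      IsRightProjective (incl B) ∧ IsBorelFunctor (induction (incl B)) leA := by
  have : IsArtinianRing A := IsArtinianRing.of_finite k A
  have : IsArtinianRing B := IsArtinianRing.of_finite k B
  constructor
  · rintro ⟨leB, h⟩
    obtain ⟨i, hi, hF⟩ := h.standard
    have := (induction_exact h.projective).1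
    have := (induction_exact h.projective).2
    exact ⟨h.projective, IsBorelFunctor.of_isStandard (induction_map_scalarEnd B) hA.adapted
      h.directed i hi hF⟩
  · rintro ⟨hp, h⟩
    obtain ⟨leB, hd, i, hi, hF⟩ := h.exists_order hA.adapted fun Y =>
      finite_tensorOver (incl B) Y.rep
    exact ⟨leB, hA, hp, hd, i, hi, hF⟩

theorem exists_isStrongExactBorel_iff {leA : PartialOrder (Sim A)} (B : Subalgebra k A) :
    (∃ leB, IsStrongExactBorel leA B leB) ↔
      (∃ leB, IsExactBorel leA B leB) ∧ ∀ a, ∃ b : B, a - incl B b ∈ Ring.jacobson A := by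
  have h := exists_maximal_semisimple_iff B
  constructor
  · rintro ⟨leB, hB⟩
    refine ⟨⟨leB, hB.toIsExactBorel⟩, fun a => ?_⟩
    obtain ⟨b, hb, hab⟩ := h.1 hB.strong a
    exact ⟨⟨b, hb⟩, hab⟩
  · rintro ⟨⟨leB, hB⟩, hd⟩
    exact ⟨leB, hB, h.2 fun a => let ⟨b, hb⟩ := hd a; ⟨b, b.2, hb⟩⟩

/-- Normality is automatic, because the splitting always exists. -/
theorem exists_isNormalExactBorel_iff {leA : PartialOrder (Sim A)} (B : Subalgebra k A) :
    (∃ leB, IsNormalExactBorel leA B leB) ↔ ∃ leB, IsExactBorel leA B leB :=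
  ⟨fun ⟨leB, h⟩ => ⟨leB, h.toIsExactBorel⟩, fun ⟨leB, h⟩ => ⟨leB, h, h.exists_splitting⟩⟩

omit [IsAlgClosed k] [FiniteDimensional k A] in
theorem exists_isHomologicalExactBorel_iff {leA : PartialOrder (Sim A)} (B : Subalgebra k A)
    (hp : IsRightProjective (incl B)) : (∃ leB, IsHomologicalExactBorel leA B leB) ↔
      (∃ leB, IsExactBorel leA B leB) ∧
        (∀ L L' : Sim B, Function.Surjective (inductionExtMap hp L.rep L'.rep 1)) ∧
        ∀ n, 2 ≤ n → ∀ L L' : Sim B, Function.Bijective (inductionExtMap hp L.rep L'.rep n) :=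
  ⟨fun ⟨leB, h⟩ => ⟨⟨leB, h.toIsExactBorel⟩, h.ext_one, fun n hn L L' => h.ext_ge_two L L' n hn⟩,
    fun ⟨⟨leB, h⟩, h1, h2⟩ => ⟨leB, h, h1, fun L L' n hn => h2 n hn L L'⟩⟩

theorem exists_isRegularExactBorel_iff {leA : PartialOrder (Sim A)} (B : Subalgebra k A)
    (hp : IsRightProjective (incl B)) : (∃ leB, IsRegularExactBorel leA B leB) ↔
      (∃ leB, IsExactBorel leA B leB) ∧
        ∀ n, 1 ≤ n → ∀ L L' : Sim B, Function.Bijective (inductionExtMap hp L.rep L'.rep n) :=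
  ⟨fun ⟨leB, h⟩ => ⟨⟨leB, h.toIsExactBorel⟩, fun n hn L L' => h.ext_ge_one L L' n hn⟩,
    fun ⟨⟨leB, h⟩, h1⟩ => ⟨leB, ⟨h, h.exists_splitting⟩, fun L L' n hn => h1 n hn L L'⟩⟩

end Criterion

/-! ### Application to skew group algebras -/

section Skew

variable {k A G : Type u} [Field k] [IsAlgClosed k] [Ring A] [Algebra k A]
  [FiniteDimensional k A] [Group G] [MulSemiringAction G A] [SMulCommClass G k A]

/-- The skew group algebra is quasi-hereditary for the induced order. -/
theorem isQuasiHereditary_inducedOrder [Finite G] (hG : (Nat.card G : k) ≠ 0)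
    {le : PartialOrder (Sim A)} (hle : IsEquivariantOrder G le) (hA : IsQuasiHereditary k le) :
    IsQuasiHereditary k (inducedOrder (A := A) (G := G) k le) := by
  have := Fintype.ofFinite G
  have : IsArtinianRing A := IsArtinianRing.of_finite k A
  have : FiniteDimensional k (SkewMonoidAlgebra A G) := finiteDimensional_skew k A G
  have : IsArtinianRing (SkewMonoidAlgebra A G) := IsArtinianRing.of_finite k _
  exact (orderCompat_inducedOrder hG hle).isQuasiHereditary (tensorOverSelf _) hA

variable {B : Subalgebra k A} (hB : ∀ g : G, B.map (MulSemiringAction.toAlgHom k A g) = B)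

omit [IsAlgClosed k] in
theorem isRightProjective_skewSubalgebra_iff [Finite G] (hG : (Nat.card G : k) ≠ 0) :
    IsRightProjective (incl (skewSubalgebra B hB)) ↔ IsRightProjective (incl B) := by
  have := Fintype.ofFinite G
  have : FiniteDimensional k (SkewMonoidAlgebra A G) := finiteDimensional_skew k A G
  have H := skewSubExt_hom hB hG
  exact ⟨fun h => (H.hasRightDualBasis_of h.hasRightDualBasis_incl).isRightProjective,
    fun h => (H.hasRightDualBasis h.hasRightDualBasis_incl).isRightProjective⟩

theorem exists_isExactBorel_skew_iff [Finite G] (hG : (Nat.card G : k) ≠ 0)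
    {le : PartialOrder (Sim A)} (hle : IsEquivariantOrder G le) (hA : IsQuasiHereditary k le) :
    (∃ leB, IsExactBorel le B leB) ↔
      ∃ leBG, IsExactBorel (inducedOrder k le) (skewSubalgebra B hB) leBG := by
  have := Fintype.ofFinite G
  have : IsArtinianRing A := IsArtinianRing.of_finite k A
  have : IsArtinianRing B := IsArtinianRing.of_finite k B
  have : FiniteDimensional k (SkewMonoidAlgebra A G) := finiteDimensional_skew k A G
  have : IsArtinianRing (SkewMonoidAlgebra A G) := IsArtinianRing.of_finite k _
  have : IsArtinianRing (skewSubalgebra B hB) := IsArtinianRing.of_finite k _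
  have sq := (skewSubExt_hom hB hG).frobSquare
  have hord := orderCompat_inducedOrder (A := A) (G := G) hG hle
  rw [exists_isExactBorel_iff hA, exists_isExactBorel_iff (isQuasiHereditary_inducedOrder hG hle hA),
    isRightProjective_skewSubalgebra_iff hB hG]
  exact and_congr_right' ⟨sq.isBorelFunctor hord fun M _ => finite_tensorOver (incl B) M,
    sq.swap.isBorelFunctor hord.swap fun M _ => finite_tensorOver (incl (skewSubalgebra B hB)) M⟩

omit [IsAlgClosed k] in
theorem surjective_inductionExtMap_skew_iff [Finite G] (hG : (Nat.card G : k) ≠ 0)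
    (hp : IsRightProjective (incl B)) (hp' : IsRightProjective (incl (skewSubalgebra B hB)))
    (n : ℕ) :
    (∀ L L' : Sim B, Function.Surjective (inductionExtMap hp L.rep L'.rep n)) ↔
      ∀ S S' : Sim (skewSubalgebra B hB),
        Function.Surjective (inductionExtMap hp' S.rep S'.rep n) := by
  have := Fintype.ofFinite G
  have : IsArtinianRing A := IsArtinianRing.of_finite k A
  have : IsArtinianRing B := IsArtinianRing.of_finite k B
  have : FiniteDimensional k (SkewMonoidAlgebra A G) := finiteDimensional_skew k A G
  have : IsArtinianRing (SkewMonoidAlgebra A G) := IsArtinianRing.of_finite k _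
  have : IsArtinianRing (skewSubalgebra B hB) := IsArtinianRing.of_finite k _
  exact (skewSubExt_hom hB hG).frobSquare.surjective_inductionExtMap_iff hp hp'

omit [IsAlgClosed k] in
theorem bijective_inductionExtMap_skew_iff [Finite G] (hG : (Nat.card G : k) ≠ 0)
    (hp : IsRightProjective (incl B)) (hp' : IsRightProjective (incl (skewSubalgebra B hB)))
    (n : ℕ) :
    (∀ L L' : Sim B, Function.Bijective (inductionExtMap hp L.rep L'.rep n)) ↔
      ∀ S S' : Sim (skewSubalgebra B hB),
        Function.Bijective (inductionExtMap hp' S.rep S'.rep n) := by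
  have := Fintype.ofFinite G
  have : IsArtinianRing A := IsArtinianRing.of_finite k A
  have : IsArtinianRing B := IsArtinianRing.of_finite k B
  have : FiniteDimensional k (SkewMonoidAlgebra A G) := finiteDimensional_skew k A G
  have : IsArtinianRing (SkewMonoidAlgebra A G) := IsArtinianRing.of_finite k _
  have : IsArtinianRing (skewSubalgebra B hB) := IsArtinianRing.of_finite k _
  exact (skewSubExt_hom hB hG).frobSquare.bijective_inductionExtMap_iff hp hp'

end Skew

end QHSkew

open QHSkew in
theorem mainTheorem3 {k A G : Type u} [Field k] [IsAlgClosed k] [Ring A] [Algebra k A]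
    [FiniteDimensional k A] [Group G] [Finite G] [MulSemiringAction G A] [SMulCommClass G k A]
    (hG : (Nat.card G : k) ≠ 0)
    (leA : PartialOrder (Sim A)) (hleA : IsEquivariantOrder G leA)
    (hA : IsQuasiHereditary k leA)
    (B : Subalgebra k A) (hB : ∀ g : G, B.map (MulSemiringAction.toAlgHom k A g) = B) :
    ((∃ leB : PartialOrder (Sim B), IsStrongExactBorel leA B leB) ↔
      ∃ leBG : PartialOrder (Sim (skewSubalgebra B hB)),
        IsStrongExactBorel (inducedOrder k leA) (skewSubalgebra B hB) leBG) ∧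
    ((∃ leB : PartialOrder (Sim B), IsNormalExactBorel leA B leB) ↔
      ∃ leBG : PartialOrder (Sim (skewSubalgebra B hB)),
        IsNormalExactBorel (inducedOrder k leA) (skewSubalgebra B hB) leBG) ∧
    ((∃ leB : PartialOrder (Sim B), IsHomologicalExactBorel leA B leB) ↔
      ∃ leBG : PartialOrder (Sim (skewSubalgebra B hB)),
        IsHomologicalExactBorel (inducedOrder k leA) (skewSubalgebra B hB) leBG) ∧
    ((∃ leB : PartialOrder (Sim B), IsRegularExactBorel leA B leB) ↔
      ∃ leBG : PartialOrder (Sim (skewSubalgebra B hB)),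
        IsRegularExactBorel (inducedOrder k leA) (skewSubalgebra B hB) leBG) := by
  have := Fintype.ofFinite G
  have : IsArtinianRing A := IsArtinianRing.of_finite k A
  have : FiniteDimensional k (SkewMonoidAlgebra A G) := finiteDimensional_skew k A G
  have : IsArtinianRing (SkewMonoidAlgebra A G) := IsArtinianRing.of_finite k _
  have hex := exists_isExactBorel_skew_iff hB hG hleA hA
  have hproj := isRightProjective_skewSubalgebra_iff hB hG
  refine ⟨?_, ?_, ?_, ?_⟩
  · rw [exists_isStrongExactBorel_iff, exists_isStrongExactBorel_iff, hex]
    exact and_congr_right' (skewSubExt_hom hB hG).dense_iff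
  · rw [exists_isNormalExactBorel_iff, exists_isNormalExactBorel_iff, hex]
  -- The maps on Ext are defined only under right projectivity. If it fails, it fails on both sides
  -- and neither structure exists.
  · by_cases hp : IsRightProjective (incl B)
    · rw [exists_isHomologicalExactBorel_iff B hp,
        exists_isHomologicalExactBorel_iff _ (hproj.2 hp), hex,
        surjective_inductionExtMap_skew_iff hB hG hp (hproj.2 hp)]
      simp only [bijective_inductionExtMap_skew_iff hB hG hp (hproj.2 hp)]
    · exact iff_of_false (fun ⟨_, h⟩ => hp h.projective) fun ⟨_, h⟩ => hp (hproj.1 h.projective)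
  · by_cases hp : IsRightProjective (incl B)
    · rw [exists_isRegularExactBorel_iff B hp,
        exists_isRegularExactBorel_iff _ (hproj.2 hp), hex]
      simp only [bijective_inductionExtMap_skew_iff hB hG hp (hproj.2 hp)]
    · exact iff_of_false (fun ⟨_, h⟩ => hp h.projective) fun ⟨_, h⟩ => hp (hproj.1 h.projective)
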